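/- Let $\mathbb{T}^n=\mathbb{R}^n/\mathbb{Z}^n$ with its flat metric, identify every tangent space with $\mathbb{R}^n$, and let $f:\mathbb{T}^n\to\mathbb{T}^n$ be a $C^1$ local diffeomorphism that is partially hyperbolic with expanding extremal direction, i.e. for some $0<d<n$ there are (a) a continuous subbundle $\mathbb{E}^c$ of the tangent bundle of rank $d$ that is invariant: $Df(x)\,\mathbb{E}^c_x=\mathbb{E}^c_{f(x)}$ for all $x$; (b) a continuous cone field $\mathcal{C}^u$ (each $\mathcal{C}^u_x$ is the image under a linear isomorphism of a standard cone $\{(u,w)\in\mathbb{R}^p\times\mathbb{R}^q:\|w\|\le\|u\|\}$, $p+q=n$; equivalently, $\mathcal{C}^u_x=\{v: Q_x(v)\ge 0\}$ with nondegenerate quadratic forms $Q_x$ depending continuously on $x$) that is unstable: $Df(x)\,\mathcal{C}^u_x\subset\mathcal{C}^u_{f(x)}$ for all $x$; and it is complementary to $\mathbb{E}^c$: for every inverse path $(x_k)_{k\ge0}$, $f(x_{k+1})=x_k$, there are subspaces $S_k\subset\mathcal{C}^u_{x_k}$ of dimension $n-d$ with $Df(x_{k+1})S_{k+1}=S_k$;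 (c) a constant $0<\lambda<1$ such that for every $x'\in\mathbb{T}^n$ and every unit vector $v\in\mathcal{C}^u_{x}$, where $x=f(x')$ and $\varphi$ is the local inverse branch of $f$ with $\varphi(x)=x'$, one has $\|D\varphi(x)v\|<\lambda$ and $\|Df(x')|_{\mathbb{E}^c_{x'}}\|\,\|D\varphi(x)v\|<\lambda$. By a disc tangent to the unstable cones we mean an $(n-d)$-dimensional $C^1$ disc $\gamma$, that is, the projection to $\mathbb{T}^n$ of a $C^1$-embedded closed ball in the universal cover $\mathbb{R}^n$, with $T_y\gamma\subset\mathcal{C}^u_y$ at each of its points $y$. Its internal diameter is twice its inner radius, the latter being the largest intrinsic distance (infimum of lengths of curves inside the disc) from a point of the disc to its boundary. Write $m\{L\}=\min_{\|v\|=1}\|Lv\|$. Suppose that: 1. $\{w\in f^{-k}(x):k\in\mathbb{N}\}$ is dense in $\mathbb{T}^n$ for every $x\in\mathbb{T}^n$. 2. There exist $\delta_0>0$, $\lambda_0>1$ and $k_0\in\mathbb{N}$ such that every disc $\gamma$ tangent to the unstable cones with internal diameter larger than $\delta_0$ contains a point $y$ with $m\{Df^i|_{\mathbb{E}^c_{f^k(y)}}\}>\lambda_0^i$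 for all $i>0$ and all $k>k_0$. Then there is $\varepsilon>0$ such that for every $C^1$ map $g:\mathbb{T}^n\to\mathbb{T}^n$ with $\mathrm{dist}(f(x),g(x))<\varepsilon$ and $\|Df(x)-Dg(x)\|<\varepsilon$ for all $x$, the set $\{w\in g^{-k}(x):k\in\mathbb{N}\}$ is dense in $\mathbb{T}^n$ for every $x\in\mathbb{T}^n$. -/

import Mathlib

open scoped ENNReal

/-- Euclidean space `ℝⁿ`: the universal cover of the torus, and its tangent space at every point. -/
abbrev Euc (n : ℕ) : Type := EuclideanSpace ℝ (Fin n)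

/-- The torus `𝕋ⁿ = (ℝ/ℤ)ⁿ`. -/
abbrev Torus (n : ℕ) : Type := UnitAddTorus (Fin n)

/-- The universal covering `ℝⁿ → 𝕋ⁿ`. -/
def toTorus {n : ℕ} (v : Euc n) : Torus n := fun i => ((v i : ℝ) : UnitAddCircle)

/-- The representative in `(-1/2, 1/2]ⁿ` of a point of the torus, a local inverse of `toTorus`
near `0`. -/
noncomputable def torusLog {n : ℕ} (x : Torus n) : Euc n :=
  WithLp.toLp 2 fun i => (AddCircle.equivIoc (1 : ℝ) (-(1 / 2)) (x i) : ℝ)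

/-- `F` is a `C¹` lift of `f` to the universal cover. -/
def IsC1Lift {n : ℕ} (F : Euc n → Euc n) (f : Torus n → Torus n) : Prop :=
  ContDiff ℝ 1 F ∧ ∀ v, toTorus (F v) = f (toTorus v)

/-- `f` is a `C¹` endomorphism of the torus. -/
def IsC1 {n : ℕ} (f : Torus n → Torus n) : Prop := ∃ F, IsC1Lift F f

/-- The derivative `Df(x) : ℝⁿ → ℝⁿ` of a map of the torus, the tangent spaces being identified
with `ℝⁿ` by translation. It is the derivative of any lift, see `IsC1Lift.torusDeriv_eq`. -/
noncomputable def torusDeriv {n : ℕ} (f : Torus n → Torus n) (x : Torus n) : Euc n →L[ℝ] Euc n :=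
  fderiv ℝ (fun v : Euc n => torusLog (f (x + toTorus v) - f x)) 0

theorem torusLog_toTorus {n : ℕ} (v : Euc n) (h : ‖v‖ < 1 / 2) : torusLog (toTorus v) = v := by
  ext i
  have hi : |v i| < 1 / 2 := lt_of_le_of_lt (by simpa using PiLp.norm_apply_le v i) h
  rw [abs_lt] at hi
  have hm : v i ∈ Set.Ioc (-(1 / 2) : ℝ) (-(1 / 2) + 1) := ⟨hi.1, by linarith [hi.2]⟩
  show ((AddCircle.equivIoc (1 : ℝ) (-(1 / 2)) ((v i : ℝ) : UnitAddCircle)) : ℝ) = v i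
  have := AddCircle.equivIoc_coe_eq hm
  simpa using congrArg Subtype.val this

theorem IsC1Lift.torusDeriv_eq {n : ℕ} {F : Euc n → Euc n} {f : Torus n → Torus n}
    (h : IsC1Lift F f) (a : Euc n) : torusDeriv f (toTorus a) = fderiv ℝ F a := by
  have hd : HasFDerivAt F (fderiv ℝ F a) a :=
    ((h.1.differentiable (by norm_num)) a).hasFDerivAt
  have hd' : HasFDerivAt (fun v : Euc n => F (a + v) - F a) (fderiv ℝ F a) 0 := by
    have hd0 : HasFDerivAt F (fderiv ℝ F a) (a + 0) := by simpa using hd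
    exact (((hasFDerivAt_comp_add_left a).2 hd0)).sub_const (F a)
  refine HasFDerivAt.fderiv (hd'.congr_of_eventuallyEq ?_)
  have hc : Filter.Tendsto (fun v : Euc n => F (a + v) - F a) (nhds 0) (nhds 0) := by
    simpa using hd'.continuousAt.tendsto
  filter_upwards [hc (Metric.ball_mem_nhds 0 (by norm_num : (0 : ℝ) < 1 / 2))] with v hv
  have hv' : ‖F (a + v) - F a‖ < 1 / 2 := by simpa using hv
  rw [← torusLog_toTorus _ hv']
  congr 1
  have e1 : toTorus a + toTorus v = toTorus (a + v) := by
    funext i; simp [toTorus]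
  rw [e1, ← h.2, ← h.2]
  funext i; simp [toTorus]

/-- A `C¹` local diffeomorphism of the torus. -/
def IsLocalDiffeo {n : ℕ} (f : Torus n → Torus n) : Prop :=
  IsC1 f ∧ ∀ x, Function.Bijective (torusDeriv f x)

/-- The pre-orbit `{w ∈ f⁻ᵏ(x) : k ∈ ℕ}` of `x`. -/
def preOrbit {n : ℕ} (f : Torus n → Torus n) (x : Torus n) : Set (Torus n) :=
  {w | ∃ k : ℕ, f^[k] w = x}

/-- `C` is a continuous cone field: each `C x` is a cone, the image of a standard cone
`{(u, w) ∈ ℝᵖ × ℝ^q : ‖w‖ ≤ ‖u‖}`, `p + q = n`, under a linear isomorphism, and depends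
continuously on `x`. Such cones are the sets where a nondegenerate quadratic form is nonnegative. -/
def IsConeField {n : ℕ} (C : Torus n → Set (Euc n)) : Prop :=
  ∃ b : Torus n → Euc n →L[ℝ] Euc n →L[ℝ] ℝ, Continuous b ∧
    ∀ x, (∀ v w, b x v w = b x w v) ∧ (∀ v, (∀ w, b x v w = 0) → v = 0) ∧
      C x = {v | 0 ≤ b x v v}

/-- An unstable (forward invariant, continuous) cone field. -/
structure IsUnstableConeField {n : ℕ} (f : Torus n → Torus n) (C : Torus n → Set (Euc n)) :
    Prop where
  isConeField : IsConeField C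
  forward_invariant : ∀ x, ∀ v ∈ C x, torusDeriv f x v ∈ C (f x)

/-- A continuous `Df`-invariant subbundle of the tangent bundle, of rank `d`. -/
structure IsInvariantSubbundle {n : ℕ} (f : Torus n → Torus n) (d : ℕ)
    (E : Torus n → Submodule ℝ (Euc n)) : Prop where
  finrank_eq : ∀ x, Module.finrank ℝ (E x) = d
  continuous : Continuous fun x => (E x).starProjection
  invariant : ∀ x, (E x).map (torusDeriv f x).toLinearMap = E (f x)

/-- The cone field `C` is complementary to a bundle of rank `d`: along every inverse path `(xₖ)`
of `f` the cones contain an invariant family of subspaces of dimension `n - d`. -/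
def IsComplementary {n : ℕ} (f : Torus n → Torus n) (d : ℕ) (C : Torus n → Set (Euc n)) : Prop :=
  ∀ x : ℕ → Torus n, (∀ k, f (x (k + 1)) = x k) →
    ∃ S : ℕ → Submodule ℝ (Euc n), ∀ k, Module.finrank ℝ (S k) + d = n ∧
      (S k : Set (Euc n)) ⊆ C (x k) ∧
      (S (k + 1)).map (torusDeriv f (x (k + 1))).toLinearMap = S k

/-- `f` is partially hyperbolic with expanding extremal direction, with center bundle `E` of rank
`d` and unstable cone field `C`; both directions are nontrivial. If `φ` is the inverse branch of
`f` with `φ (f x) = x`, the vectors `v` of the cone at `f x` are written `v = Df(x) w`, so that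
`w = Dφ(f x) v`. -/
structure IsPartiallyHyperbolic {n : ℕ} (f : Torus n → Torus n) (d : ℕ)
    (E : Torus n → Submodule ℝ (Euc n)) (C : Torus n → Set (Euc n)) : Prop where
  rank_pos : 0 < d
  rank_lt : d < n
  center : IsInvariantSubbundle f d E
  unstable : IsUnstableConeField f C
  complementary : IsComplementary f d C
  expansion_domination : ∃ lam : ℝ, 0 < lam ∧ lam < 1 ∧
    ∀ x w, w ≠ 0 → torusDeriv f x w ∈ C (f x) →
      ‖w‖ < lam * ‖torusDeriv f x w‖ ∧
      ‖(torusDeriv f x).comp (E x).subtypeL‖ * ‖w‖ < lam * ‖torusDeriv f x w‖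

/-- A `C¹` disc of dimension `m` in the torus, parametrized by the closed unit ball through its
lift `σ` to the universal cover, where it is embedded, and tangent to `C`. -/
structure IsTangentDisc {n m : ℕ} (C : Torus n → Set (Euc n)) (σ : Euc m → Euc n) : Prop where
  contDiffAt : ∀ u ∈ Metric.closedBall (0 : Euc m) 1, ContDiffAt ℝ 1 σ u
  injOn : Set.InjOn σ (Metric.closedBall 0 1)
  immersion : ∀ u ∈ Metric.closedBall (0 : Euc m) 1, Function.Injective (fderiv ℝ σ u)
  tangent : ∀ u ∈ Metric.closedBall (0 : Euc m) 1, ∀ w, fderiv ℝ σ u w ∈ C (toTorus (σ u))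

/-- The intrinsic distance, in the disc `σ`, from the point with parameter `p` to the boundary:
the infimum of the lengths of `C¹` curves in the disc from that point to the boundary. -/
noncomputable def distToBoundary {n m : ℕ} (σ : Euc m → Euc n) (p : Euc m) : ℝ≥0∞ :=
  ⨅ (c : ℝ → Euc m) (_ : ContDiff ℝ 1 c ∧ (∀ t ∈ Set.Icc (0 : ℝ) 1, c t ∈ Metric.closedBall 0 1) ∧
    c 0 = p ∧ c 1 ∈ Metric.sphere 0 1), ∫⁻ t in Set.Icc (0 : ℝ) 1, ‖deriv (σ ∘ c) t‖ₑ

/-- The internal diameter of the disc `σ`: twice its inner radius, the largest intrinsic distance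
from a point of the disc to its boundary. For arcs this is the length. -/
noncomputable def internalDiam {n m : ℕ} (σ : Euc m → Euc n) : ℝ≥0∞ :=
  2 * ⨆ p ∈ Metric.closedBall (0 : Euc m) 1, distToBoundary σ p

/-- Every disc of dimension `n - d` tangent to the cones with internal diameter larger than `δ₀`
has a point `y` with `m{Dfⁱ|E(fᵏ(y))} > λ₀ⁱ` for all `i > 0`, `k > k₀`. -/
def CenterExpandingPoints {n : ℕ} (f : Torus n → Torus n) (d : ℕ)
    (E : Torus n → Submodule ℝ (Euc n)) (C : Torus n → Set (Euc n))
    (δ₀ lam₀ : ℝ) (k₀ : ℕ) : Prop :=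
  ∀ σ : Euc (n - d) → Euc n, IsTangentDisc C σ → ENNReal.ofReal δ₀ < internalDiam σ →
    ∃ u ∈ Metric.closedBall (0 : Euc (n - d)) 1,
      ∀ i > 0, ∀ k > k₀, ∀ v ∈ E (f^[k] (toTorus (σ u))), v ≠ 0 →
        lam₀ ^ i * ‖v‖ < ‖torusDeriv (f^[i]) (f^[k] (toTorus (σ u))) v‖

/-! Everything is carried to the universal cover, where two facts about maps close to `f` suffice.
First, there is a radius `r`, depending only on `f`, such that every nonempty open set has a forward
iterate containing a ball of radius `r` (`DominatedSystem.exists_ball_subset_iterate`). Second,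
every ball of radius `r` meets every pre-orbit of `g` (`IsC1Lift.exists_robust_mem_preOrbit`). A
pre-orbit point in the ball is then the image of a point of the open set, which therefore lies in
the same pre-orbit. The second fact follows from density for `f`, uniform openness of finitely many
iterates, and compactness. The first is the heart of the matter.

Replace `f` by a power for which the direction transverse to the center dominates it by the factor 4
and the expansion in hypothesis 2 is at least 4. For maps `Φ` close to this power, the graph
transform sends discs transverse to the center, of bounded slope, to discs of the same kind and at
least doubles their radius (`GraphDisc.exists_image`). The original map and `Φ` act on discs almost
alike: under domination two discs through nearby points approach each other at relative rate 2/3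
(`GraphDisc.dist_image_le`). Hence a small disc in the open set grows under `Φ` to a definite size
and, after a fixed number `M` of further steps, lies close to a disc tangent to the unstable cones
of `f`. By hypothesis 2 the latter contains a point from which `f` eventually expands the center, so
the iterated disc passes near such a point.

The construction is repeated every `T` steps. Discs contract by 1/2 per step backwards, so the
successive choices converge geometrically: a single point of the initial disc shadows, in each of
any prescribed number of blocks of length `T`, an orbit of `f` with expanding center
(`GraphScale.exists_shadowsExpanding`). In each block there are bounded losses at the beginning and
at the end and many expanding steps in between, so `T` can be fixed with `DΦ^T` expanding all
directions by 2 (`DominatedSystem.exists_expand_of_shadows`). A ball around the point then grows by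
3/2 per block until it reaches a radius independent of the open set. What `Φ` must satisfy involves
only `T`, `M` and the original map, never the number of blocks. -/

open Set Metric

/-! ### Quantitative inverse function estimates and uniform `C¹` closeness of iterates -/

section LocalAnalysis

variable {E : Type*} [NormedAddCommGroup E] [NormedSpace ℝ E]

/-- An endomorphism of a finite-dimensional space that expands norms by at least `α > 0` has a
right inverse of norm at most `α⁻¹`. -/
theorem exists_nonlinearRightInverse [FiniteDimensional ℝ E] {A : E →L[ℝ] E} {α : ℝ} (hα : 0 < α)
    (hA : ∀ v, α * ‖v‖ ≤ ‖A v‖) :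
    ∃ B : A.NonlinearRightInverse, (B.nnnorm : ℝ) = α⁻¹ := by
  have hinj : Function.Injective A := by
    refine (injective_iff_map_eq_zero A).2 fun v hv => ?_
    have := hA v
    rw [hv, norm_zero] at this
    exact norm_le_zero_iff.1 (by nlinarith [norm_nonneg v])
  have hsurj : Function.Surjective A := LinearMap.surjective_of_injective (f := A.toLinearMap) hinj
  choose g hg using hsurj
  refine ⟨⟨g, ⟨α⁻¹, by positivity⟩, fun y => ?_, hg⟩, rfl⟩
  have := hA (g y)
  rw [hg] at this
  show ‖g y‖ ≤ α⁻¹ * ‖y‖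
  rw [inv_mul_eq_div, le_div_iff₀ hα]
  linarith

/-- A map which is `c`-close to an `α`-expanding linear map on a ball covers a ball of radius
multiplied by `α - c`. -/
theorem closedBall_subset_image_of_approximatesLinearOn [FiniteDimensional ℝ E] {Φ : E → E}
    {A : E →L[ℝ] E} {α : ℝ} (hα : 0 < α) (hA : ∀ v, α * ‖v‖ ≤ ‖A v‖) {b : E} {s : ℝ} (hs : 0 ≤ s)
    {c : NNReal} (h : ApproximatesLinearOn Φ A (closedBall b s) c) :
    closedBall (Φ b) ((α - c) * s) ⊆ Φ '' closedBall b s := by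
  have : CompleteSpace E := FiniteDimensional.complete ℝ E
  obtain ⟨B, hB⟩ := exists_nonlinearRightInverse hα hA
  have := h.surjOn_closedBall_of_nonlinearRightInverse B hs subset_rfl
  rwa [hB, inv_inv] at this

theorem approximatesLinearOn_of_fderiv_le {F : Type*} [NormedAddCommGroup F] [NormedSpace ℝ F]
    {Φ : E → F} {A : E →L[ℝ] F} {s : Set E} (hs : Convex ℝ s)
    (hd : ∀ x ∈ s, DifferentiableAt ℝ Φ x) {c : NNReal} (hc : ∀ x ∈ s, ‖fderiv ℝ Φ x - A‖ ≤ c) :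
    ApproximatesLinearOn Φ A s c := fun _ hx _ hy =>
  hs.norm_image_sub_le_of_norm_hasFDerivWithin_le'
    (fun z hz => (hd z hz).hasFDerivAt.hasFDerivWithinAt) hc hy hx

/-- Balls around `b` are blown up by the factor `α - c` by a map whose derivative is `c`-close to an
`α`-expanding linear map. -/
theorem closedBall_subset_image_of_fderiv [FiniteDimensional ℝ E] {Φ : E → E}
    (hΦ : Differentiable ℝ Φ) {A : E →L[ℝ] E} {α : ℝ} (hα : 0 < α) (hA : ∀ v, α * ‖v‖ ≤ ‖A v‖)
    {b : E} {s c : ℝ} (hs : 0 ≤ s) (hc0 : 0 ≤ c) (hc : ∀ x ∈ closedBall b s, ‖fderiv ℝ Φ x - A‖ ≤ c) :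
    closedBall (Φ b) ((α - c) * s) ⊆ Φ '' closedBall b s :=
  closedBall_subset_image_of_approximatesLinearOn hα hA hs (c := ⟨c, hc0⟩)
    (approximatesLinearOn_of_fderiv_le (convex_closedBall b s) (fun x _ => hΦ x) hc)

/-- A `C¹` map whose derivative is bounded and uniformly continuous. -/
structure UnifC1 (F : E → E) : Prop where
  contDiff : ContDiff ℝ 1 F
  bound : ∃ L : ℝ, ∀ x, ‖fderiv ℝ F x‖ ≤ L
  unif : ∀ c > (0 : ℝ), ∃ ρ > (0 : ℝ), ∀ x y, ‖x - y‖ ≤ ρ → ‖fderiv ℝ F x - fderiv ℝ F y‖ ≤ c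

/-- `F` and `G` are uniformly `ε`-close together with their derivatives. -/
def C1Close (F G : E → E) (ε : ℝ) : Prop :=
  ∀ x, ‖F x - G x‖ ≤ ε ∧ ‖fderiv ℝ F x - fderiv ℝ G x‖ ≤ ε

theorem C1Close.mono {F G : E → E} {ε ε' : ℝ} (h : C1Close F G ε) (hε : ε ≤ ε') : C1Close F G ε' :=
  fun x => ⟨(h x).1.trans hε, (h x).2.trans hε⟩

theorem UnifC1.differentiable {F : E → E} (h : UnifC1 F) : Differentiable ℝ F :=
  h.contDiff.differentiable (by norm_num)

theorem UnifC1.exists_pos_bound {F : E → E} (h : UnifC1 F) :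
    ∃ L : ℝ, 1 ≤ L ∧ ∀ x, ‖fderiv ℝ F x‖ ≤ L := by
  obtain ⟨L, hL⟩ := h.bound
  exact ⟨max L 1, le_max_right _ _, fun x => (hL x).trans (le_max_left _ _)⟩

theorem norm_sub_le_of_fderiv_le {F : E → E} (hF : Differentiable ℝ F) {L : ℝ}
    (hL : ∀ x, ‖fderiv ℝ F x‖ ≤ L) (x y : E) : ‖F x - F y‖ ≤ L * ‖x - y‖ :=
  convex_univ.norm_image_sub_le_of_norm_fderiv_le (fun z _ => hF z) (fun z _ => hL z)
    (mem_univ y) (mem_univ x)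

theorem norm_comp_sub_comp_le (A A' B B' : E →L[ℝ] E) {a b K : ℝ} (hA : ‖A - A'‖ ≤ a)
    (hB : ‖B - B'‖ ≤ b) (hK : ‖B‖ ≤ K) (hK' : ‖A'‖ ≤ K) (ha : 0 ≤ a) :
    ‖A.comp B - A'.comp B'‖ ≤ K * (a + b) := by
  have e : A.comp B - A'.comp B' = (A - A').comp B + A'.comp (B - B') := by
    ext v; simp
  rw [e]
  have hK0 : 0 ≤ K := (norm_nonneg _).trans hK
  calc _ ≤ ‖(A - A').comp B‖ + ‖A'.comp (B - B')‖ := norm_add_le _ _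
    _ ≤ ‖A - A'‖ * ‖B‖ + ‖A'‖ * ‖B - B'‖ :=
      add_le_add (ContinuousLinearMap.opNorm_comp_le _ _) (ContinuousLinearMap.opNorm_comp_le _ _)
    _ ≤ a * K + K * b := by gcongr
    _ = K * (a + b) := by ring

theorem UnifC1.id : UnifC1 (fun x : E => x) where
  contDiff := contDiff_id
  bound := ⟨‖ContinuousLinearMap.id ℝ E‖, fun x => by rw [fderiv_fun_id]⟩
  unif := fun c hc => ⟨1, one_pos, fun x y _ => by simp [hc.le]⟩

theorem UnifC1.comp {F G : E → E} (hF : UnifC1 F) (hG : UnifC1 G) : UnifC1 (F ∘ G) := by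
  obtain ⟨L, hL1, hL⟩ := hF.exists_pos_bound
  obtain ⟨K, hK1, hK⟩ := hG.exists_pos_bound
  have hd : ∀ x, fderiv ℝ (F ∘ G) x = (fderiv ℝ F (G x)).comp (fderiv ℝ G x) := fun x =>
    fderiv_comp x (hF.differentiable _) (hG.differentiable _)
  refine ⟨hF.contDiff.comp hG.contDiff, ⟨L * K, fun x => ?_⟩, fun c hc => ?_⟩
  · rw [hd]
    exact (ContinuousLinearMap.opNorm_comp_le _ _).trans (by gcongr <;> simp_all)
  · set M := max L K
    have hM : 0 < M := lt_of_lt_of_le one_pos (hL1.trans (le_max_left _ _))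
    obtain ⟨ρ₁, hρ₁, h₁⟩ := hF.unif (c / (2 * M)) (by positivity)
    obtain ⟨ρ₂, hρ₂, h₂⟩ := hG.unif (c / (2 * M)) (by positivity)
    refine ⟨min (ρ₁ / K) ρ₂, by positivity, fun x y hxy => ?_⟩
    rw [hd, hd]
    have hG' : ‖G x - G y‖ ≤ ρ₁ := by
      have h1 := norm_sub_le_of_fderiv_le hG.differentiable hK x y
      have h2 : K * ‖x - y‖ ≤ K * (ρ₁ / K) := by
        gcongr; exact hxy.trans (min_le_left _ _)
      rw [mul_div_cancel₀ _ (by positivity)] at h2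
      linarith
    refine (norm_comp_sub_comp_le _ _ _ _ (h₁ _ _ hG') (h₂ _ _ (hxy.trans (min_le_right _ _)))
      ((hK x).trans (le_max_right L K)) ((hL _).trans (le_max_left L K)) (by positivity)).trans ?_
    rw [← add_div]
    apply le_of_eq
    field_simp
    ring

theorem contDiff_one_iterate {F : E → E} (hF : ContDiff ℝ 1 F) (N : ℕ) : ContDiff ℝ 1 F^[N] := by
  induction N with
  | zero => exact contDiff_id
  | succ N ih => exact Function.iterate_succ F N ▸ ih.comp hF

theorem UnifC1.iterate {F : E → E} (hF : UnifC1 F) (N : ℕ) : UnifC1 F^[N] := by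
  induction N with
  | zero => exact UnifC1.id
  | succ N ih => exact Function.iterate_succ F N ▸ ih.comp hF

/-- Iterates depend continuously on the map in the uniform `C¹` topology. -/
theorem UnifC1.exists_c1Close_iterate {F : E → E} (hF : UnifC1 F) (N : ℕ) {η : ℝ} (hη : 0 < η) :
    ∃ ε > (0 : ℝ), ∀ G : E → E, ContDiff ℝ 1 G → C1Close F G ε → C1Close F^[N] G^[N] η := by
  induction N generalizing η with
  | zero => exact ⟨1, one_pos, fun G _ _ x => by simp [hη.le]⟩
  | succ N ih =>
    obtain ⟨L, hL1, hL⟩ := hF.exists_pos_bound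
    obtain ⟨K, hK1, hK⟩ := (hF.iterate N).exists_pos_bound
    set M := max (L + 1) K
    have hM : 0 < M := by
      have : L + 1 ≤ M := le_max_left _ _
      linarith
    obtain ⟨ρ, hρ, hu⟩ := hF.unif (η / (4 * M)) (by positivity)
    obtain ⟨ε, hε, h⟩ := ih (η := min (min ρ (η / (4 * M))) (η / (2 * L))) (by positivity)
    refine ⟨min (min ε 1) (min (η / (4 * M)) (η / 2)), by positivity, fun G hG hFG => ?_⟩
    have hε1 := h G hG (hFG.mono ((min_le_left _ _).trans (min_le_left _ _)))
    have hGd : Differentiable ℝ G := hG.differentiable (by norm_num)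
    have hGN : Differentiable ℝ G^[N] := hGd.iterate N
    intro x
    obtain ⟨a1, a2⟩ := hε1 x
    obtain ⟨b1, b2⟩ := hFG (G^[N] x)
    simp only [Function.iterate_succ']
    constructor
    · have h1 := norm_sub_le_of_fderiv_le hF.differentiable hL (F^[N] x) (G^[N] x)
      have h2 : L * ‖F^[N] x - G^[N] x‖ ≤ L * (η / (2 * L)) := by
        gcongr; exact a1.trans (min_le_right _ _)
      have h3 : L * (η / (2 * L)) = η / 2 := by field_simp
      have h4 := b1.trans ((min_le_right _ _).trans (min_le_right _ _))
      have h5 := norm_sub_le_norm_sub_add_norm_sub (F (F^[N] x)) (F (G^[N] x)) (G (G^[N] x))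
      simp only [Function.comp]
      linarith
    · rw [fderiv_comp x (hF.differentiable _) ((hF.iterate N).differentiable _),
        fderiv_comp x (hGd _) (hGN _)]
      have c1 : ‖fderiv ℝ F (F^[N] x) - fderiv ℝ G (G^[N] x)‖ ≤ η / (4 * M) + η / (4 * M) := by
        refine (norm_sub_le_norm_sub_add_norm_sub _ (fderiv ℝ F (G^[N] x)) _).trans
          (add_le_add (hu _ _ ?_) ?_)
        · exact a1.trans ((min_le_left _ _).trans (min_le_left _ _))
        · exact b2.trans ((min_le_right _ _).trans (min_le_left _ _))
      have c2 : ‖fderiv ℝ G (G^[N] x)‖ ≤ M := by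
        have h1 := hL (G^[N] x)
        have h2 := b2.trans ((min_le_left _ _).trans (min_le_right _ _))
        have h3 := norm_le_norm_add_norm_sub (fderiv ℝ F (G^[N] x)) (fderiv ℝ G (G^[N] x))
        have : L + 1 ≤ M := le_max_left _ _
        linarith
      refine (norm_comp_sub_comp_le _ _ _ _ c1
        (a2.trans ((min_le_left _ _).trans (min_le_right _ _)))
        ((hK x).trans (le_max_right _ _)) c2 (by positivity)).trans ?_
      have : M * (η / (4 * M) + η / (4 * M) + η / (4 * M)) = 3 / 4 * η := by
        field_simp
        ring
      rw [this]
      linarith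

end LocalAnalysis

/-! ### Graph transform for one dominated step -/

section GraphTransform

variable {X W : Type*} [NormedAddCommGroup X] [NormedSpace ℝ X]
  [NormedAddCommGroup W] [NormedSpace ℝ W]

/-- A splitting of `X` into the range of the isometry `J`, with coordinate `R`, and the range of
the projection `Q`. -/
structure Frame (J : W →L[ℝ] X) (R : X →L[ℝ] W) (Q : X →L[ℝ] X) : Prop where
  coord_J : ∀ h, R (J h) = h
  decomp : ∀ v, J (R v) + Q v = v
  norm_J : ∀ h, ‖J h‖ = ‖h‖
  norm_coord : ∀ v, ‖R v‖ ≤ ‖v‖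
  norm_Q : ∀ v, ‖Q v‖ ≤ ‖v‖

theorem Frame.coord_Q {J : W →L[ℝ] X} {R : X →L[ℝ] W} {Q : X →L[ℝ] X} (h : Frame J R Q) (v : X) :
    R (Q v) = 0 := by
  have := congrArg R (h.decomp v)
  rw [map_add, h.coord_J] at this
  simpa using this

theorem Frame.norm_le {J : W →L[ℝ] X} {R : X →L[ℝ] W} {Q : X →L[ℝ] X} (h : Frame J R Q) (v : X) :
    ‖v‖ ≤ ‖R v‖ + ‖Q v‖ := by
  conv_lhs => rw [← h.decomp v]
  exact (norm_add_le _ _).trans (by rw [h.norm_J])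

/-- The coordinates `R` will be chosen pointwise, without any continuity in the base point. This
identity lets their norms be compared at different points through `Q` alone, which does vary
continuously. -/
theorem Frame.norm_coord_eq {J : W →L[ℝ] X} {R : X →L[ℝ] W} {Q : X →L[ℝ] X} (h : Frame J R Q)
    (v : X) : ‖R v‖ = ‖v - Q v‖ := by
  rw [← h.norm_J, eq_sub_of_add_eq (h.decomp v)]

/-- A linear map `T` between split spaces that almost preserves the ranges of the projections,
where it expands by at most `μ`, and expands the other coordinate by at least `3 * μ`. -/
structure DominatedStep (J : W →L[ℝ] X) (R : X →L[ℝ] W) (Q : X →L[ℝ] X) (R' : X →L[ℝ] W)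
    (Q' : X →L[ℝ] X) (T : X →L[ℝ] X) (L μ c : ℝ) : Prop where
  frame : Frame J R Q
  frame' : ∃ J' : W →L[ℝ] X, Frame J' R' Q'
  one_le : 1 ≤ μ
  le_L : μ ≤ L
  bound : ∀ v, ‖T v‖ ≤ L * ‖v‖
  center : ∀ v, ‖T (Q v)‖ ≤ μ * ‖Q v‖
  expand : ∀ h, 3 * μ * ‖h‖ ≤ ‖R' (T (J h))‖
  almost_inv : ∀ v, ‖R' (T (Q v))‖ ≤ c * ‖Q v‖

/-- A `C¹` disc which is the graph, over a ball of radius `r`, of a map with slope at most `a`. -/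
structure GraphDisc (R : X →L[ℝ] W) (Q : X →L[ℝ] X) (a : ℝ) (p : X) (r : ℝ) (φ : W → X) : Prop where
  contDiffAt : ∀ h ∈ ball (0 : W) r, ContDiffAt ℝ 1 φ h
  chart : ∀ h ∈ ball (0 : W) r, R (φ h - p) = h
  cone : ∀ h ∈ ball (0 : W) r, ∀ h' ∈ ball (0 : W) r, ‖Q (φ h - φ h')‖ ≤ a * ‖h - h'‖

theorem GraphDisc.coord_sub {R : X →L[ℝ] W} {Q : X →L[ℝ] X} {a r : ℝ} {p : X} {φ : W → X}
    (hφ : GraphDisc R Q a p r φ) {h h' : W} (hh : h ∈ ball (0 : W) r) (hh' : h' ∈ ball (0 : W) r) :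
    R (φ h - φ h') = h - h' := by
  have h1 := hφ.chart h hh
  have h2 := hφ.chart h' hh'
  rw [← sub_sub_sub_cancel_right (φ h) (φ h') p, map_sub, h1, h2]

theorem GraphDisc.norm_sub_le {J : W →L[ℝ] X} {R : X →L[ℝ] W} {Q : X →L[ℝ] X} {a r : ℝ} {p : X}
    {φ : W → X} (hφ : GraphDisc R Q a p r φ) (hF : Frame J R Q) {h h' : W}
    (hh : h ∈ ball (0 : W) r) (hh' : h' ∈ ball (0 : W) r) :
    ‖φ h - φ h'‖ ≤ (1 + a) * ‖h - h'‖ := by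
  have h1 := hF.norm_le (φ h - φ h')
  rw [hφ.coord_sub hh hh'] at h1
  linarith [hφ.cone h hh h' hh']

variable {J : W →L[ℝ] X} {R : X →L[ℝ] W} {Q : X →L[ℝ] X} {R' : X →L[ℝ] W}
    {Q' : X →L[ℝ] X} {T : X →L[ℝ] X} {L μ c a r : ℝ} {p : X} {φ : W → X} {Φ : X → X} {B : Set X}

/-- In the chart, the image of a graph disc differs little from its image under the linear model. -/
theorem GraphDisc.coord_image_sub (hφ : GraphDisc R Q a p r φ)
    (hs : DominatedStep J R Q R' Q' T L μ c) (hc0 : 0 ≤ c) (hca : c * (1 + 2 * a) ≤ 1 / 8)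
    (hB : ∀ h ∈ ball (0 : W) r, φ h ∈ B)
    (hΦ : ∀ y ∈ B, ∀ y' ∈ B, ‖Φ y - Φ y' - T (y - y')‖ ≤ c * ‖y - y'‖) {h h' : W}
    (hh : h ∈ ball (0 : W) r) (hh' : h' ∈ ball (0 : W) r) :
    ‖R' (Φ (φ h) - Φ (φ h')) - R' (T (J (h - h')))‖ ≤ 1 / 8 * ‖h - h'‖ := by
  obtain ⟨J', hf'⟩ := hs.frame'
  set v := φ h - φ h' with hv
  have h1 : J (h - h') + Q v = v := by
    rw [← hφ.coord_sub hh hh']; exact hs.frame.decomp v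
  have h2 := hΦ _ (hB h hh) _ (hB h' hh')
  rw [← hv] at h2
  have h3 : R' (Φ (φ h) - Φ (φ h')) - R' (T (J (h - h'))) =
      R' (Φ (φ h) - Φ (φ h') - T v) + R' (T (Q v)) := by
    have : T v = T (J (h - h')) + T (Q v) := by rw [← map_add, h1]
    rw [map_sub R' (Φ (φ h) - Φ (φ h')) (T v), this, map_add R']
    abel
  rw [h3]
  have h4 := hf'.norm_coord (Φ (φ h) - Φ (φ h') - T v)
  have h5 := hs.almost_inv v
  have h6 := hφ.cone h hh h' hh'
  have h7 := hφ.norm_sub_le hs.frame hh hh'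
  rw [← hv] at h6 h7
  refine (norm_add_le _ _).trans ?_
  have h8 : c * ‖v‖ ≤ c * ((1 + a) * ‖h - h'‖) := by gcongr
  have h9 : c * ‖Q v‖ ≤ c * (a * ‖h - h'‖) := by gcongr
  have h10 : c * (1 + 2 * a) * ‖h - h'‖ ≤ 1 / 8 * ‖h - h'‖ := by gcongr
  nlinarith

/-- The linear model expands the coordinate by `3 * μ`, and the error of at most `1 / 8` is absorbed
because `μ ≥ 1`. -/
theorem GraphDisc.expand_image (hφ : GraphDisc R Q a p r φ)
    (hs : DominatedStep J R Q R' Q' T L μ c) (hc0 : 0 ≤ c) (hca : c * (1 + 2 * a) ≤ 1 / 8)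
    (hB : ∀ h ∈ ball (0 : W) r, φ h ∈ B)
    (hΦ : ∀ y ∈ B, ∀ y' ∈ B, ‖Φ y - Φ y' - T (y - y')‖ ≤ c * ‖y - y'‖) {h h' : W}
    (hh : h ∈ ball (0 : W) r) (hh' : h' ∈ ball (0 : W) r) :
    2 * μ * ‖h - h'‖ ≤ ‖R' (Φ (φ h) - Φ (φ h'))‖ := by
  have h1 := hφ.coord_image_sub hs hc0 hca hB hΦ hh hh'
  have h2 := hs.expand (h - h')
  have h3 := norm_sub_norm_le (R' (T (J (h - h')))) (R' (Φ (φ h) - Φ (φ h')))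
  rw [norm_sub_rev] at h3
  have := hs.one_le
  nlinarith [norm_nonneg (h - h')]

theorem exists_continuousLinearEquiv_of_expanding [FiniteDimensional ℝ W] {A : W →L[ℝ] W} {α : ℝ}
    (hα : 0 < α) (hA : ∀ v, α * ‖v‖ ≤ ‖A v‖) :
    ∃ e : W ≃L[ℝ] W, (e : W →L[ℝ] W) = A ∧ ‖(e.symm : W →L[ℝ] W)‖ ≤ α⁻¹ := by
  have hinj : Function.Injective A := by
    refine (injective_iff_map_eq_zero A).2 fun v hv => ?_
    have := hA v
    rw [hv, norm_zero] at this
    exact norm_le_zero_iff.1 (by nlinarith [norm_nonneg v])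
  set e := (LinearEquiv.ofInjectiveEndo A.toLinearMap hinj).toContinuousLinearEquiv with he
  have hA' : ∀ v, e v = A v := fun v => rfl
  refine ⟨e, by ext v; exact hA' v, ContinuousLinearMap.opNorm_le_bound _ (by positivity) ?_⟩
  intro y
  have := hA (e.symm y)
  rw [← hA', e.apply_symm_apply] at this
  show ‖e.symm y‖ ≤ α⁻¹ * ‖y‖
  rw [inv_mul_eq_div, le_div_iff₀ hα]
  linarith

/-- The graph transform: the image of a graph disc contains a graph disc. -/
theorem GraphDisc.exists_image [FiniteDimensional ℝ W] (hφ : GraphDisc R Q a p r φ)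
    (hs : DominatedStep J R Q R' Q' T L μ c) (hc0 : 0 ≤ c) (hca : c * (1 + 2 * a) ≤ 1 / 8)
    (haL : L + 1 ≤ a) (hB : ∀ h ∈ ball (0 : W) r, φ h ∈ B)
    (hΦ : ∀ y ∈ B, ∀ y' ∈ B, ‖Φ y - Φ y' - T (y - y')‖ ≤ c * ‖y - y'‖) (hΦ1 : ContDiff ℝ 1 Φ)
    {h₀ : W} {s r' : ℝ} (hsr : ball h₀ s ⊆ ball 0 r) {p' : X}
    (hr' : r' + ‖R' (Φ (φ h₀) - p')‖ ≤ 2 * s) :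
    ∃ φ' : W → X, ∃ ψ : W → W, GraphDisc R' Q' a p' r' φ' ∧ ∀ h ∈ ball (0 : W) r',
      ψ h ∈ ball h₀ s ∧ φ' h = Φ (φ (ψ h)) ∧
      ∀ w, ∃ w', fderiv ℝ φ' h w = fderiv ℝ Φ (φ (ψ h)) (fderiv ℝ φ (ψ h) w') := by
  have : CompleteSpace W := FiniteDimensional.complete ℝ W
  obtain ⟨J', hf'⟩ := hs.frame'
  have hμ := hs.one_le
  have hexp := fun h (hh : h ∈ ball (0 : W) r) h' (hh' : h' ∈ ball (0 : W) r) =>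
    hφ.expand_image hs hc0 hca hB hΦ hh hh'
  set A : W →L[ℝ] W := R' ∘L T ∘L J with hAdef
  have hA : ∀ v, 3 * ‖v‖ ≤ ‖A v‖ := fun v => by
    have := hs.expand v
    have h2 : 3 * ‖v‖ ≤ 3 * μ * ‖v‖ := by
      gcongr; linarith
    exact h2.trans this
  -- `S` is the coordinate of the image disc in the new frame. It is `1 / 8`-close to the
  -- 3-expanding map `A`, hence invertible; the new disc is `Φ ∘ φ` reparametrized by its inverse.
  set S : W → W := fun h => R' (Φ (φ h) - p') with hS
  have hap : ApproximatesLinearOn S A (ball h₀ s) (1 / 8) := fun h hh h' hh' => by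
    have := hφ.coord_image_sub hs hc0 hca hB hΦ (hsr hh) (hsr hh')
    have e : S h - S h' - A (h - h') = R' (Φ (φ h) - Φ (φ h')) - R' (T (J (h - h'))) := by
      simp only [hS, hAdef, ContinuousLinearMap.comp_apply, ← map_sub]
      congr 2
      abel
    rw [e]
    simpa using this
  obtain ⟨eA, heA, hsymm⟩ := exists_continuousLinearEquiv_of_expanding (by norm_num : (0:ℝ) < 3) hA
  have hN : Subsingleton W ∨ (1 / 8 : NNReal) < ‖(eA.symm : W →L[ℝ] W)‖₊⁻¹ := by
    rcases subsingleton_or_nontrivial W with h | h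
    · exact Or.inl h
    · right
      have hpos : 0 < ‖(eA.symm : W →L[ℝ] W)‖₊ := NNReal.coe_pos.1 eA.symm.norm_pos
      rw [lt_inv_comm₀ (by norm_num) hpos, ← NNReal.coe_lt_coe]
      refine hsymm.trans_lt ?_
      norm_num
  rw [← heA] at hap
  set e := hap.toOpenPartialHomeomorph S (ball h₀ s) hN isOpen_ball with he
  have hSe : ∀ h, e h = S h := fun h => rfl
  have htarget : ball (0 : W) r' ⊆ e.target := by
    intro h hh
    rw [ApproximatesLinearOn.toOpenPartialHomeomorph_target S (ball h₀ s) hap hN isOpen_ball]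
    have h1 : ‖h - S h₀‖ < 2 * s := by
      have := _root_.norm_sub_le h (S h₀)
      have h2 : ‖h‖ < r' := by simpa using hh
      linarith
    -- Since `3 - 1 / 8 > 2`, a ball of half the required radius around `h₀` already has `h` in its
    -- image.
    have h3 : closedBall h₀ (‖h - S h₀‖ / 2) ⊆ ball h₀ s := closedBall_subset_ball (by linarith)
    obtain ⟨y, hy, hy'⟩ := closedBall_subset_image_of_approximatesLinearOn
      (by norm_num : (0:ℝ) < 3) hA (by positivity : 0 ≤ ‖h - S h₀‖ / 2)
      (heA ▸ hap.mono_set h3) (show h ∈ _ by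
        rw [mem_closedBall, dist_eq_norm]
        have : ((1 / 8 : NNReal) : ℝ) = 1 / 8 := by norm_num
        rw [this]
        linarith [norm_nonneg (h - S h₀)])
    exact ⟨y, h3 hy, hy'⟩
  have hψ : ∀ h ∈ ball (0 : W) r', e.symm h ∈ ball h₀ s := fun h hh => e.map_target (htarget hh)
  have hψS : ∀ h ∈ ball (0 : W) r', S (e.symm h) = h := fun h hh => e.right_inv (htarget hh)
  have hSd : ∀ h ∈ ball h₀ s, ContDiffAt ℝ 1 S h := fun h hh =>
    R'.contDiff.contDiffAt.comp h
      ((hΦ1.contDiffAt.comp h (hφ.contDiffAt h (hsr hh))).sub contDiffAt_const)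
  have hsymmd : ∀ h ∈ ball (0 : W) r', ContDiffAt ℝ 1 e.symm h := fun h hh => by
    have hd : HasFDerivAt S (fderiv ℝ S (e.symm h)) (e.symm h) :=
      ((hSd _ (hψ h hh)).differentiableAt (by norm_num)).hasFDerivAt
    have hlip : ‖fderiv ℝ S (e.symm h) - A‖ ≤ ((1 / 8 : NNReal) : ℝ) := by
      refine HasFDerivAt.le_of_lipschitzOn (hd.sub A.hasFDerivAt)
        (isOpen_ball.mem_nhds (hψ h hh)) ?_
      have := hap.lipschitzOnWith
      rwa [heA] at this
    have hexp' : ∀ v, 2 * ‖v‖ ≤ ‖fderiv ℝ S (e.symm h) v‖ := fun v => by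
      have h1 := (fderiv ℝ S (e.symm h) - A).le_of_opNorm_le hlip v
      have h2 := norm_sub_norm_le (A v) (fderiv ℝ S (e.symm h) v)
      rw [norm_sub_rev] at h2
      have h3 := hA v
      have : ((1 / 8 : NNReal) : ℝ) = 1 / 8 := by norm_num
      rw [this] at h1
      have h4 : ‖fderiv ℝ S (e.symm h) v - A v‖ ≤ 1 / 8 * ‖v‖ := h1
      linarith [norm_nonneg v]
    obtain ⟨e', he', -⟩ := exists_continuousLinearEquiv_of_expanding two_pos hexp'
    exact e.contDiffAt_symm (htarget hh) (f₀' := e') (he' ▸ hd) (hSd _ (hψ h hh))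
  refine ⟨fun h => Φ (φ (e.symm h)), e.symm, ⟨fun h hh => ?_, hψS, fun h hh h' hh' => ?_⟩,
    fun h hh => ⟨hψ h hh, rfl, fun w => ?_⟩⟩
  · exact hΦ1.contDiffAt.comp h
      ((hφ.contDiffAt _ (hsr (hψ h hh))).comp h (hsymmd h hh))
  · set k := e.symm h
    set k' := e.symm h'
    have hk := hsr (hψ h hh)
    have hk' := hsr (hψ h' hh')
    have h1 := hΦ _ (hB k hk) _ (hB k' hk')
    have h2 := hexp k hk k' hk'
    have h3 : R' (Φ (φ k) - Φ (φ k')) = h - h' := by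
      rw [← hψS h hh, ← hψS h' hh', ← map_sub]
      congr 1
      abel
    rw [h3] at h2
    set v := φ k - φ k' with hv
    have h4 : J (k - k') + Q v = v := by
      rw [← hφ.coord_sub hk hk']; exact hs.frame.decomp v
    have h5 : ‖T v‖ ≤ L * ‖k - k'‖ + μ * ‖Q v‖ := by
      rw [← h4, map_add]
      refine (norm_add_le _ _).trans (add_le_add ?_ ?_)
      · exact (hs.bound _).trans (by rw [hs.frame.norm_J])
      · rw [h4]; exact hs.center v
    have h6 := hφ.cone k hk k' hk'
    have h7 := hφ.norm_sub_le hs.frame hk hk'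
    rw [← hv] at h6 h7
    have h8 := hf'.norm_Q (Φ (φ k) - Φ (φ k'))
    have h9 := norm_le_norm_add_norm_sub' (Φ (φ k) - Φ (φ k')) (T v)
    have h10 : c * ‖v‖ ≤ c * ((1 + a) * ‖k - k'‖) := by gcongr
    have ha : 0 ≤ a := by linarith [hs.le_L]
    have h11 : c * (1 + a) ≤ 1 := by nlinarith
    have h12 : c * (1 + a) * ‖k - k'‖ ≤ 1 * ‖k - k'‖ := by gcongr
    have h13 : μ * ‖Q v‖ ≤ μ * (a * ‖k - k'‖) := by gcongr
    have h14 : a * (2 * μ * ‖k - k'‖) ≤ a * ‖h - h'‖ := by gcongr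
    -- The complement of the center is not invariant, so slopes do not decrease to zero. The image
    -- has center displacement at most `(L + μ * a + 1) * ‖k - k'‖`; as `L + 1 ≤ a`, this is at most
    -- `2 * μ * a * ‖k - k'‖`, and the coordinate has grown by `2 * μ`. The bound `a` thus
    -- reproduces itself.
    have h15 : (L + 1) * ‖k - k'‖ ≤ μ * (a * ‖k - k'‖) := by
      have : (L + 1) * ‖k - k'‖ ≤ a * ‖k - k'‖ := by gcongr
      nlinarith [norm_nonneg (k - k'), mul_nonneg ha (norm_nonneg (k - k'))]
    nlinarith
  · have hd1 : DifferentiableAt ℝ e.symm h := (hsymmd h hh).differentiableAt (by norm_num)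
    have hd2 : DifferentiableAt ℝ φ (e.symm h) :=
      (hφ.contDiffAt _ (hsr (hψ h hh))).differentiableAt (by norm_num)
    have hd3 : DifferentiableAt ℝ Φ (φ (e.symm h)) := (hΦ1.differentiable (by norm_num)) _
    refine ⟨fderiv ℝ e.symm h w, ?_⟩
    have := (hd3.hasFDerivAt.comp h (hd2.hasFDerivAt.comp h hd1.hasFDerivAt)).fderiv
    have h2 := congrArg (fun A : W →L[ℝ] X => A w) this
    exact h2

/-- Two graph discs whose distance grows slowly get closer in relative terms under the graph
transforms of two maps that are close to each other. -/
theorem GraphDisc.dist_image_le {φ₁ φ₂ : W → X} {Φ₁ Φ₂ : X → X} (h₁ : GraphDisc R Q a p r φ₁)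
    (h₂ : GraphDisc R Q a p r φ₂) (hs : DominatedStep J R Q R' Q' T L μ c) (hc0 : 0 ≤ c)
    (hca : c * (1 + 2 * a) ≤ 1 / 8) (haL : L + 1 ≤ a) (hB₁ : ∀ h ∈ ball (0 : W) r, φ₁ h ∈ B)
    (hB₂ : ∀ h ∈ ball (0 : W) r, φ₂ h ∈ B)
    (hΦ : ∀ y ∈ B, ∀ y' ∈ B, ‖Φ₁ y - Φ₁ y' - T (y - y')‖ ≤ c * ‖y - y'‖) {ε : ℝ} (hε : 0 ≤ ε)
    (hclose : ∀ y, ‖Φ₁ y - Φ₂ y‖ ≤ ε) {θ κ : ℝ} (hθ0 : 0 ≤ θ) (hθ1 : θ ≤ 2 * a) (hκ : 0 ≤ κ)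
    (hd : ∀ h ∈ ball (0 : W) r, ‖φ₁ h - φ₂ h‖ ≤ θ * ‖h‖ + κ) (hr : 0 < r) {p' : X}
    (hp' : ‖Φ₁ (φ₁ 0) - p'‖ ≤ L * κ + ε) {k₁ k₂ h : W}
    (hk₁ : k₁ ∈ ball (0 : W) r) (hk₂ : k₂ ∈ ball (0 : W) r) (hh₁ : R' (Φ₁ (φ₁ k₁) - p') = h)
    (hh₂ : R' (Φ₂ (φ₂ k₂) - p') = h) :
    ‖Φ₁ (φ₁ k₁) - Φ₂ (φ₂ k₂)‖ ≤ 2 / 3 * θ * ‖h‖ + 4 * (1 + a) ^ 2 * (κ + ε) := by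
  obtain ⟨J', hf'⟩ := hs.frame'
  have hμ := hs.one_le
  have hμL := hs.le_L
  set e := φ₁ k₁ - φ₂ k₂ with he
  set k := k₁ - k₂ with hk
  set d := Φ₁ (φ₁ k₁) - Φ₂ (φ₂ k₂) with hdd
  have hRe : R e = k := by
    have e1 : e = (φ₁ k₁ - p) - (φ₂ k₂ - p) := by rw [he]; abel
    rw [e1, map_sub, h₁.chart _ hk₁, h₂.chart _ hk₂]
  have hdec : J k + Q e = e := by rw [← hRe]; exact hs.frame.decomp e
  -- The two image points lie over the same coordinate `h`, so their difference is purely central.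
  -- As `T` expands the other coordinate, the difference `k` of the source coordinates must be
  -- small.
  have hRd : R' d = 0 := by
    have e1 : d = (Φ₁ (φ₁ k₁) - p') - (Φ₂ (φ₂ k₂) - p') := by rw [hdd]; abel
    rw [e1, map_sub, hh₁, hh₂, sub_self]
  have hr1 : ‖d - T e‖ ≤ c * ‖e‖ + ε := by
    have e1 : d - T e = (Φ₁ (φ₁ k₁) - Φ₁ (φ₂ k₂) - T e) + (Φ₁ (φ₂ k₂) - Φ₂ (φ₂ k₂)) := by
      rw [hdd]; abel
    rw [e1]
    exact (norm_add_le _ _).trans (add_le_add (hΦ _ (hB₁ _ hk₁) _ (hB₂ _ hk₂)) (hclose _))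
  have hQe : ‖Q e‖ ≤ ‖e‖ := hs.frame.norm_Q e
  have hk1 : 3 * μ * ‖k‖ ≤ 2 * c * ‖e‖ + ε := by
    have e1 : R' (T (J k)) = - R' (d - T e) - R' (T (Q e)) := by
      have : T e = T (J k) + T (Q e) := by rw [← map_add, hdec]
      rw [map_sub R' d, hRd, this, map_add R']; abel
    have h1 := hs.expand k
    rw [e1] at h1
    have h2 := _root_.norm_sub_le (-R' (d - T e)) (R' (T (Q e)))
    rw [norm_neg] at h2
    have h3 := hf'.norm_coord (d - T e)
    have h4 := hs.almost_inv e
    have h5 : c * ‖Q e‖ ≤ c * ‖e‖ := by gcongr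
    linarith
  have hk2 : ‖k‖ ≤ c * ‖e‖ + ε := by
    have : 3 * ‖k‖ ≤ 3 * μ * ‖k‖ := by gcongr; linarith
    nlinarith [norm_nonneg e, norm_nonneg k, mul_nonneg hc0 (norm_nonneg e)]
  have ha : 0 ≤ a := by linarith
  have hc1 : c * (1 + a) ≤ 1 / 8 := by nlinarith
  have he1 : ‖e‖ ≤ θ * ‖k₁‖ + κ + (1 + a) * ‖k‖ := by
    have e1 : e = (φ₁ k₁ - φ₂ k₁) + (φ₂ k₁ - φ₂ k₂) := by rw [he]; abel
    rw [e1]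
    exact (norm_add_le _ _).trans (add_le_add (hd _ hk₁) (h₂.norm_sub_le hs.frame hk₁ hk₂))
  have he2 : ‖e‖ ≤ 8 / 7 * (θ * ‖k₁‖ + κ + (1 + a) * ε) := by
    have h1 : (1 + a) * ‖k‖ ≤ (1 + a) * (c * ‖e‖ + ε) := by gcongr
    have h2 : c * (1 + a) * ‖e‖ ≤ 1 / 8 * ‖e‖ := by gcongr
    nlinarith
  have hd1 : ‖d‖ ≤ 9 / 8 * μ * ‖e‖ + (L + 1) * ε := by
    have h1 := norm_le_norm_add_norm_sub' d (T e)
    have h2 : ‖T e‖ ≤ L * ‖k‖ + μ * ‖Q e‖ := by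
      have : T e = T (J k) + T (Q e) := by rw [← map_add, hdec]
      rw [this]
      refine (norm_add_le _ _).trans (add_le_add ?_ (hs.center e))
      exact (hs.bound _).trans (by rw [hs.frame.norm_J])
    have h3 : L * ‖k‖ ≤ L * (c * ‖e‖ + ε) := by
      gcongr; linarith
    have h4 : μ * ‖Q e‖ ≤ μ * ‖e‖ := by gcongr
    have h5 : c * (L + 1) * ‖e‖ ≤ 1 / 8 * ‖e‖ := by
      gcongr
      exact (mul_le_mul_of_nonneg_left (by linarith) hc0).trans hc1
    nlinarith [norm_nonneg e]
  have hk₁' : 2 * μ * ‖k₁‖ ≤ ‖h‖ + (L * κ + ε) := by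
    have h1 := h₁.expand_image hs hc0 hca hB₁ hΦ hk₁ (mem_ball_self hr)
    rw [sub_zero] at h1
    have e1 : Φ₁ (φ₁ k₁) - Φ₁ (φ₁ 0) = (Φ₁ (φ₁ k₁) - p') - (Φ₁ (φ₁ 0) - p') := by abel
    rw [e1, map_sub, hh₁] at h1
    have h2 := _root_.norm_sub_le h (R' (Φ₁ (φ₁ 0) - p'))
    have h3 := hf'.norm_coord (Φ₁ (φ₁ 0) - p')
    linarith
  -- The factor `9 / 8 * 8 / 7 = 9 / 7` collects the losses. The center growth `μ` is beaten by the
  -- coordinate growth `2 * μ`, so the new slope factor is `9 / 14 < 2 / 3`; the remaining terms go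
  -- into the additive error.
  have h1 : ‖d‖ ≤ 9 / 7 * (μ * ‖k₁‖) * θ + 9 / 7 * μ * (κ + (1 + a) * ε) + (L + 1) * ε := by
    have : 9 / 8 * μ * ‖e‖ ≤ 9 / 8 * μ * (8 / 7 * (θ * ‖k₁‖ + κ + (1 + a) * ε)) := by gcongr
    linarith
  have h2 : μ * ‖k₁‖ * θ ≤ (‖h‖ + (L * κ + ε)) / 2 * θ := by
    gcongr; linarith
  have h3 : (L * κ + ε) * θ ≤ (a * κ + ε) * (2 * a) := by
    gcongr; linarith
  have h4 : μ * (κ + (1 + a) * ε) ≤ a * (κ + (1 + a) * ε) := by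
    gcongr
    linarith
  have h5 : (L + 1) * ε ≤ a * ε := by gcongr
  have h6 : 0 ≤ θ * ‖h‖ := by positivity
  have h7 : 0 ≤ a * κ := by positivity
  have h8 : 0 ≤ a * ε := by positivity
  have h9 : 0 ≤ a ^ 2 * κ := by positivity
  have h10 : 0 ≤ a ^ 2 * ε := by positivity
  nlinarith

end GraphTransform

/-! ### Dominated systems and growth of discs under iteration -/

section DominatedSystem

variable {X W : Type*} [NormedAddCommGroup X] [NormedSpace ℝ X]
  [NormedAddCommGroup W] [NormedSpace ℝ W]

/-- A uniformly `C¹` map preserving the field of ranges of the projections `Q x`, the center, which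
is dominated by the complementary coordinate `R x`, expanded by a factor at least `4`. -/
structure DominatedSystem (F : X → X) (J : X → W →L[ℝ] X) (R : X → X →L[ℝ] W)
    (Q : X → X →L[ℝ] X) (L : ℝ) : Prop where
  unifC1 : UnifC1 F
  frame : ∀ x, Frame (J x) (R x) (Q x)
  bound : ∀ x, ‖fderiv ℝ F x‖ ≤ L
  lower : ∀ x v, ‖v‖ ≤ L * ‖fderiv ℝ F x v‖
  unifQ : ∀ c > (0 : ℝ), ∃ ρ > (0 : ℝ), ∀ x y, ‖x - y‖ ≤ ρ → ‖Q x - Q y‖ ≤ c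
  center_inv : ∀ x v, Q (F x) (fderiv ℝ F x (Q x v)) = fderiv ℝ F x (Q x v)
  dominated : ∀ x, ∃ μ, 1 ≤ μ ∧ μ ≤ L ∧ (∀ v, ‖fderiv ℝ F x (Q x v)‖ ≤ μ * ‖Q x v‖) ∧
    ∀ w, 4 * μ * ‖R x w‖ ≤ ‖R (F x) (fderiv ℝ F x w)‖

variable {F : X → X} {J : X → W →L[ℝ] X} {R : X → X →L[ℝ] W} {Q : X → X →L[ℝ] X} {L : ℝ}

theorem DominatedSystem.one_le (hS : DominatedSystem F J R Q L) : 1 ≤ L := by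
  obtain ⟨μ, h1, h2, -⟩ := hS.dominated 0
  exact h1.trans h2

theorem DominatedSystem.norm_le (hS : DominatedSystem F J R Q L) (x v : X) :
    ‖fderiv ℝ F x v‖ ≤ L * ‖v‖ := (fderiv ℝ F x).le_of_opNorm_le (hS.bound x) v

theorem DominatedSystem.norm_sub_le (hS : DominatedSystem F J R Q L) (x y : X) :
    ‖F x - F y‖ ≤ L * ‖x - y‖ :=
  norm_sub_le_of_fderiv_le hS.unifC1.differentiable hS.bound x y

/-- The norm of the coordinate is the norm of the complementary projection. -/
theorem DominatedSystem.norm_coord_sub_le (hS : DominatedSystem F J R Q L) (x y v : X) :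
    ‖R x v‖ ≤ ‖R y v‖ + ‖Q x - Q y‖ * ‖v‖ := by
  rw [(hS.frame x).norm_coord_eq, (hS.frame y).norm_coord_eq]
  have e : v - Q x v = (v - Q y v) - (Q x - Q y) v := by simp
  rw [e]
  exact (_root_.norm_sub_le _ _).trans (add_le_add le_rfl ((Q x - Q y).le_opNorm v))

/-- Exact invariance of the center and expansion `4 * μ` hold in the frame at `F p`. Passing to the
frame at a nearby `p'` costs `‖Q (F p) - Q p'‖ * L`: at most 1 in the expansion, leaving `3 * μ`,
and at most `c` in the invariance. -/
theorem DominatedSystem.exists_dominatedStep (hS : DominatedSystem F J R Q L) {c : ℝ} (hc : 0 < c) :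
    ∃ δ > (0 : ℝ), ∀ p p', ‖F p - p'‖ ≤ δ → ∃ μ,
      DominatedStep (J p) (R p) (Q p) (R p') (Q p') (fderiv ℝ F p) L μ c := by
  have hL := hS.one_le
  have hL0 : 0 < L := by linarith
  obtain ⟨δ, hδ, hQ⟩ := hS.unifQ (min (c / L) (1 / L)) (by positivity)
  refine ⟨δ, hδ, fun p p' hp => ?_⟩
  have hQ1 : ‖Q (F p) - Q p'‖ * L ≤ c := by
    rw [← le_div_iff₀ hL0]; exact (hQ _ _ hp).trans (min_le_left _ _)
  have hQ2 : ‖Q (F p) - Q p'‖ * L ≤ 1 := by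
    rw [← le_div_iff₀ hL0]; exact (hQ _ _ hp).trans (min_le_right _ _)
  obtain ⟨μ, hμ1, hμL, hμc, hμe⟩ := hS.dominated p
  refine ⟨μ, hS.frame p, ⟨_, hS.frame p'⟩, hμ1, hμL, hS.norm_le p, hμc, fun h => ?_, fun v => ?_⟩
  · have h1 := hμe (J p h)
    rw [(hS.frame p).coord_J] at h1
    have h2 := hS.norm_coord_sub_le (F p) p' (fderiv ℝ F p (J p h))
    have h3 := hS.norm_le p (J p h)
    rw [(hS.frame p).norm_J] at h3
    have h4 : ‖Q (F p) - Q p'‖ * ‖fderiv ℝ F p (J p h)‖ ≤ ‖Q (F p) - Q p'‖ * (L * ‖h‖) := by gcongr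
    have h5 : ‖Q (F p) - Q p'‖ * L * ‖h‖ ≤ 1 * ‖h‖ := by gcongr
    nlinarith [norm_nonneg h]
  · have h1 := hS.norm_coord_sub_le p' (F p) (fderiv ℝ F p (Q p v))
    have h2 : R (F p) (fderiv ℝ F p (Q p v)) = 0 := by
      rw [← hS.center_inv p v, (hS.frame (F p)).coord_Q]
    rw [h2, norm_zero, zero_add, norm_sub_rev] at h1
    have h3 := hS.norm_le p (Q p v)
    have h4 : ‖Q (F p) - Q p'‖ * ‖fderiv ℝ F p (Q p v)‖ ≤
      ‖Q (F p) - Q p'‖ * (L * ‖Q p v‖) := by gcongr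
    have h5 : ‖Q (F p) - Q p'‖ * L * ‖Q p v‖ ≤ c * ‖Q p v‖ := by gcongr
    linarith

theorem UnifC1.exists_approx (hF : UnifC1 F) {c : ℝ} (hc : 0 < c) :
    ∃ δ > (0 : ℝ), ∃ ε > (0 : ℝ), ∀ Φ : X → X, ContDiff ℝ 1 Φ → C1Close F Φ ε → ∀ p,
      ∀ y ∈ closedBall p δ, ∀ y' ∈ closedBall p δ,
        ‖Φ y - Φ y' - fderiv ℝ F p (y - y')‖ ≤ c * ‖y - y'‖ := by
  obtain ⟨δ, hδ, hu⟩ := hF.unif (c / 2) (by positivity)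
  refine ⟨δ, hδ, c / 2, by positivity, fun Φ hΦ hcl p => ?_⟩
  refine approximatesLinearOn_of_fderiv_le (c := ⟨c, hc.le⟩) (convex_closedBall p δ)
    (fun x _ => hΦ.differentiable (by norm_num) x) fun x hx => ?_
  have h1 := hu x p (by simpa [dist_eq_norm] using hx)
  have h2 := (hcl x).2
  rw [norm_sub_rev] at h2
  have h3 := norm_sub_le_norm_sub_add_norm_sub (fderiv ℝ Φ x) (fderiv ℝ F x) (fderiv ℝ F p)
  show _ ≤ c
  linarith

/-- Constants `c`, `ρ`, `ε` for which graph transforms of maps `ε`-close to `F` act on graph discs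
of radius at most `ρ`. -/
structure GraphScale (F : X → X) (J : X → W →L[ℝ] X) (R : X → X →L[ℝ] W)
    (Q : X → X →L[ℝ] X) (L a c ρ ε : ℝ) : Prop where
  c_pos : 0 < c
  c_small : c * (1 + 2 * a) ≤ 1 / 8
  le_a : L + 1 ≤ a
  ρ_pos : 0 < ρ
  ε_pos : 0 < ε
  approx : ∀ Φ : X → X, ContDiff ℝ 1 Φ → C1Close F Φ ε → ∀ p,
    ∀ y ∈ closedBall p ((2 + a) * ρ), ∀ y' ∈ closedBall p ((2 + a) * ρ),
      ‖Φ y - Φ y' - fderiv ℝ F p (y - y')‖ ≤ c * ‖y - y'‖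
  step : ∀ p p', ‖F p - p'‖ ≤ L * ((2 + a) * ρ) + ε → ∃ μ,
    DominatedStep (J p) (R p) (Q p) (R p') (Q p') (fderiv ℝ F p) L μ c

/-- Graph scales exist, with `ρ` and `ε` as small as one likes. -/
theorem DominatedSystem.exists_graphScale (hS : DominatedSystem F J R Q L) {a : ℝ}
    (ha : L + 1 ≤ a) {ρ₀ : ℝ} (hρ₀ : 0 < ρ₀) :
    ∃ c ρ ε, ρ ≤ ρ₀ ∧ GraphScale F J R Q L a c ρ ε := by
  have hL := hS.one_le
  have ha0 : 0 < a := by linarith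
  set c : ℝ := 1 / (8 * (1 + 2 * a)) with hcdef
  have hc : 0 < c := by positivity
  obtain ⟨δ₁, hδ₁, h₁⟩ := hS.exists_dominatedStep hc
  obtain ⟨δ₂, hδ₂, ε₂, hε₂, h₂⟩ := hS.unifC1.exists_approx hc
  have hL0 : 0 < L := by linarith
  set ρ := min ρ₀ (min (δ₂ / (2 + a)) (δ₁ / (2 * L * (2 + a)))) with hρdef
  have hρ : 0 < ρ := by positivity
  have hρ1 : (2 + a) * ρ ≤ δ₂ := by
    have : ρ ≤ δ₂ / (2 + a) := (min_le_right _ _).trans (min_le_left _ _)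
    rw [le_div_iff₀ (by positivity)] at this
    linarith
  have hρ2 : L * ((2 + a) * ρ) ≤ δ₁ / 2 := by
    have : ρ ≤ δ₁ / (2 * L * (2 + a)) := (min_le_right _ _).trans (min_le_right _ _)
    rw [le_div_iff₀ (by positivity)] at this
    linarith
  refine ⟨c, ρ, min ε₂ (δ₁ / 2), min_le_left _ _, hc, le_of_eq (by rw [hcdef]; field_simp), ha, hρ,
    by positivity, fun Φ hΦ hcl p y hy y' hy' => ?_, fun p p' hp => h₁ p p' ?_⟩
  · exact h₂ Φ hΦ (hcl.mono (min_le_left _ _)) p y (closedBall_subset_closedBall hρ1 hy) y'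
      (closedBall_subset_closedBall hρ1 hy')
  · have : min ε₂ (δ₁ / 2) ≤ δ₁ / 2 := min_le_right _ _
    linarith

variable {a c ρ ε : ℝ}

/-- The radius `(2 + a) * ρ` is made of `ρ` for the offset of the disc from its base point and `(1 +
a) * ρ` for its extent. -/
theorem GraphScale.mem_closedBall (hG : GraphScale F J R Q L a c ρ ε)
    (hS : DominatedSystem F J R Q L) {p : X} {r : ℝ} {φ : W → X}
    (hφ : GraphDisc (R p) (Q p) a p r φ) (hr : r ≤ ρ) (hr0 : 0 < r) (h0 : ‖φ 0 - p‖ ≤ ρ) :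
    ∀ h ∈ ball (0 : W) r, φ h ∈ closedBall p ((2 + a) * ρ) := by
  intro h hh
  have h1 := hφ.norm_sub_le (hS.frame p) hh (mem_ball_self hr0)
  have h2 : ‖h‖ ≤ ρ := by
    have : ‖h‖ < r := by simpa using hh
    linarith
  have h3 := norm_sub_le_norm_sub_add_norm_sub (φ h) (φ 0) p
  have ha : 0 ≤ 1 + a := by linarith [hG.le_a, hS.one_le]
  rw [sub_zero] at h1
  have h4 : (1 + a) * ‖h‖ ≤ (1 + a) * ρ := by gcongr
  rw [Metric.mem_closedBall, dist_eq_norm]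
  linarith

/-- One step of the graph transform along the orbit of a point of the disc. -/
theorem GraphScale.exists_image [FiniteDimensional ℝ W] (hG : GraphScale F J R Q L a c ρ ε)
    (hS : DominatedSystem F J R Q L) {Φ : X → X} (hΦ : ContDiff ℝ 1 Φ) (hcl : C1Close F Φ ε)
    {p : X} {r : ℝ} {φ : W → X} (hφ : GraphDisc (R p) (Q p) a p r φ) (hr : r ≤ ρ) (hr0 : 0 < r)
    (h0 : ‖φ 0 - p‖ ≤ ρ) {h₀ : W} {s r' : ℝ} (hs : 0 < s) (hsr : ball h₀ s ⊆ ball 0 r) {p' : X}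
    (hp' : ‖F p - p'‖ ≤ L * ((2 + a) * ρ) + ε)
    (hr' : r' + ‖R p' (Φ (φ h₀) - p')‖ ≤ 2 * s) :
    ∃ φ' : W → X, ∃ ψ : W → W, GraphDisc (R p') (Q p') a p' r' φ' ∧
      (∀ h ∈ ball (0 : W) r', ψ h ∈ ball h₀ s ∧ φ' h = Φ (φ (ψ h)) ∧
        ∀ w, ∃ w', fderiv ℝ φ' h w = fderiv ℝ Φ (φ (ψ h)) (fderiv ℝ φ (ψ h) w')) ∧
      (∀ h ∈ ball (0 : W) r', 2 * ‖ψ h - h₀‖ ≤ ‖h - R p' (Φ (φ h₀) - p')‖) ∧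
      (Φ (φ h₀) = p' → 0 < r' → ψ 0 = h₀ ∧ φ' 0 = p') := by
  obtain ⟨μ, hstep⟩ := hG.step p p' hp'
  have hB := hG.mem_closedBall hS hφ hr hr0 h0
  obtain ⟨φ', ψ, h1, h2⟩ := hφ.exists_image hstep hG.c_pos.le hG.c_small hG.le_a hB
    (hG.approx Φ hΦ hcl p) hΦ hsr hr'
  have hexp : ∀ h ∈ ball (0 : W) r', 2 * ‖ψ h - h₀‖ ≤ ‖h - R p' (Φ (φ h₀) - p')‖ := by
    intro h hh
    have h3 := hφ.expand_image hstep hG.c_pos.le hG.c_small hB (hG.approx Φ hΦ hcl p)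
      (hsr (h2 h hh).1) (hsr (mem_ball_self hs))
    have e : Φ (φ (ψ h)) - Φ (φ h₀) = (φ' h - p') - (Φ (φ h₀) - p') := by
      rw [(h2 h hh).2.1]; abel
    rw [e, map_sub, h1.chart h hh] at h3
    have := hstep.one_le
    nlinarith [norm_nonneg (ψ h - h₀)]
  refine ⟨φ', ψ, h1, h2, hexp, fun he hr'0 => ?_⟩
  have h3 := hexp 0 (mem_ball_self hr'0)
  rw [he, sub_self, map_zero, sub_self, norm_zero] at h3
  have h4 : ψ 0 = h₀ := by
    rw [← sub_eq_zero, ← norm_le_zero_iff]; linarith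
  refine ⟨h4, ?_⟩
  rw [(h2 0 (mem_ball_self hr'0)).2.1, h4, he]

/-- A disc tangent to the field of sets `C`. -/
def TangentTo (C : X → Set X) (r : ℝ) (φ : W → X) : Prop :=
  ∀ h ∈ ball (0 : W) r, ∀ w, fderiv ℝ φ h w ∈ C (φ h)

/-- Images of a disc of small radius `r₀` under the iterates of a map grow to radius `ρ`. -/
theorem GraphScale.exists_iterate_image [FiniteDimensional ℝ W]
    (hG : GraphScale F J R Q L a c ρ ε) (hS : DominatedSystem F J R Q L) {Φ : X → X}
    (hΦ : ContDiff ℝ 1 Φ) (hcl : C1Close F Φ ε) {p : X} {r₀ : ℝ} {φ : W → X}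
    (hφ : GraphDisc (R p) (Q p) a p r₀ φ) (hr₀ : r₀ ≤ ρ) (hr0 : 0 < r₀) (h0 : ‖φ 0 - p‖ ≤ ρ)
    {t : W} (ht : ‖t‖ ≤ r₀ / 2) (k : ℕ) :
    ∃ γ : W → X, GraphDisc (R (Φ^[k + 1] (φ t))) (Q (Φ^[k + 1] (φ t))) a (Φ^[k + 1] (φ t))
        (min ρ (2 ^ k * r₀)) γ ∧ γ 0 = Φ^[k + 1] (φ t) ∧
      ∀ h ∈ ball (0 : W) (min ρ (2 ^ k * r₀)), ∃ t' ∈ ball t (r₀ / 2), γ h = Φ^[k + 1] (φ t') ∧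
        2 ^ (k + 1) * ‖t' - t‖ ≤ ‖h‖ ∧
        ∀ i ≤ k + 1, 2 ^ (k + 1) * ‖Φ^[i] (φ t') - Φ^[i] (φ t)‖ ≤ (1 + a) * ‖h‖ * 2 ^ i := by
  have ha : 0 ≤ 1 + a := by linarith [hG.le_a, hS.one_le]
  have hsub : ball t (r₀ / 2) ⊆ ball 0 r₀ := by
    refine ball_subset_ball' ?_
    rw [dist_zero_right]; linarith
  have htmem : t ∈ ball (0 : W) r₀ := by
    rw [mem_ball_zero_iff]; linarith
  induction k with
  | zero =>
    -- The first iterate recenters the disc at `φ t`: only a ball of radius `r₀ / 2` around `t` is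
    -- available, and doubling it restores `r₀`. Hence `k + 1` iterates yield radius `2 ^ k * r₀`.
    have hmin : min ρ (2 ^ 0 * r₀) = r₀ := by rw [pow_zero, one_mul, min_eq_right hr₀]
    rw [hmin]
    simp only [zero_add, Function.iterate_one, pow_one]
    have hmem := hG.mem_closedBall hS hφ hr₀ hr0 h0 t htmem
    rw [Metric.mem_closedBall, dist_eq_norm] at hmem
    obtain ⟨γ, ψ, h1, h2, h3, h4⟩ := hG.exists_image hS hΦ hcl hφ hr₀ hr0 h0 (h₀ := t)
      (s := r₀ / 2) (r' := r₀) (p' := Φ (φ t)) (by positivity) hsub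
      (by
        have e1 := hS.norm_sub_le (φ t) p
        rw [norm_sub_rev] at e1
        have e2 := (hcl (φ t)).1
        have e3 := norm_sub_le_norm_sub_add_norm_sub (F p) (F (φ t)) (Φ (φ t))
        have e4 : L * ‖φ t - p‖ ≤ L * ((2 + a) * ρ) := by
          gcongr; linarith [hS.one_le]
        linarith)
      (by simp; linarith)
    refine ⟨γ, h1, (h4 rfl hr0).2, fun h hh => ⟨ψ h, (h2 h hh).1, (h2 h hh).2.1, ?_, ?_⟩⟩
    · simpa using h3 h hh
    · have h5 := h3 h hh
      rw [sub_self, map_zero, sub_zero] at h5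
      intro i hi
      interval_cases i
      · have h6 := hφ.norm_sub_le (hS.frame p) (hsub (h2 h hh).1) htmem
        have h7 : (1 + a) * (2 * ‖ψ h - t‖) ≤ (1 + a) * ‖h‖ := by gcongr
        simp only [Function.iterate_zero, id_eq, pow_zero, mul_one]
        linarith
      · have h6 := h1.norm_sub_le (hS.frame _) hh (mem_ball_self hr0)
        rw [(h4 rfl hr0).2, (h2 h hh).2.1, sub_zero] at h6
        simp only [Function.iterate_one, pow_one]
        linarith
  | succ k ih =>
    obtain ⟨γ, g1, g2, g3⟩ := ih
    set x := Φ^[k + 1] (φ t) with hx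
    have hx' : Φ^[k + 1 + 1] (φ t) = Φ x := by rw [Function.iterate_succ_apply']
    rw [hx']
    set r := min ρ (2 ^ k * r₀) with hr
    have hrpos : 0 < r := lt_min hG.ρ_pos (by positivity)
    set r' := min ρ (2 ^ (k + 1) * r₀) with hr'
    have hr'pos : 0 < r' := lt_min hG.ρ_pos (by positivity)
    have hrr' : r' ≤ 2 * r := by
      rw [hr, hr', mul_min_of_nonneg _ _ (by norm_num : (0:ℝ) ≤ 2)]
      refine min_le_min (by linarith [hG.ρ_pos]) (le_of_eq (by ring))
    obtain ⟨γ', ψ, h1, h2, h3, h4⟩ := hG.exists_image hS hΦ hcl g1 (min_le_left _ _) hrpos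
      (by rw [g2, sub_self, norm_zero]; exact hG.ρ_pos.le) (h₀ := 0) (s := r) (r' := r')
      (p' := Φ x) hrpos subset_rfl
      (by
        have := (hcl x).1
        have e1 : 0 ≤ L * ((2 + a) * ρ) := by
          have hL : 0 ≤ L := by linarith [hS.one_le]
          have hρ := hG.ρ_pos
          have ha' : 0 ≤ 2 + a := by linarith
          positivity
        linarith)
      (by rw [g2, sub_self, map_zero, norm_zero, add_zero]; exact hrr')
    obtain ⟨-, h5⟩ := h4 (by rw [g2]) hr'pos
    refine ⟨γ', h1, h5, fun h hh => ?_⟩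
    obtain ⟨e1, e2, -⟩ := h2 h hh
    obtain ⟨t', f1, f2, f3, f4⟩ := g3 (ψ h) e1
    have e3 := h3 h hh
    rw [g2, sub_self, map_zero, sub_zero, sub_zero] at e3
    refine ⟨t', f1, ?_, ?_, fun i hi => ?_⟩
    · rw [e2, f2, Function.iterate_succ_apply' Φ (k + 1)]
    · rw [pow_succ]; linarith
    · rcases Nat.lt_or_ge i (k + 2) with hi' | hi'
      · have := f4 i (by omega)
        have e4 : (1 + a) * (2 * ‖ψ h‖) * 2 ^ i ≤ (1 + a) * ‖h‖ * 2 ^ i := by gcongr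
        rw [pow_succ]
        linarith
      · have hi2 : i = k + 1 + 1 := by omega
        subst hi2
        rw [Function.iterate_succ_apply' Φ (k + 1), ← f2, ← e2, hx', ← h5, mul_comm _ (2 ^ _)]
        have := h1.norm_sub_le (hS.frame _) hh (mem_ball_self hr'pos)
        rw [sub_zero] at this
        gcongr

end DominatedSystem

/-! ### Approaching tangent discs and shadowing center expanding orbits -/

section BlowUp

variable {X W : Type*} [NormedAddCommGroup X] [NormedSpace ℝ X]
  [NormedAddCommGroup W] [NormedSpace ℝ W]

variable {F : X → X} {J : X → W →L[ℝ] X} {R : X → X →L[ℝ] W} {Q : X → X →L[ℝ] X} {L : ℝ}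
  {a c ρ ε : ℝ} {C : X → Set X}

theorem c1Close_self (F : X → X) {ε : ℝ} (hε : 0 ≤ ε) : C1Close F F ε := fun x => by simp [hε]

theorem graphDisc_affine {p : X} {ℓ : W →L[ℝ] X} (hR : ∀ h, R p (ℓ h) = h)
    (hQ : ∀ h, ‖Q p (ℓ h)‖ ≤ a * ‖h‖) (r : ℝ) :
    GraphDisc (R p) (Q p) a p r (fun h => p + ℓ h) where
  contDiffAt := fun h _ => (contDiff_const.add ℓ.contDiff).contDiffAt
  chart := fun h _ => by simp [hR]
  cone := fun h _ h' _ => by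
    rw [add_sub_add_left_eq_sub, ← map_sub]
    exact hQ _

/-- A disc that has been iterated for a long time is close to a disc tangent to `C`. -/
theorem GraphScale.exists_tangent_near [FiniteDimensional ℝ W]
    (hG : GraphScale F J R Q L a c ρ ε) (hS : DominatedSystem F J R Q L)
    (hC1 : ∀ x, ∀ v ∈ C x, fderiv ℝ F x v ∈ C (F x))
    (hC2 : ∀ p, ∃ ℓ : W →L[ℝ] X, (∀ h, R p (ℓ h) = h) ∧ (∀ h, ‖Q p (ℓ h)‖ ≤ a * ‖h‖) ∧
      ∀ y, ‖y - p‖ ≤ (1 + a) * ρ → ∀ h, ℓ h ∈ C y)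
    {Φ : X → X} (hΦ : ContDiff ℝ 1 Φ) {ε' : ℝ} (hε' : ε' ≤ ε) (hε'0 : 0 ≤ ε')
    (hcl : C1Close F Φ ε') {x : X} {γ : W → X} (hγ : GraphDisc (R x) (Q x) a x ρ γ)
    (hγ0 : γ 0 = x) (M : ℕ) (hM : L * (ε' * (8 * (1 + a) ^ 2) ^ M) + ε' ≤ ρ) :
    ∃ γ' σ : W → X, GraphDisc (R (Φ^[M] x)) (Q (Φ^[M] x)) a (Φ^[M] x) ρ γ' ∧ γ' 0 = Φ^[M] x ∧
      GraphDisc (R (Φ^[M] x)) (Q (Φ^[M] x)) a (Φ^[M] x) ρ σ ∧ TangentTo C ρ σ ∧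
      (∀ h ∈ ball (0 : W) ρ, ‖σ h - γ' h‖ ≤
        (2 / 3) ^ M * (2 * a) * ‖h‖ + ε' * (8 * (1 + a) ^ 2) ^ M) ∧
      ∀ h ∈ ball (0 : W) ρ, ∃ h' ∈ ball (0 : W) ρ, γ' h = Φ^[M] (γ h') ∧ 2 ^ M * ‖h'‖ ≤ ‖h‖ ∧
        ∀ i ≤ M, 2 ^ M * ‖Φ^[i] (γ h') - Φ^[i] x‖ ≤ (1 + a) * ‖h‖ * 2 ^ i := by
  have hρ := hG.ρ_pos
  have hL := hS.one_le
  have haL := hG.le_a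
  have ha : 0 ≤ 1 + a := by linarith
  have hK : 1 ≤ 4 * (1 + a) ^ 2 := by nlinarith
  have h0mem : (0 : W) ∈ ball (0 : W) ρ := mem_ball_self hρ
  induction M with
  | zero =>
    -- The comparison disc starts as an affine disc tangent to `C` through the same point. Both
    -- slopes are at most `a`, whence the initial factor `2 * a`.
    obtain ⟨ℓ, hℓ1, hℓ2, hℓ3⟩ := hC2 x
    have hσ := graphDisc_affine (p := x) hℓ1 hℓ2 ρ
    refine ⟨γ, fun h => x + ℓ h, hγ, hγ0, hσ, fun h hh w => ?_, fun h hh => ?_, fun h hh =>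
      ⟨h, hh, rfl, by simp, fun i hi => ?_⟩⟩
    · have hd : fderiv ℝ (fun h => x + ℓ h) h = ℓ := by
        rw [fderiv_const_add]; exact ℓ.fderiv
      rw [hd]
      refine hℓ3 _ ?_ w
      have := hσ.norm_sub_le (hS.frame x) hh h0mem
      have h2 : (1 + a) * ‖h - 0‖ ≤ (1 + a) * ρ := by
        gcongr
        rw [sub_zero]
        exact (mem_ball_zero_iff.1 hh).le
      simpa using this.trans h2
    · have e : x + ℓ h - γ h = ((x + ℓ h) - (x + ℓ 0)) - (γ h - γ 0) := by
        rw [hγ0, map_zero, add_zero]; abel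
      have h1 := (hS.frame x).norm_le (x + ℓ h - γ h)
      have h2 : R x (x + ℓ h - γ h) = 0 := by
        rw [e, map_sub, hσ.coord_sub hh h0mem, hγ.coord_sub hh h0mem, sub_self]
      have h3 := hσ.cone h hh 0 h0mem
      have h4 := hγ.cone h hh 0 h0mem
      have h5 := _root_.norm_sub_le (Q x ((x + ℓ h) - (x + ℓ 0))) (Q x (γ h - γ 0))
      rw [← map_sub, ← e] at h5
      rw [h2, norm_zero, zero_add] at h1
      rw [sub_zero] at h3 h4
      simp only [pow_zero, one_mul, mul_one]
      linarith
    · obtain rfl : i = 0 := by omega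
      have := hγ.norm_sub_le (hS.frame x) hh h0mem
      rw [hγ0, sub_zero] at this
      simpa using this
  | succ M ih =>
    set K := 8 * (1 + a) ^ 2 with hKdef
    have hκ : 0 ≤ ε' * K ^ M := by positivity
    have hκ1 : ε' * K ^ M ≤ ε' * K ^ (M + 1) := by
      rw [pow_succ, ← mul_assoc]
      exact le_mul_of_one_le_right hκ (by linarith)
    have hM' : L * (ε' * K ^ M) + ε' ≤ ρ := by
      refine le_trans ?_ hM
      gcongr
    obtain ⟨γ', σ, g1, g2, g3, g4, g5, g6⟩ := ih hM'
    set y := Φ^[M] x with hy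
    have hy' : Φ^[M + 1] x = Φ y := by rw [Function.iterate_succ_apply']
    rw [hy']
    have hclε := hcl.mono hε'
    have hFΦ := (hcl y).1
    have hp' : ‖F y - Φ y‖ ≤ L * ((2 + a) * ρ) + ε := by
      have e1 : 0 ≤ L * ((2 + a) * ρ) := by
        have hL : 0 ≤ L := by linarith
        have ha' : 0 ≤ 2 + a := by linarith
        positivity
      linarith
    have hσ0 : ‖σ 0 - y‖ ≤ ε' * K ^ M := by
      have := g5 0 h0mem
      rwa [g2, norm_zero, mul_zero, zero_add] at this
    have hσρ : ‖σ 0 - y‖ ≤ ρ := by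
      refine hσ0.trans (le_trans ?_ hM')
      nlinarith
    have hFσ : ‖F (σ 0) - Φ y‖ ≤ L * (ε' * K ^ M) + ε' := by
      have e1 := hS.norm_sub_le (σ 0) y
      have e2 : L * ‖σ 0 - y‖ ≤ L * (ε' * K ^ M) := by gcongr
      have e3 := norm_sub_le_norm_sub_add_norm_sub (F (σ 0)) (F y) (Φ y)
      linarith
    have hγρ : ‖γ' 0 - y‖ ≤ ρ := by rw [g2, sub_self, norm_zero]; exact hρ.le
    obtain ⟨γ'', ψ, h1, h2, h3, h4⟩ := hG.exists_image hS hΦ hclε g1 le_rfl hρ hγρ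
      (h₀ := 0) (s := ρ) (r' := ρ) (p' := Φ y) hρ subset_rfl hp'
      (by rw [g2, sub_self, map_zero, norm_zero]; linarith)
    -- The tangent disc is pushed by `F`, which preserves `C`, but is charted at the `Φ`-orbit so
    -- that both discs are graphs over the same ball. Its center drifts from that orbit by at most
    -- the additive error.
    obtain ⟨σ'', ψ', k1, k2, -, -⟩ := hG.exists_image hS hS.unifC1.contDiff
      (c1Close_self F hG.ε_pos.le) g3 le_rfl hρ hσρ (h₀ := 0) (s := ρ) (r' := ρ) (p' := Φ y) hρ
      subset_rfl hp' (by
        have := (hS.frame (Φ y)).norm_coord (F (σ 0) - Φ y)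
        linarith)
    obtain ⟨-, h5⟩ := h4 (by rw [g2]) hρ
    refine ⟨γ'', σ'', h1, h5, k1, fun h hh w => ?_, fun h hh => ?_, fun h hh => ?_⟩
    · obtain ⟨e1, e2, e3⟩ := k2 h hh
      obtain ⟨w', hw'⟩ := e3 w
      rw [hw', e2]
      exact hC1 _ _ (g4 _ e1 w')
    · obtain ⟨e1, e2, -⟩ := h2 h hh
      obtain ⟨f1, f2, -⟩ := k2 h hh
      obtain ⟨μ, hstep⟩ := hG.step y (Φ y) hp'
      have hθ : (2 / 3 : ℝ) ^ M * (2 * a) ≤ 2 * a := by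
        have : (2 / 3 : ℝ) ^ M ≤ 1 := pow_le_one₀ (by norm_num) (by norm_num)
        nlinarith
      have := g3.dist_image_le (Φ₁ := F) (Φ₂ := Φ) (h := h) g1 hstep hG.c_pos.le hG.c_small hG.le_a
        (hG.mem_closedBall hS g3 le_rfl hρ hσρ) (hG.mem_closedBall hS g1 le_rfl hρ hγρ)
        (hG.approx F hS.unifC1.contDiff (c1Close_self F hG.ε_pos.le) y) hε'0
        (fun z => (hcl z).1) (by have : 0 ≤ a := by linarith
                                 positivity) hθ hκ g5 hρ hFσ f1 e1
        (by rw [← f2]; exact k1.chart h hh) (by rw [← e2]; exact h1.chart h hh)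
      rw [← e2, ← f2] at this
      refine this.trans (le_of_le_of_eq (b := 2 / 3 * ((2 / 3) ^ M * (2 * a)) * ‖h‖ +
        4 * (1 + a) ^ 2 * (ε' * K ^ M + ε' * K ^ M)) ?_ ?_)
      · gcongr
        exact le_mul_of_one_le_right hε'0 (one_le_pow₀ (a := K) (by linarith))
      · rw [hKdef]; ring
    · obtain ⟨e1, e2, -⟩ := h2 h hh
      obtain ⟨h', f1, f2, f3, f4⟩ := g6 (ψ h) e1
      have e3 := h3 h hh
      rw [g2, sub_self, map_zero, sub_zero, sub_zero] at e3
      refine ⟨h', f1, ?_, ?_, fun i hi => ?_⟩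
      · rw [e2, f2, Function.iterate_succ_apply' Φ M]
      · rw [pow_succ]; linarith
      · rcases Nat.lt_or_ge i (M + 1) with hi' | hi'
        · have := f4 i (by omega)
          have e4 : (1 + a) * (2 * ‖ψ h‖) * 2 ^ i ≤ (1 + a) * ‖h‖ * 2 ^ i := by gcongr
          rw [pow_succ]
          linarith
        · have hi2 : i = M + 1 := by omega
          subst hi2
          rw [Function.iterate_succ_apply' Φ M, ← f2, ← e2, hy', ← h5, mul_comm _ (2 ^ _)]
          have := h1.norm_sub_le (hS.frame _) hh h0mem
          rw [sub_zero] at this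
          gcongr

/-- The center is expanded by the factor `4` at all iterates of `q` from time `m₀` on. -/
def CenterExpandingFrom (F : X → X) (Q : X → X →L[ℝ] X) (m₀ : ℕ) (q : X) : Prop :=
  ∀ k ≥ m₀, ∀ v, 4 * ‖Q (F^[k] q) v‖ ≤ ‖fderiv ℝ F (F^[k] q) (Q (F^[k] q) v)‖

/-- The tangent discs of radius `ρ` all have center expanding points. -/
def HasExpandingPoints (F : X → X) (R : X → X →L[ℝ] W) (Q : X → X →L[ℝ] X) (C : X → Set X)
    (a ρ : ℝ) (m₀ : ℕ) : Prop :=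
  ∀ p σ, GraphDisc (R p) (Q p) a p ρ σ → TangentTo C ρ σ →
    ∃ h, ‖h‖ ≤ ρ / 2 ∧ CenterExpandingFrom F Q m₀ (σ h)

/-- After `k + 1` steps the disc has radius `ρ`; after `M` more it is `η`-close to a disc tangent to
`C`. The point of the iterated disc with the same coordinate as an expanding point of the tangent
disc is pulled back to a parameter `t'`, all intermediate distances being controlled by backward
contraction. -/
theorem GraphScale.exists_near_expanding [FiniteDimensional ℝ W]
    (hG : GraphScale F J R Q L a c ρ ε) (hS : DominatedSystem F J R Q L)
    (hC1 : ∀ x, ∀ v ∈ C x, fderiv ℝ F x v ∈ C (F x))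
    (hC2 : ∀ p, ∃ ℓ : W →L[ℝ] X, (∀ h, R p (ℓ h) = h) ∧ (∀ h, ‖Q p (ℓ h)‖ ≤ a * ‖h‖) ∧
      ∀ y, ‖y - p‖ ≤ (1 + a) * ρ → ∀ h, ℓ h ∈ C y)
    {m₀ : ℕ} (hC3 : HasExpandingPoints F R Q C a ρ m₀)
    {Φ : X → X} (hΦ : ContDiff ℝ 1 Φ) {ε' : ℝ} (hε' : ε' ≤ ε) (hε'0 : 0 ≤ ε')
    (hcl : C1Close F Φ ε') {M : ℕ} (hM : L * (ε' * (8 * (1 + a) ^ 2) ^ M) + ε' ≤ ρ) {η : ℝ}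
    (hη : (2 / 3) ^ M * (2 * a) * ρ + ε' * (8 * (1 + a) ^ 2) ^ M ≤ η)
    {p : X} {r₀ : ℝ} {φ : W → X} (hφ : GraphDisc (R p) (Q p) a p r₀ φ) (hr₀ : r₀ ≤ ρ)
    (hr0 : 0 < r₀) (h0 : ‖φ 0 - p‖ ≤ ρ) {t : W} (ht : ‖t‖ ≤ r₀ / 2) {k : ℕ}
    (hk : ρ ≤ 2 ^ k * r₀) :
    ∃ t', 2 ^ (k + 1 + M) * ‖t' - t‖ ≤ ρ ∧
      (∀ i ≤ k + 1 + M, 2 ^ (k + 1 + M) * ‖Φ^[i] (φ t') - Φ^[i] (φ t)‖ ≤ (1 + a) * ρ * 2 ^ i) ∧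
      ∃ q, CenterExpandingFrom F Q m₀ q ∧ ‖Φ^[k + 1 + M] (φ t') - q‖ ≤ η := by
  have hρ := hG.ρ_pos
  have ha : 0 ≤ a := by linarith [hG.le_a, hS.one_le]
  obtain ⟨γ, g1, g2, g3⟩ := hG.exists_iterate_image hS hΦ (hcl.mono hε') hφ hr₀ hr0 h0 ht k
  rw [min_eq_left hk] at g1 g3
  obtain ⟨γ', σ, h1, h2, h3, h4, h5, h6⟩ :=
    hG.exists_tangent_near hS hC1 hC2 hΦ hε' hε'0 hcl g1 g2 M hM
  obtain ⟨h, hh, hq⟩ := hC3 _ σ h3 h4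
  have hhm : h ∈ ball (0 : W) ρ := by rw [mem_ball_zero_iff]; linarith
  obtain ⟨h', e1, e2, e3, e4⟩ := h6 h hhm
  obtain ⟨t', f1, f2, f3, f4⟩ := g3 h' e1
  have hhρ : ‖h‖ ≤ ρ := by linarith
  have hsplit : ∀ z, Φ^[M] (Φ^[k + 1] z) = Φ^[k + 1 + M] z := fun z => by
    rw [← Function.iterate_add_apply, add_comm M]
  refine ⟨t', ?_, fun i hi => ?_, σ h, hq, ?_⟩
  · rw [pow_add, mul_comm (2 ^ (k + 1)), mul_assoc]
    exact (mul_le_mul_of_nonneg_left f3 (by positivity)).trans (e3.trans hhρ)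
  · rcases le_total i (k + 1) with hi' | hi'
    · have := f4 i hi'
      calc 2 ^ (k + 1 + M) * ‖Φ^[i] (φ t') - Φ^[i] (φ t)‖
          = 2 ^ M * (2 ^ (k + 1) * ‖Φ^[i] (φ t') - Φ^[i] (φ t)‖) := by ring
        _ ≤ 2 ^ M * ((1 + a) * ‖h'‖ * 2 ^ i) := by gcongr
        _ = (1 + a) * (2 ^ M * ‖h'‖) * 2 ^ i := by ring
        _ ≤ (1 + a) * ρ * 2 ^ i := by gcongr; linarith
    · obtain ⟨j, rfl⟩ := Nat.exists_eq_add_of_le hi'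
      have := e4 j (by omega)
      rw [f2, ← Function.iterate_add_apply, ← Function.iterate_add_apply, add_comm j] at this
      calc 2 ^ (k + 1 + M) * ‖Φ^[k + 1 + j] (φ t') - Φ^[k + 1 + j] (φ t)‖
          = 2 ^ (k + 1) * (2 ^ M * ‖Φ^[k + 1 + j] (φ t') - Φ^[k + 1 + j] (φ t)‖) := by ring
        _ ≤ 2 ^ (k + 1) * ((1 + a) * ‖h‖ * 2 ^ j) := by gcongr
        _ = (1 + a) * ‖h‖ * 2 ^ (k + 1 + j) := by ring
        _ ≤ (1 + a) * ρ * 2 ^ (k + 1 + j) := by gcongr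
  · have h7 := h5 h hhm
    rw [e2, f2, hsplit, norm_sub_rev] at h7
    refine h7.trans (le_trans ?_ hη)
    gcongr

/-- The orbit of `w` under `Φ`, up to time `T`, approaches that of a point `u` which starts near a
center expanding point. -/
def ShadowsExpanding (F Φ : X → X) (Q : X → X →L[ℝ] X) (m₀ T : ℕ) (η B : ℝ) (w : X) : Prop :=
  ∃ u q, CenterExpandingFrom F Q m₀ q ∧ ‖u - q‖ ≤ η ∧
    ∀ i ≤ T, 2 ^ T * ‖Φ^[i] w - Φ^[i] u‖ ≤ B * 2 ^ i

/-- Expanding points are selected at times `T` apart, each time on the image of an ever smaller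
neighbourhood of the previous parameter. Later corrections shrink by `2 ^ T ≥ 2` per block, so their
total effect at the first selection time is at most twice that of a single one. Neither `T` nor the
closeness of `Φ` to `F` depends on the number `m` of blocks. -/
theorem GraphScale.exists_shadowsExpanding [FiniteDimensional ℝ W]
    (hG : GraphScale F J R Q L a c ρ ε) (hS : DominatedSystem F J R Q L)
    (hC1 : ∀ x, ∀ v ∈ C x, fderiv ℝ F x v ∈ C (F x))
    (hC2 : ∀ p, ∃ ℓ : W →L[ℝ] X, (∀ h, R p (ℓ h) = h) ∧ (∀ h, ‖Q p (ℓ h)‖ ≤ a * ‖h‖) ∧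
      ∀ y, ‖y - p‖ ≤ (1 + a) * ρ → ∀ h, ℓ h ∈ C y)
    {m₀ : ℕ} (hC3 : HasExpandingPoints F R Q C a ρ m₀)
    {Φ : X → X} (hΦ : ContDiff ℝ 1 Φ) {ε' : ℝ} (hε' : ε' ≤ ε) (hε'0 : 0 ≤ ε')
    (hcl : C1Close F Φ ε') {M : ℕ} (hM : L * (ε' * (8 * (1 + a) ^ 2) ^ M) + ε' ≤ ρ) {η : ℝ}
    (hη : (2 / 3) ^ M * (2 * a) * ρ + ε' * (8 * (1 + a) ^ 2) ^ M ≤ η)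
    {p : X} {r₀ : ℝ} {φ : W → X} (hφ : GraphDisc (R p) (Q p) a p r₀ φ) (hr₀ : r₀ ≤ ρ)
    (hr0 : 0 < r₀) (h0 : ‖φ 0 - p‖ ≤ ρ) {T : ℕ} (hT : 1 ≤ T) (m : ℕ) :
    ∀ (t : W) (k : ℕ), ρ ≤ 2 ^ k * r₀ → 2 * ρ ≤ 2 ^ (k + 1 + M) * (r₀ / 2 - ‖t‖) →
    ∃ t', 2 ^ (k + 1 + M) * ‖t' - t‖ ≤ 2 * ρ ∧
      (∀ i ≤ k + 1 + M, 2 ^ (k + 1 + M) * ‖Φ^[i] (φ t') - Φ^[i] (φ t)‖ ≤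
        2 * (1 + a) * ρ * 2 ^ i) ∧
      ∀ j < m, ShadowsExpanding F Φ Q m₀ T η (2 * (1 + a) * ρ) (Φ^[k + 1 + M + j * T] (φ t')) := by
  have hρ := hG.ρ_pos
  have ha : 0 ≤ a := by linarith [hG.le_a, hS.one_le]
  have h2T : (2 : ℝ) ≤ 2 ^ T := by
    calc (2 : ℝ) = 2 ^ 1 := (pow_one 2).symm
      _ ≤ 2 ^ T := pow_le_pow_right₀ (by norm_num) hT
  induction m with
  | zero =>
    intro t k _ _
    refine ⟨t, by simp [hρ.le], fun i _ => ?_, fun j hj => absurd hj (by omega)⟩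
    simp only [sub_self, norm_zero, mul_zero]
    positivity
  | succ m ih =>
    intro t k hk ht
    have ht0 : ‖t‖ ≤ r₀ / 2 := by
      by_contra hcon
      push Not at hcon
      have : 2 ^ (k + 1 + M) * (r₀ / 2 - ‖t‖) ≤ 0 :=
        mul_nonpos_of_nonneg_of_nonpos (by positivity) (by linarith)
      linarith
    obtain ⟨t₁, a1, a2, q, a3, a4⟩ := hG.exists_near_expanding hS hC1 hC2 hC3 hΦ hε' hε'0 hcl hM hη
      hφ hr₀ hr0 h0 ht0 hk
    have hk' : k + T + 1 + M = k + 1 + M + T := by omega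
    have hpow : (2 : ℝ) ^ (k + T + 1 + M) = 2 ^ (k + 1 + M) * 2 ^ T := by rw [hk', pow_add]
    set P : ℝ := 2 ^ (k + 1 + M) with hP
    have hP0 : 0 < P := by positivity
    obtain ⟨t', b1, b2, b3⟩ := ih t₁ (k + T)
      (hk.trans (by gcongr <;> [norm_num; omega]))
      (by
        have e1 : ‖t₁‖ ≤ ‖t‖ + ‖t₁ - t‖ := norm_le_norm_add_norm_sub' t₁ t
        -- Moving from `t` to `t₁` uses up at most half of the available room; multiplication by `2
        -- ^ T ≥ 2` restores the hypothesis at time `k + T`.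
        have e2 : ρ ≤ P * (r₀ / 2 - ‖t₁‖) := by nlinarith
        rw [hpow]
        nlinarith)
    rw [hpow] at b1 b2
    refine ⟨t', ?_, fun i hi => ?_, fun j hj => ?_⟩
    · have e1 : ‖t' - t‖ ≤ ‖t' - t₁‖ + ‖t₁ - t‖ := norm_sub_le_norm_sub_add_norm_sub _ _ _
      -- The later corrections contribute at most `ρ` at this scale, as does the first one; together
      -- they give `2 * ρ`.
      have e2 : 2 * (P * ‖t' - t₁‖) ≤ 2 * ρ :=
        le_trans (by nlinarith [mul_nonneg hP0.le (norm_nonneg (t' - t₁))]) b1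
      nlinarith
    · have e1 := norm_sub_le_norm_sub_add_norm_sub (Φ^[i] (φ t')) (Φ^[i] (φ t₁)) (Φ^[i] (φ t))
      have e2 := b2 i (by omega)
      have e3 := a2 i hi
      have e4 : 2 * (P * ‖Φ^[i] (φ t') - Φ^[i] (φ t₁)‖) ≤ 2 * (1 + a) * ρ * 2 ^ i :=
        le_trans (by nlinarith [mul_nonneg hP0.le (norm_nonneg (Φ^[i] (φ t') - Φ^[i] (φ t₁)))]) e2
      nlinarith
    · rcases j with _ | j
      -- In the first block the shadowed orbit is that of `φ t₁`. The induction bound refers to the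
      -- end of the block; dividing by `P` leaves the weight `2 ^ T`.
      · refine ⟨Φ^[k + 1 + M] (φ t₁), q, a3, a4, fun i hi => ?_⟩
        have e2 := b2 (k + 1 + M + i) (by omega)
        rw [← Function.iterate_add_apply, ← Function.iterate_add_apply, zero_mul, add_zero,
          add_comm i]
        rw [pow_add 2 (k + 1 + M) i, ← hP] at e2
        refine le_of_mul_le_mul_left ?_ hP0
        linarith
      · have := b3 j (by omega)
        have e : k + 1 + M + (j + 1) * T = k + T + 1 + M + j * T := by ring
        rwa [e]

end BlowUp

/-! ### Expansion along shadowing orbits and balls of uniform radius -/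

section BlowUpConclusion

variable {X W : Type*} [NormedAddCommGroup X] [NormedSpace ℝ X]
  [NormedAddCommGroup W] [NormedSpace ℝ W]

variable {F : X → X} {J : X → W →L[ℝ] X} {R : X → X →L[ℝ] W} {Q : X → X →L[ℝ] X} {L : ℝ}
  {a c ρ ε : ℝ} {C : X → Set X}

/-- The norm adapted to the splitting at `x`. -/
def splitNorm (R : X → X →L[ℝ] W) (Q : X → X →L[ℝ] X) (L : ℝ) (x v : X) : ℝ :=
  ‖Q x v‖ + L * ‖R x v‖

theorem DominatedSystem.le_splitNorm (hS : DominatedSystem F J R Q L) (x v : X) :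
    ‖v‖ ≤ splitNorm R Q L x v := by
  have h1 := (hS.frame x).norm_le v
  have h2 := hS.one_le
  unfold splitNorm
  nlinarith [norm_nonneg (R x v)]

theorem DominatedSystem.splitNorm_le (hS : DominatedSystem F J R Q L) (x v : X) :
    splitNorm R Q L x v ≤ (1 + L) * ‖v‖ := by
  have h1 := (hS.frame x).norm_coord v
  have h2 := (hS.frame x).norm_Q v
  have h3 := hS.one_le
  unfold splitNorm
  nlinarith [norm_nonneg (R x v)]

theorem DominatedSystem.splitNorm_add_le (hS : DominatedSystem F J R Q L) (x v w : X) :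
    splitNorm R Q L x (v + w) ≤ splitNorm R Q L x v + splitNorm R Q L x w := by
  unfold splitNorm
  rw [map_add, map_add]
  have h1 := norm_add_le (Q x v) (Q x w)
  have h2 := norm_add_le (R x v) (R x w)
  have h3 := hS.one_le
  nlinarith

theorem DominatedSystem.splitNorm_change (hS : DominatedSystem F J R Q L) (x y v : X) :
    splitNorm R Q L x v ≤ splitNorm R Q L y v + (1 + L) * (‖Q x - Q y‖ * ‖v‖) := by
  have h1 := hS.norm_coord_sub_le x y v
  have h2 : ‖Q x v‖ ≤ ‖Q y v‖ + ‖Q x - Q y‖ * ‖v‖ := by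
    have e : Q x v = Q y v + (Q x - Q y) v := by simp
    rw [e]
    exact (norm_add_le _ _).trans (add_le_add le_rfl ((Q x - Q y).le_opNorm v))
  have h3 := hS.one_le
  unfold splitNorm
  nlinarith

/-- The complement of the center is not invariant: the component `R x v` may alter the center part
of the image by `L * ‖R x v‖`. The weight `L` in the norm compensates this, as the transverse part
contributes at least `4 * L * ‖R x v‖`, leaving `3 * L`. -/
theorem DominatedSystem.splitNorm_fderiv (hS : DominatedSystem F J R Q L) (x v : X) :
    ‖fderiv ℝ F x (Q x v)‖ + 3 * L * ‖R x v‖ ≤ splitNorm R Q L (F x) (fderiv ℝ F x v) := by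
  obtain ⟨μ, h1, -, -, h2⟩ := hS.dominated x
  have h3 := h2 v
  have hL := hS.one_le
  have h4 : fderiv ℝ F x (Q x v) =
      Q (F x) (fderiv ℝ F x v) - Q (F x) (fderiv ℝ F x (J x (R x v))) := by
    rw [← hS.center_inv x v, ← map_sub, ← map_sub]
    congr 2
    exact eq_sub_of_add_eq' ((hS.frame x).decomp v)
  have h5 : ‖Q (F x) (fderiv ℝ F x (J x (R x v)))‖ ≤ L * ‖R x v‖ := by
    refine ((hS.frame _).norm_Q _).trans ((hS.norm_le _ _).trans ?_)
    rw [(hS.frame x).norm_J]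
  have h6 := _root_.norm_sub_le (Q (F x) (fderiv ℝ F x v)) (Q (F x) (fderiv ℝ F x (J x (R x v))))
  rw [← h4] at h6
  have h7 : 4 * ‖R x v‖ ≤ ‖R (F x) (fderiv ℝ F x v)‖ :=
    le_trans (by nlinarith [norm_nonneg (R x v)]) h3
  have h8 : L * (4 * ‖R x v‖) ≤ L * ‖R (F x) (fderiv ℝ F x v)‖ := by gcongr
  unfold splitNorm
  linarith

/-- One step estimates for the adapted norm: the loss is bounded, and there is a gain near points
where the center is expanded. -/
theorem DominatedSystem.exists_splitNorm_step (hS : DominatedSystem F J R Q L) :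
    ∃ δ > (0 : ℝ), ∃ ε > (0 : ℝ), ∀ Φ : X → X, C1Close F Φ ε → ∀ y v,
      splitNorm R Q L y v ≤ 2 * L * splitNorm R Q L (Φ y) (fderiv ℝ Φ y v) ∧
      ∀ x, ‖y - x‖ ≤ δ → (∀ u, 4 * ‖Q x u‖ ≤ ‖fderiv ℝ F x (Q x u)‖) →
        2 * splitNorm R Q L y v ≤ splitNorm R Q L (Φ y) (fderiv ℝ Φ y v) := by
  have hL := hS.one_le
  have hL0 : 0 < L := by linarith
  -- Replacing `F` by `Φ` and changing base point costs `(1 + L) * e * (1 + L) * ‖v‖ = ‖v‖ / (4 *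
  -- L)`.
  set e : ℝ := 1 / (4 * L * (1 + L) * (1 + L)) with he
  have he0 : 0 < e := by positivity
  -- Transferring center expansion 4 from `x` to `y` loses `(4 + L + 1) * b = 1`. The resulting
  -- factor 3, minus at most 1 for the perturbation, gives the gain 2.
  set b : ℝ := 1 / (L + 5) with hb
  have hb0 : 0 < b := by positivity
  obtain ⟨δ₁, hδ₁, hQ₁⟩ := hS.unifQ e he0
  obtain ⟨δ₂, hδ₂, hQ₂⟩ := hS.unifQ b hb0
  obtain ⟨δ₃, hδ₃, hD⟩ := hS.unifC1.unif b hb0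
  refine ⟨min δ₂ δ₃, by positivity, min e δ₁, by positivity, fun Φ hcl y v => ?_⟩
  have hV := hS.le_splitNorm y v
  have hmain : ‖fderiv ℝ F y (Q y v)‖ + 3 * L * ‖R y v‖ - 1 / (2 * L) * splitNorm R Q L y v ≤
      splitNorm R Q L (Φ y) (fderiv ℝ Φ y v) := by
    have h1 := hS.splitNorm_fderiv y v
    have h2 := hS.splitNorm_change (F y) (Φ y) (fderiv ℝ F y v)
    have h3 : ‖Q (F y) - Q (Φ y)‖ ≤ e := hQ₁ _ _ ((hcl y).1.trans (min_le_right _ _))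
    have h4 := hS.norm_le y v
    have h5 := hS.splitNorm_add_le (Φ y) (fderiv ℝ Φ y v) (fderiv ℝ F y v - fderiv ℝ Φ y v)
    rw [add_sub_cancel] at h5
    have h6 := hS.splitNorm_le (Φ y) (fderiv ℝ F y v - fderiv ℝ Φ y v)
    have h7 : ‖fderiv ℝ F y v - fderiv ℝ Φ y v‖ ≤ e * ‖v‖ :=
      (fderiv ℝ F y - fderiv ℝ Φ y).le_of_opNorm_le ((hcl y).2.trans (min_le_left _ _)) v
    have h8 : (1 + L) * ‖fderiv ℝ F y v - fderiv ℝ Φ y v‖ ≤ (1 + L) * (e * ‖v‖) := by gcongr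
    have h9 : (1 + L) * (‖Q (F y) - Q (Φ y)‖ * ‖fderiv ℝ F y v‖) ≤ (1 + L) * (e * (L * ‖v‖)) := by
      gcongr
    have h10 : (1 + L) * (e * ‖v‖) + (1 + L) * (e * (L * ‖v‖)) ≤
        1 / (2 * L) * splitNorm R Q L y v := by
      have : (1 + L) * (e * ‖v‖) + (1 + L) * (e * (L * ‖v‖)) = 1 / (4 * L) * ‖v‖ := by
        rw [he]; field_simp
      rw [this]
      have h11 : 1 / (4 * L) ≤ 1 / (2 * L) := by
        apply one_div_le_one_div_of_le <;> linarith
      gcongr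
    linarith
  set V := splitNorm R Q L y v with hVdef
  have hV' : V = ‖Q y v‖ + L * ‖R y v‖ := rfl
  constructor
  · have h1 := hS.lower y (Q y v)
    have h2 : 2 * L * (‖fderiv ℝ F y (Q y v)‖ + 3 * L * ‖R y v‖ - 1 / (2 * L) * V) ≤
      2 * L * splitNorm R Q L (Φ y) (fderiv ℝ Φ y v) := by gcongr
    have h3 : 2 * L * (1 / (2 * L) * V) = V := by field_simp
    have h4 : L * ‖R y v‖ ≤ L * L * ‖R y v‖ := by
      have := mul_le_mul_of_nonneg_right hL (mul_nonneg hL0.le (norm_nonneg (R y v)))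
      linarith
    nlinarith [norm_nonneg (R y v), norm_nonneg (Q y v)]
  · intro x hx hexp
    have hQQ : Q y (Q y v) = Q y v := by
      have := (hS.frame y).decomp (Q y v)
      rwa [(hS.frame y).coord_Q, map_zero, zero_add] at this
    set u := Q y v with hu
    have h1 := hexp u
    have hQ := hQ₂ y x (hx.trans (min_le_left _ _))
    have hDx := hD y x (hx.trans (min_le_right _ _))
    have h2 : ‖u - Q x u‖ ≤ b * ‖u‖ := by
      have := (Q y - Q x).le_of_opNorm_le hQ u
      rwa [sub_apply, hQQ] at this
    have h3 : ‖fderiv ℝ F y u - fderiv ℝ F x u‖ ≤ b * ‖u‖ :=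
      (fderiv ℝ F y - fderiv ℝ F x).le_of_opNorm_le hDx u
    have h4 : ‖fderiv ℝ F x u - fderiv ℝ F x (Q x u)‖ ≤ L * (b * ‖u‖) := by
      rw [← map_sub]
      exact (hS.norm_le _ _).trans (by gcongr)
    have h5 := norm_le_norm_add_norm_sub' u (Q x u)
    have h6 := norm_le_norm_add_norm_sub (fderiv ℝ F x u) (fderiv ℝ F x (Q x u))
    have h7 := norm_le_norm_add_norm_sub (fderiv ℝ F y u) (fderiv ℝ F x u)
    have h8 : (L + 5) * (b * ‖u‖) = ‖u‖ := by rw [hb]; field_simp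
    have h9 : 1 / (2 * L) * V ≤ V := by
      have : 1 / (2 * L) ≤ 1 := by
        rw [div_le_one (by positivity)]; linarith
      have hV0 : 0 ≤ V := (norm_nonneg v).trans hV
      nlinarith
    nlinarith

theorem fderiv_iterate_succ_apply {Φ : X → X} (hΦ : Differentiable ℝ Φ) (i : ℕ) (w v : X) :
    fderiv ℝ Φ^[i + 1] w v = fderiv ℝ Φ (Φ^[i] w) (fderiv ℝ Φ^[i] w v) := by
  rw [Function.iterate_succ', fderiv_comp w (hΦ _) (hΦ.iterate i w)]
  rfl

theorem DominatedSystem.norm_iterate_sub_le (hS : DominatedSystem F J R Q L) (i : ℕ) (x y : X) :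
    ‖F^[i] x - F^[i] y‖ ≤ L ^ i * ‖x - y‖ := by
  induction i with
  | zero => simp
  | succ i ih =>
    rw [Function.iterate_succ_apply', Function.iterate_succ_apply', pow_succ']
    refine (hS.norm_sub_le _ _).trans ?_
    rw [mul_assoc]
    gcongr
    linarith [hS.one_le]

/-- Along an orbit shadowing a center expanding one for a long time, the derivative expands. -/
theorem DominatedSystem.exists_expand_of_shadows (hS : DominatedSystem F J R Q L) (m₀ : ℕ)
    (B : ℝ) :
    ∃ T : ℕ, 1 ≤ T ∧ ∃ η > (0 : ℝ), ∃ ε > (0 : ℝ), ∀ Φ : X → X, ContDiff ℝ 1 Φ → C1Close F Φ ε →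
      ∀ w, ShadowsExpanding F Φ Q m₀ T η B w → ∀ v, 2 * ‖v‖ ≤ ‖fderiv ℝ Φ^[T] w v‖ := by
  have hL := hS.one_le
  have hL0 : 0 < L := by linarith
  obtain ⟨δ, hδ, ε₁, hε₁, hstep⟩ := hS.exists_splitNorm_step
  -- The shadowing distance at time `i` is at most `B * 2 ^ i / 2 ^ T`, so only in the last `l`
  -- steps can it exceed `δ / 3`.
  obtain ⟨l, hl⟩ := pow_unbounded_of_one_lt (B / (δ / 3)) (by norm_num : (1 : ℝ) < 2)
  have hl' : B ≤ δ / 3 * 2 ^ l := by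
    rw [div_lt_iff₀ (by positivity)] at hl
    linarith
  -- The `s` gains must outweigh `m₀` losses before expansion begins, `l` losses at the end, and the
  -- comparison `1 + L` of norms, with a factor 2 to spare.
  obtain ⟨s, hs⟩ := pow_unbounded_of_one_lt (2 * (2 * L) ^ (m₀ + l) * (1 + L))
    (by norm_num : (1 : ℝ) < 2)
  have hs1 : 1 ≤ s := by
    rcases s with _ | s
    · exfalso
      have h1 : (1 : ℝ) ≤ (2 * L) ^ (m₀ + l) := one_le_pow₀ (by linarith)
      rw [pow_zero] at hs
      nlinarith
    · omega
  set T := m₀ + s + l with hT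
  have hi : ∀ i : ℕ, ∃ ε > (0 : ℝ), ∀ G : X → X, ContDiff ℝ 1 G → C1Close F G ε →
      C1Close F^[i] G^[i] (δ / 3) := fun i => hS.unifC1.exists_c1Close_iterate i (by positivity)
  choose e he0 he using hi
  obtain ⟨ε₂, hε₂, hε₂'⟩ : ∃ ε₂ > (0 : ℝ), ∀ i ≤ T, ε₂ ≤ e i := by
    refine ⟨(Finset.range (T + 1)).inf' ⟨0, by simp⟩ e, ?_, fun i hi => ?_⟩
    · exact (Finset.lt_inf'_iff _).2 fun i _ => he0 i
    · exact Finset.inf'_le _ (by simp; omega)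
  -- With this `η` the `F`-orbits of `u` and `q` stay within `δ / 3` up to time `T`.
  refine ⟨T, by omega, δ / (3 * L ^ T), by positivity, min ε₁ ε₂, by positivity,
    fun Φ hΦ hcl w hw v => ?_⟩
  obtain ⟨u, q, hq, huq, hwu⟩ := hw
  have hΦd : Differentiable ℝ Φ := hΦ.differentiable (by norm_num)
  have hst := hstep Φ (hcl.mono (min_le_left _ _))
  set V : ℕ → ℝ := fun i => splitNorm R Q L (Φ^[i] w) (fderiv ℝ Φ^[i] w v) with hV
  have hbad : ∀ i, V i ≤ 2 * L * V (i + 1) := fun i => by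
    simp only [hV, fderiv_iterate_succ_apply hΦd, Function.iterate_succ_apply']
    exact (hst _ _).1
  have hgood : ∀ i, i < s → 2 * V (m₀ + i) ≤ V (m₀ + i + 1) := fun i hi => by
    simp only [hV, fderiv_iterate_succ_apply hΦd, Function.iterate_succ_apply']
    refine (hst _ _).2 (F^[m₀ + i] q) ?_ (hq _ (by omega))
    have h1 : ‖Φ^[m₀ + i] w - Φ^[m₀ + i] u‖ ≤ δ / 3 := by
      have e1 := hwu (m₀ + i) (by omega)
      have e2 : (2 : ℝ) ^ (m₀ + i) * 2 ^ l ≤ 2 ^ T := by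
        rw [← pow_add]
        exact pow_le_pow_right₀ (by norm_num) (by omega)
      have e3 : B * 2 ^ (m₀ + i) ≤ 2 ^ T * (δ / 3) := by
        calc B * 2 ^ (m₀ + i) ≤ δ / 3 * 2 ^ l * 2 ^ (m₀ + i) := by gcongr
          _ = (2 ^ (m₀ + i) * 2 ^ l) * (δ / 3) := by ring
          _ ≤ 2 ^ T * (δ / 3) := by gcongr
      exact le_of_mul_le_mul_left (e1.trans e3) (by positivity)
    have h2 : ‖F^[m₀ + i] u - Φ^[m₀ + i] u‖ ≤ δ / 3 :=
      (he (m₀ + i) Φ hΦ (hcl.mono ((min_le_right _ _).trans (hε₂' _ (by omega)))) u).1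
    have h3 : ‖F^[m₀ + i] u - F^[m₀ + i] q‖ ≤ δ / 3 := by
      refine (hS.norm_iterate_sub_le _ _ _).trans ?_
      calc L ^ (m₀ + i) * ‖u - q‖ ≤ L ^ T * (δ / (3 * L ^ T)) := by
            gcongr
            omega
        _ = δ / 3 := by field_simp
    rw [norm_sub_rev] at h2
    have h4 := norm_sub_le_norm_sub_add_norm_sub (Φ^[m₀ + i] w) (Φ^[m₀ + i] u) (F^[m₀ + i] q)
    have h5 := norm_sub_le_norm_sub_add_norm_sub (Φ^[m₀ + i] u) (F^[m₀ + i] u) (F^[m₀ + i] q)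
    linarith
  have h1 : ∀ i, V 0 ≤ (2 * L) ^ i * V i := fun i => by
    induction i with
    | zero => simp
    | succ i ih =>
      refine ih.trans ?_
      rw [pow_succ, mul_assoc]
      have := hbad i
      gcongr
  have h2 : ∀ i ≤ s, 2 ^ i * V 0 ≤ (2 * L) ^ m₀ * V (m₀ + i) := fun i => by
    induction i with
    | zero => intro _; simpa using h1 m₀
    | succ i ih =>
      intro hi
      have e1 := ih (by omega)
      have e2 := hgood i (by omega)
      have e3 : (2 * L) ^ m₀ * (2 * V (m₀ + i)) ≤ (2 * L) ^ m₀ * V (m₀ + i + 1) := by gcongr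
      rw [pow_succ, ← add_assoc]
      linarith
  have h3 : ∀ i, 2 ^ s * V 0 ≤ (2 * L) ^ (m₀ + i) * V (m₀ + s + i) := fun i => by
    induction i with
    | zero => simpa using h2 s le_rfl
    | succ i ih =>
      refine ih.trans ?_
      rw [← add_assoc, pow_succ, mul_assoc, ← add_assoc]
      have := hbad (m₀ + s + i)
      gcongr
  have h4 := h3 l
  have h5 : ‖v‖ ≤ V 0 := by
    have := hS.le_splitNorm w v
    simpa [hV] using this
  have h6 : V T ≤ (1 + L) * ‖fderiv ℝ Φ^[T] w v‖ := hS.splitNorm_le _ _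
  rw [← hT] at h4
  have h7 : 2 ^ s * ‖v‖ ≤ (2 * L) ^ (m₀ + l) * ((1 + L) * ‖fderiv ℝ Φ^[T] w v‖) := by
    calc 2 ^ s * ‖v‖ ≤ 2 ^ s * V 0 := by gcongr
      _ ≤ _ := h4
      _ ≤ _ := by gcongr
  have h8 : 2 * (2 * L) ^ (m₀ + l) * (1 + L) * ‖v‖ ≤ 2 ^ s * ‖v‖ := by gcongr
  have h9 : 0 < (2 * L) ^ (m₀ + l) * (1 + L) := by positivity
  refine le_of_mul_le_mul_left ?_ h9
  linarith

/-- Iterates of balls contain balls of a radius that only depends on the number of iterates and the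
size of the ball. -/
theorem UnifC1.exists_ball_iterate [FiniteDimensional ℝ X] (hF : UnifC1 F) (hL0 : 0 < L)
    (hlow : ∀ x v, ‖v‖ ≤ L * ‖fderiv ℝ F x v‖) :
    ∃ ε > (0 : ℝ), ∀ (N : ℕ) (u : ℝ), 0 < u → ∃ s > (0 : ℝ), ∀ Φ : X → X, ContDiff ℝ 1 Φ →
      C1Close F Φ ε → ∀ z, closedBall (Φ^[N] z) s ⊆ Φ^[N] '' closedBall z u := by
  obtain ⟨δ, hδ, hu⟩ := hF.unif (1 / (4 * L)) (by positivity)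
  -- The perturbation and the oscillation of the derivative each take `1 / (4 * L)`, half of the
  -- lower bound `1 / L` remaining. This closeness is fixed before `N`, which will depend on the
  -- open set.
  refine ⟨1 / (4 * L), by positivity, fun N u hu0 => ?_⟩
  induction N with
  | zero => exact ⟨u, hu0, fun _ _ _ z => by simp⟩
  | succ N ih =>
    obtain ⟨s, hs, h⟩ := ih
    refine ⟨1 / (2 * L) * min s δ, by positivity, fun Φ hΦ hcl z => ?_⟩
    rw [Function.iterate_succ', image_comp]
    refine Subset.trans ?_
      (image_mono ((closedBall_subset_closedBall (min_le_left s δ)).trans (h Φ hΦ hcl z)))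
    have h1 := closedBall_subset_image_of_fderiv (hΦ.differentiable (by norm_num))
      (A := fderiv ℝ F (Φ^[N] z)) (α := 1 / L) (by positivity) (b := Φ^[N] z) (s := min s δ)
      (c := 1 / (2 * L)) (fun v => by
        have := hlow (Φ^[N] z) v
        rw [div_mul_eq_mul_div, one_mul, div_le_iff₀ hL0]
        linarith) (by positivity) (by positivity) (fun x hx => by
        have e1 := hu x (Φ^[N] z) (by
          have : ‖x - Φ^[N] z‖ ≤ min s δ := by simpa [dist_eq_norm] using hx
          exact this.trans (min_le_right _ _))
        have e2 := (hcl x).2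
        rw [norm_sub_rev] at e2
        have e3 := norm_sub_le_norm_sub_add_norm_sub (fderiv ℝ Φ x) (fderiv ℝ F x)
          (fderiv ℝ F (Φ^[N] z))
        have e4 : 1 / (4 * L) + 1 / (4 * L) = 1 / (2 * L) := by field_simp; norm_num
        linarith)
    have e5 : 1 / L - 1 / (2 * L) = 1 / (2 * L) := by field_simp; norm_num
    rwa [e5] at h1

/-- Some iterate of every nonempty open set contains a ball of a fixed radius, for all maps close
to `F`. -/
theorem DominatedSystem.exists_ball_subset_iterate [FiniteDimensional ℝ X] [FiniteDimensional ℝ W]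
    (hS : DominatedSystem F J R Q L)
    (hC1 : ∀ x, ∀ v ∈ C x, fderiv ℝ F x v ∈ C (F x)) {a₀ ρ₁ : ℝ} (hρ₁ : 0 < ρ₁)
    (hC2 : ∀ p, ∃ ℓ : W →L[ℝ] X, (∀ h, R p (ℓ h) = h) ∧ (∀ h, ‖Q p (ℓ h)‖ ≤ a₀ * ‖h‖) ∧
      ∀ y, ‖y - p‖ ≤ ρ₁ → ∀ h, ℓ h ∈ C y)
    (hC3 : ∀ a ρ, 0 < ρ → ∃ m₀, HasExpandingPoints F R Q C a ρ m₀) :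
    ∃ ε > (0 : ℝ), ∃ r > (0 : ℝ), ∀ Φ : X → X, ContDiff ℝ 1 Φ → C1Close F Φ ε →
      ∀ U : Set X, IsOpen U → U.Nonempty → ∃ k w, closedBall w r ⊆ Φ^[k] '' U := by
  have hL := hS.one_le
  set a := max a₀ (L + 1) with ha_def
  have haL : L + 1 ≤ a := le_max_right _ _
  have ha : 0 < a := by linarith
  obtain ⟨c, ρ, ε₀, hρρ₁, hG⟩ := hS.exists_graphScale haL (ρ₀ := ρ₁ / (1 + a)) (by positivity)
  have hρ := hG.ρ_pos
  have hC2' : ∀ p, ∃ ℓ : W →L[ℝ] X, (∀ h, R p (ℓ h) = h) ∧ (∀ h, ‖Q p (ℓ h)‖ ≤ a * ‖h‖) ∧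
      ∀ y, ‖y - p‖ ≤ (1 + a) * ρ → ∀ h, ℓ h ∈ C y := fun p => by
    obtain ⟨ℓ, h1, h2, h3⟩ := hC2 p
    refine ⟨ℓ, h1, fun h => (h2 h).trans (by gcongr; exact le_max_left _ _), fun y hy => h3 y ?_⟩
    rw [le_div_iff₀ (by positivity)] at hρρ₁
    linarith
  obtain ⟨m₀, hm₀⟩ := hC3 a ρ hρ
  obtain ⟨T, hT, η, hη, ε₁, hε₁, hexp⟩ :=
    hS.exists_expand_of_shadows m₀ (2 * (1 + a) * ρ)
  obtain ⟨M, hM⟩ := exists_pow_lt_of_lt_one (show 0 < η / 2 / (2 * a * ρ) by positivity)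
    (by norm_num : (2 / 3 : ℝ) < 1)
  set K := (8 * (1 + a) ^ 2) ^ M with hK
  have hK0 : 0 < K := by positivity
  obtain ⟨ε₂, hε₂, hball⟩ := hS.unifC1.exists_ball_iterate (by linarith) hS.lower
  obtain ⟨δ, hδ, hu⟩ := (hS.unifC1.iterate T).unif (1 / 4) (by norm_num)
  obtain ⟨ε₃, hε₃, hT3⟩ := hS.unifC1.exists_c1Close_iterate T (η := 1 / 8) (by norm_num)
  -- The discs separate by `ε * K`, with `K` exponential in `M`. Since `M` is already fixed by `F`
  -- and `η`, `ε` can absorb it.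
  set ε := min (min (min ε₀ ε₁) (min ε₂ ε₃)) (min (η / 2 / K) (ρ / (L * K + 1))) with hεdef
  have hε : 0 < ε := by
    have := hG.ε_pos
    positivity
  have le₀ : ε ≤ ε₀ := (min_le_left _ _).trans ((min_le_left _ _).trans (min_le_left _ _))
  have le₁ : ε ≤ ε₁ := (min_le_left _ _).trans ((min_le_left _ _).trans (min_le_right _ _))
  have le₂ : ε ≤ ε₂ := (min_le_left _ _).trans ((min_le_right _ _).trans (min_le_left _ _))
  have le₃ : ε ≤ ε₃ := (min_le_left _ _).trans ((min_le_right _ _).trans (min_le_right _ _))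
  have le₄ : ε * K ≤ η / 2 := by
    rw [← le_div_iff₀ hK0]; exact (min_le_right _ _).trans (min_le_left _ _)
  have le₅ : L * (ε * K) + ε ≤ ρ := by
    have : ε ≤ ρ / (L * K + 1) := (min_le_right _ _).trans (min_le_right _ _)
    rw [le_div_iff₀ (by positivity)] at this
    linarith
  have hη' : (2 / 3) ^ M * (2 * a) * ρ + ε * K ≤ η := by
    rw [lt_div_iff₀ (by positivity)] at hM
    linarith
  refine ⟨ε, hε, δ, hδ, fun Φ hΦ hcl U hU hUne => ?_⟩
  obtain ⟨p, hp⟩ := hUne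
  obtain ⟨u, hu0, hpU⟩ := Metric.isOpen_iff.1 hU p hp
  set r₀ := min ρ (u / 4) with hr₀
  have hr0 : 0 < r₀ := by positivity
  have hφ := graphDisc_affine (R := R) (Q := Q) (a := a) (p := p) (ℓ := J p)
    (hS.frame p).coord_J (fun h => by
      have := (hS.frame p).decomp (J p h)
      rw [(hS.frame p).coord_J, add_eq_left] at this
      rw [this, norm_zero]; positivity) r₀
  set φ : W → X := fun h => p + J p h with hφdef
  obtain ⟨k, hk⟩ := pow_unbounded_of_one_lt (4 * ρ / r₀) (by norm_num : (1 : ℝ) < 2)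
  rw [div_lt_iff₀ hr0] at hk
  have hkM : (2 : ℝ) ^ k ≤ 2 ^ (k + 1 + M) := pow_le_pow_right₀ (by norm_num) (by omega)
  set N := k + 1 + M with hN
  obtain ⟨s, hs, hballN⟩ := hball N (u / 4) (by positivity)
  -- The radius `s` depends on the open set, so the number `m` of blocks needed to reach the fixed
  -- radius `δ` does too.
  obtain ⟨m, hm⟩ := pow_unbounded_of_one_lt (δ / s) (by norm_num : (1 : ℝ) < 3 / 2)
  rw [div_lt_iff₀ hs] at hm
  obtain ⟨t, ht1, -, ht2⟩ := hG.exists_shadowsExpanding hS hC1 hC2' hm₀ hΦ le₀ hε.le hcl le₅ hη' hφ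
    (min_le_left _ _) hr0 (by simp [hφdef, hρ.le]) hT m 0 k (by linarith) (by
      rw [norm_zero, sub_zero]
      have : 2 ^ k * r₀ ≤ 2 ^ N * r₀ := by gcongr
      linarith)
  set z := φ t with hz
  have hzp : ‖z - p‖ ≤ u / 4 := by
    have e1 : z - p = J p t := by simp [hz, hφdef]
    rw [e1, (hS.frame p).norm_J]
    rw [sub_zero] at ht1
    have e2 : 2 ^ N * r₀ ≥ 2 ^ k * r₀ := by gcongr
    have e3 : 2 ^ N * ‖t‖ ≤ 2 ^ N * r₀ := by linarith
    exact (le_of_mul_le_mul_left e3 (by positivity)).trans (min_le_right _ _)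
  have hzU : closedBall z (u / 4) ⊆ U := by
    refine Subset.trans (closedBall_subset_ball' ?_) hpU
    rw [dist_eq_norm]; linarith
  have hΦT : ContDiff ℝ 1 Φ^[T] := contDiff_one_iterate hΦ T
  -- The derivative of `Φ^[T]` varies by at most `1 / 8 + 1 / 4 + 1 / 8` on the ball, so expansion 2
  -- at the center leaves `3 / 2`.
  have hblow : ∀ w, ShadowsExpanding F Φ Q m₀ T η (2 * (1 + a) * ρ) w → ∀ s, 0 ≤ s → s ≤ δ →
      closedBall (Φ^[T] w) (3 / 2 * s) ⊆ Φ^[T] '' closedBall w s := by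
    intro w hw s hs hsδ
    have := closedBall_subset_image_of_fderiv (hΦT.differentiable (by norm_num))
      (A := fderiv ℝ Φ^[T] w) two_pos (hexp Φ hΦ (hcl.mono le₁) w hw) (b := w) hs
      (c := 1 / 2) (by norm_num) (fun x hx => by
        have e1 := hu x w (by
          have : ‖x - w‖ ≤ s := by simpa [dist_eq_norm] using hx
          exact this.trans hsδ)
        have e2 := (hT3 Φ hΦ (hcl.mono le₃) x).2
        have e3 := (hT3 Φ hΦ (hcl.mono le₃) w).2
        rw [norm_sub_rev] at e2
        have e4 := norm_sub_le_norm_sub_add_norm_sub (fderiv ℝ Φ^[T] x) (fderiv ℝ F^[T] x)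
          (fderiv ℝ Φ^[T] w)
        have e5 := norm_sub_le_norm_sub_add_norm_sub (fderiv ℝ F^[T] x) (fderiv ℝ F^[T] w)
          (fderiv ℝ Φ^[T] w)
        linarith)
    norm_num at this ⊢
    exact this
  have hiter : ∀ j ≤ m, closedBall (Φ^[N + j * T] z) (min δ ((3 / 2) ^ j * s)) ⊆
      Φ^[N + j * T] '' U := by
    intro j
    induction j with
    | zero =>
      intro _
      simp only [zero_mul, add_zero, pow_zero, one_mul]
      exact (closedBall_subset_closedBall (min_le_right _ _)).trans
        ((hballN Φ hΦ (hcl.mono le₂) z).trans (image_mono hzU))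
    | succ j ih =>
      intro hj
      have e1 := ih (by omega)
      have e2 := hblow _ (ht2 j (by omega)) (min δ ((3 / 2) ^ j * s)) (by positivity)
        (min_le_left _ _)
      have e3 : ∀ x, Φ^[N + (j + 1) * T] x = Φ^[T] (Φ^[N + j * T] x) := fun x => by
        rw [← Function.iterate_add_apply]
        congr 1
        rw [show N + (j + 1) * T = T + (N + j * T) by ring]
      have e4 : Φ^[N + (j + 1) * T] = Φ^[T] ∘ Φ^[N + j * T] := funext e3
      rw [e3, e4, image_comp]
      refine Subset.trans ?_ (e2.trans (image_mono e1))
      refine closedBall_subset_closedBall ?_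
      rw [mul_min_of_nonneg _ _ (by norm_num : (0:ℝ) ≤ 3 / 2)]
      refine min_le_min (by linarith) (le_of_eq (by ring))
  refine ⟨N + m * T, Φ^[N + m * T] z, ?_⟩
  have := hiter m le_rfl
  rwa [min_eq_left hm.le] at this

end BlowUpConclusion

/-! ### The covering of the torus and lifts of maps -/

section TorusLifts

variable {n : ℕ}

theorem toTorus_add (v w : Euc n) : toTorus (v + w) = toTorus v + toTorus w := by
  funext i; simp [toTorus]

theorem toTorus_sub (v w : Euc n) : toTorus (v - w) = toTorus v - toTorus w := by
  funext i; simp [toTorus]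

theorem toTorus_zero : toTorus (0 : Euc n) = 0 := by
  funext i; simp [toTorus]

/-- The covering `toTorus` as a homomorphism. -/
def toTorusHom (n : ℕ) : Euc n →+ Torus n where
  toFun := toTorus
  map_zero' := toTorus_zero
  map_add' := toTorus_add

theorem isOpenQuotientMap_toTorus : IsOpenQuotientMap (toTorus : Euc n → Torus n) := by
  have h : IsOpenQuotientMap (Pi.map fun (_ : Fin n) (x : ℝ) => (x : UnitAddCircle)) :=
    IsOpenQuotientMap.piMap fun _ => QuotientAddGroup.isOpenQuotientMap_mk
  exact h.comp (EuclideanSpace.equiv (Fin n) ℝ).toHomeomorph.isOpenQuotientMap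

theorem continuous_toTorus : Continuous (toTorus : Euc n → Torus n) :=
  isOpenQuotientMap_toTorus.continuous

theorem eq_zero_of_toTorus_eq_zero {v : Euc n} (h : ‖v‖ < 1 / 2) (hv : toTorus v = 0) : v = 0 := by
  rw [← torusLog_toTorus v h, hv, ← toTorus_zero, torusLog_toTorus 0 (by simp)]

theorem isCoveringMap_toTorus : IsCoveringMap (toTorus : Euc n → Torus n) := by
  have hq : Topology.IsQuotientMap (toTorusHom n) := isOpenQuotientMap_toTorus.isQuotientMap
  refine (hq.isAddQuotientCoveringMap_of_isDiscrete_ker_addMonoidHom ?_).isCoveringMap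
  rw [isDiscrete_iff_forall_mem_exists_isOpen]
  intro x hx
  refine ⟨ball x (1 / 2), isOpen_ball, ?_⟩
  ext y
  simp only [mem_inter_iff, mem_ball, mem_singleton_iff]
  constructor
  · rintro ⟨hy1, hy2⟩
    have hxy : toTorus (y - x) = 0 := by
      have h1 : toTorus y = 0 := hy2
      have h2 : toTorus x = 0 := hx
      rw [toTorus_sub, h1, h2, sub_zero]
    have hd : ‖y - x‖ < 1 / 2 := by
      rw [← dist_eq_norm]; exact hy1
    exact sub_eq_zero.1 (eq_zero_of_toTorus_eq_zero hd hxy)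
  · rintro rfl
    refine ⟨?_, ?_⟩ <;> first | exact hx | simp

theorem norm_toTorus_le (v : Euc n) : ‖toTorus v‖ ≤ ‖v‖ := by
  refine (pi_norm_le_iff_of_nonneg (norm_nonneg v)).2 fun i => ?_
  refine le_trans ?_ (PiLp.norm_apply_le v i)
  show ‖((v i : ℝ) : UnitAddCircle)‖ ≤ ‖v i‖
  rw [UnitAddCircle.norm_eq, Real.norm_eq_abs]
  simpa using round_le (v i) 0

theorem exists_lift_norm_le (x : Torus n) :
    ∃ v : Euc n, toTorus v = x ∧ ‖v‖ ≤ √n * ‖x‖ := by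
  obtain ⟨a, rfl⟩ := isOpenQuotientMap_toTorus.surjective x
  refine ⟨WithLp.toLp 2 fun i => a i - round (a i), ?_, ?_⟩
  · funext i
    show ((a i - (round (a i) : ℝ) : ℝ) : UnitAddCircle) = ((a i : ℝ) : UnitAddCircle)
    rw [AddCircle.coe_sub, sub_eq_self, AddCircle.coe_eq_zero_iff]
    exact ⟨round (a i), by simp⟩
  · rw [EuclideanSpace.norm_eq]
    have h : ∀ i, ‖a i - round (a i)‖ ≤ ‖toTorus a‖ := fun i => by
      have h1 := norm_le_pi_norm (toTorus a) i
      rw [Real.norm_eq_abs, ← UnitAddCircle.norm_eq]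
      exact h1
    calc √(∑ i, ‖a i - round (a i)‖ ^ 2) ≤ √(∑ _i : Fin n, ‖toTorus a‖ ^ 2) := by
          gcongr with i _; exact h i
      _ = √n * ‖toTorus a‖ := by
          rw [Finset.sum_const, Finset.card_univ, Fintype.card_fin, nsmul_eq_mul,
            Real.sqrt_mul (by positivity), Real.sqrt_sq (norm_nonneg _)]

theorem exists_lift_norm_le_sqrt (x : Torus n) : ∃ v : Euc n, toTorus v = x ∧ ‖v‖ ≤ √n := by
  obtain ⟨v, hv, h⟩ := exists_lift_norm_le x
  refine ⟨v, hv, h.trans (mul_le_of_le_one_right (by positivity) ?_)⟩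
  refine (pi_norm_le_iff_of_nonneg zero_le_one).2 fun i => ?_
  have := AddCircle.norm_le_half_period (1 : ℝ) one_ne_zero (x := x i)
  norm_num at this ⊢
  linarith

/-- A continuous function on the torus lifts to a uniformly continuous one. -/
theorem exists_unif_of_continuous {Y : Type*} [SeminormedAddCommGroup Y] {b : Torus n → Y}
    (hb : Continuous b) {c : ℝ} (hc : 0 < c) :
    ∃ ρ > (0 : ℝ), ∀ x y : Euc n, ‖x - y‖ ≤ ρ → ‖b (toTorus x) - b (toTorus y)‖ ≤ c := by
  obtain ⟨δ, hδ, h⟩ := Metric.uniformContinuous_iff.1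
    (CompactSpace.uniformContinuous_of_continuous hb) c hc
  refine ⟨δ / 2, by positivity, fun x y hxy => ?_⟩
  have h1 := norm_toTorus_le (x - y)
  rw [toTorus_sub, ← dist_eq_norm] at h1
  have := h (a := toTorus x) (b := toTorus y) (by linarith)
  rw [dist_eq_norm] at this
  exact this.le

theorem exists_bound_of_continuous {Y : Type*} [SeminormedAddCommGroup Y] {b : Torus n → Y}
    (hb : Continuous b) : ∃ L : ℝ, 1 ≤ L ∧ ∀ x, ‖b x‖ ≤ L := by
  obtain ⟨L, hL⟩ := isCompact_univ.exists_bound_of_continuousOn hb.continuousOn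
  exact ⟨max L 1, le_max_right _ _, fun x => (hL x (mem_univ x)).trans (le_max_left _ _)⟩

variable {F G : Euc n → Euc n} {f g : Torus n → Torus n}

theorem IsC1Lift.continuous_torusDeriv (h : IsC1Lift F f) : Continuous (torusDeriv f) := by
  rw [isOpenQuotientMap_toTorus.isQuotientMap.continuous_iff]
  have : torusDeriv f ∘ toTorus = fderiv ℝ F := funext fun v => h.torusDeriv_eq v
  rw [this]
  exact h.1.continuous_fderiv (by norm_num)

theorem IsC1Lift.unifC1 (h : IsC1Lift F f) : UnifC1 F := by
  refine ⟨h.1, ?_, fun c hc => ?_⟩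
  · obtain ⟨L, -, hL⟩ := exists_bound_of_continuous h.continuous_torusDeriv
    exact ⟨L, fun x => by rw [← h.torusDeriv_eq]; exact hL _⟩
  · obtain ⟨ρ, hρ, hu⟩ := exists_unif_of_continuous h.continuous_torusDeriv hc
    exact ⟨ρ, hρ, fun x y hxy => by
      rw [← h.torusDeriv_eq, ← h.torusDeriv_eq]; exact hu x y hxy⟩

theorem IsC1Lift.iterate (h : IsC1Lift F f) (N : ℕ) : IsC1Lift F^[N] f^[N] := by
  refine ⟨contDiff_one_iterate h.1 N, fun v => ?_⟩
  induction N with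
  | zero => rfl
  | succ N ih => rw [Function.iterate_succ_apply', Function.iterate_succ_apply', h.2, ih]

/-- A map `C¹`-close to `f` has a lift `C¹`-close to a given lift of `f`. -/
theorem IsC1Lift.exists_lift_c1Close (h : IsC1Lift F f) {η : ℝ} (hη : 0 < η) :
    ∃ ε > (0 : ℝ), ∀ g : Torus n → Torus n, IsC1 g →
      (∀ x, dist (f x) (g x) < ε ∧ ‖torusDeriv f x - torusDeriv g x‖ < ε) →
      ∃ G, IsC1Lift G g ∧ C1Close F G η := by
  set K : ℝ := √n + 1 with hK
  have hK0 : 0 < K := by positivity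
  have hK1 : √n ≤ K := by linarith
  refine ⟨min η (min η (1 / 8) / K), by positivity, fun g ⟨G₀, hG₀⟩ hfg => ?_⟩
  have hex : ∀ v, ∃ w : Euc n, toTorus w = toTorus (F v - G₀ v) ∧ ‖w‖ ≤ min η (1 / 8) := by
    intro v
    obtain ⟨w, hw, hw'⟩ := exists_lift_norm_le (toTorus (F v - G₀ v))
    refine ⟨w, hw, hw'.trans ?_⟩
    rw [toTorus_sub, h.2, hG₀.2, ← dist_eq_norm]
    have h1 := (hfg (toTorus v)).1.le.trans (min_le_right _ _)
    rw [le_div_iff₀ hK0] at h1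
    calc √n * dist (f (toTorus v)) (g (toTorus v))
        ≤ K * dist (f (toTorus v)) (g (toTorus v)) := by gcongr
      _ ≤ _ := by linarith
  choose w hw hw' using hex
  set k : Euc n → Euc n := fun v => F v - G₀ v - w v with hk
  have hk0 : ∀ v, toTorus (k v) = 0 := fun v => by
    rw [hk, toTorus_sub, hw, sub_self]
  have hcont : Continuous fun v => F v - G₀ v := h.1.continuous.sub hG₀.1.continuous
  -- `k` takes values in the kernel of the covering, whose distinct elements are at least `1 / 2`
  -- apart, and it varies locally by less than `1 / 4 + 1 / 8 + 1 / 8`. The constant value corrects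
  -- `G₀` to the lift close to `F`.
  have hloc : IsLocallyConstant k := by
    rw [IsLocallyConstant.iff_eventually_eq]
    intro x
    filter_upwards [Metric.continuousAt_iff'.1 hcont.continuousAt (1 / 4) (by norm_num)] with y hy
    have h1 : toTorus (k y - k x) = 0 := by rw [toTorus_sub, hk0, hk0, sub_zero]
    refine sub_eq_zero.1 (eq_zero_of_toTorus_eq_zero ?_ h1)
    have e : k y - k x = ((F y - G₀ y) - (F x - G₀ x)) - (w y - w x) := by
      simp only [hk]; abel
    rw [e]
    rw [dist_eq_norm] at hy
    have h2 := _root_.norm_sub_le ((F y - G₀ y) - (F x - G₀ x)) (w y - w x)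
    have h3 := _root_.norm_sub_le (w y) (w x)
    have h4 := (hw' y).trans (min_le_right _ _)
    have h5 := (hw' x).trans (min_le_right _ _)
    linarith
  have hconst : ∀ v, k v = k 0 := fun v => hloc.apply_eq_of_preconnectedSpace v 0
  refine ⟨fun v => G₀ v + k 0, ⟨hG₀.1.add contDiff_const, fun v => ?_⟩, fun v => ⟨?_, ?_⟩⟩
  · rw [toTorus_add, hk0, add_zero, hG₀.2]
  · have e : F v - (G₀ v + k 0) = w v := by
      rw [← hconst v]; simp only [hk]; abel
    rw [e]
    exact (hw' v).trans (min_le_left _ _)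
  · rw [fderiv_add_const, ← h.torusDeriv_eq, ← hG₀.torusDeriv_eq]
    exact (hfg _).2.le.trans (min_le_left _ _)

theorem IsC1Lift.isLocalHomeomorph (h : IsC1Lift F f)
    (hf : ∀ x, Function.Bijective (torusDeriv f x)) : IsLocalHomeomorph f := by
  have hF : IsLocalHomeomorph F := by
    refine IsLocalHomeomorph.mk F fun x => ?_
    have hx := hf (toTorus x)
    rw [h.torusDeriv_eq] at hx
    set e := (LinearEquiv.ofBijective (fderiv ℝ F x).toLinearMap hx).toContinuousLinearEquiv
      with he
    have hd : HasFDerivAt F (e : Euc n →L[ℝ] Euc n) x := by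
      have : (e : Euc n →L[ℝ] Euc n) = fderiv ℝ F x := by ext v; rfl
      rw [this]
      exact (h.1.differentiable (by norm_num) x).hasFDerivAt
    exact ⟨(h.1.contDiffAt (x := x)).toOpenPartialHomeomorph F hd (by norm_num),
      (h.1.contDiffAt (x := x)).mem_toOpenPartialHomeomorph_source hd (by norm_num), fun _ _ => rfl⟩
  have h1 : IsLocalHomeomorph (f ∘ toTorus) := by
    have : f ∘ toTorus = toTorus ∘ F := funext fun v => (h.2 v).symm
    rw [this]
    exact isCoveringMap_toTorus.isLocalHomeomorph.comp hF
  have h2 := h1.isLocalHomeomorphOn (s := univ) |>.of_comp_right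
    (isCoveringMap_toTorus.isLocalHomeomorph.isLocalHomeomorphOn)
  rw [image_univ, isOpenQuotientMap_toTorus.surjective.range_eq] at h2
  exact isLocalHomeomorph_iff_isLocalHomeomorphOn_univ.2 h2

/-- The lift of a local diffeomorphism of the torus is injective. -/
theorem IsC1Lift.injective (h : IsC1Lift F f)
    (hf : ∀ x, Function.Bijective (torusDeriv f x)) : Function.Injective F := by
  -- On the compact torus the local homeomorphism `f` is a covering. Lifting `toTorus` first through
  -- `f` and then through `toTorus` itself gives a left inverse of `F`, by uniqueness of lifts.
  have hcov : IsCoveringMap f := isLocalHomeomorph_iff_isCoveringMap.1 (h.isLocalHomeomorph hf)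
  have hp : IsCoveringMap (toTorus : Euc n → Torus n) := isCoveringMap_toTorus
  have hF := h.1.continuous
  obtain ⟨τ, ⟨hτ0, hτ⟩, -⟩ := hcov.existsUnique_continuousMap_lifts
    ⟨toTorus, continuous_toTorus⟩ (F 0) (toTorus 0) (h.2 0).symm
  obtain ⟨s, ⟨hs0, hs⟩, -⟩ := hp.existsUnique_continuousMap_lifts τ (F 0) 0 hτ0.symm
  have h1 : τ ∘ F = toTorus := by
    refine hcov.eq_of_comp_eq (τ.continuous.comp hF) continuous_toTorus ?_ 0 hτ0
    rw [← Function.comp_assoc, hτ]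
    exact funext fun v => h.2 v
  have h2 : s ∘ F = id := by
    refine hp.eq_of_comp_eq (s.continuous.comp hF) continuous_id ?_ 0 hs0
    rw [← Function.comp_assoc, hs, h1]
    rfl
  exact Function.LeftInverse.injective (g := s) fun x => congrFun h2 x

end TorusLifts

/-! ### Frames, cones and quadratic forms -/

section ConesAndBundles

variable {n d : ℕ}

/-- A positive continuous function on a closed set of pairs `(x, v)`, `‖v‖ = 1`, is bounded away
from zero. -/
theorem exists_pos_le_of_isClosed {S : Set (Torus n × Euc n)} (hS : IsClosed S)
    {φ : Torus n × Euc n → ℝ} (hφ : Continuous φ) (hpos : ∀ z ∈ S, ‖z.2‖ = 1 → 0 < φ z) :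
    ∃ c > (0 : ℝ), ∀ z ∈ S, ‖z.2‖ = 1 → c ≤ φ z := by
  set T : Set (Torus n × Euc n) := S ∩ (univ ×ˢ sphere (0 : Euc n) 1) with hT
  have hc : IsCompact T := (isCompact_univ.prod (isCompact_sphere _ _)).inter_left hS
  have hmem : ∀ z ∈ S, ‖z.2‖ = 1 → z ∈ T := fun z hz h => ⟨hz, mem_univ _, by simpa using h⟩
  rcases T.eq_empty_or_nonempty with hE | hE
  · exact ⟨1, one_pos, fun z hz h => by simpa [hE] using hmem z hz h⟩
  · obtain ⟨z₀, hz₀, hmin⟩ := hc.exists_isMinOn hE hφ.continuousOn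
    exact ⟨φ z₀, hpos z₀ hz₀.1 (by simpa using hz₀.2.2), fun z hz h => hmin (hmem z hz h)⟩

theorem exists_frame (E : Submodule ℝ (Euc n)) {m : ℕ} (hE : Module.finrank ℝ E + m = n) :
    ∃ (J : Euc m →L[ℝ] Euc n) (R : Euc n →L[ℝ] Euc m), Frame J R E.starProjection := by
  have hm : Module.finrank ℝ Eᗮ = m := by
    have := E.finrank_add_finrank_orthogonal
    rw [finrank_euclideanSpace_fin] at this
    omega
  set B := (stdOrthonormalBasis ℝ Eᗮ).reindex (finCongr hm) with hB
  refine ⟨Eᗮ.subtypeL ∘L (B.repr.symm.toContinuousLinearEquiv : Euc m →L[ℝ] Eᗮ),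
    (B.repr.toContinuousLinearEquiv : Eᗮ →L[ℝ] Euc m) ∘L Eᗮ.orthogonalProjectionOnto, ?_, ?_, ?_, ?_, ?_⟩
  · intro h
    simp
  · intro v
    simp [add_comm]
  · intro h
    exact B.repr.symm.norm_map h
  · intro v
    simpa using Eᗮ.norm_orthogonalProjectionOnto_apply_le v
  · intro v
    exact E.norm_starProjection_apply_le v

variable {f : Torus n → Torus n} {F : Euc n → Euc n} {E : Torus n → Submodule ℝ (Euc n)}
  {C : Torus n → Set (Euc n)}

theorem IsC1Lift.exists_lower_bound (h : IsC1Lift F f)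
    (hf : ∀ x, Function.Bijective (torusDeriv f x)) :
    ∃ L : ℝ, 1 ≤ L ∧ ∀ x v, ‖v‖ ≤ L * ‖fderiv ℝ F x v‖ := by
  have hcont : Continuous fun z : Torus n × Euc n => ‖torusDeriv f z.1 z.2‖ :=
    ((h.continuous_torusDeriv.comp continuous_fst).clm_apply continuous_snd).norm
  obtain ⟨c, hc, hle⟩ := exists_pos_le_of_isClosed isClosed_univ hcont fun z _ hz => by
    rw [norm_pos_iff]
    intro h0
    have : z.2 = 0 := (hf z.1).1 (by rw [h0, map_zero])
    rw [this, norm_zero] at hz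
    exact zero_ne_one hz
  refine ⟨max 1 c⁻¹, le_max_left _ _, fun x v => ?_⟩
  have key : c * ‖v‖ ≤ ‖fderiv ℝ F x v‖ := by
    rcases eq_or_ne v 0 with rfl | hv
    · simp
    · have hv' : 0 < ‖v‖ := norm_pos_iff.2 hv
      have := hle (toTorus x, ‖v‖⁻¹ • v) (mem_univ _) (by
        rw [norm_smul, norm_inv, norm_norm, inv_mul_cancel₀ hv'.ne'])
      simp only [map_smul, norm_smul, norm_inv, norm_norm] at this
      rw [h.torusDeriv_eq, inv_mul_eq_div, le_div_iff₀ hv'] at this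
      exact this
  calc ‖v‖ = c⁻¹ * (c * ‖v‖) := by field_simp
    _ ≤ max 1 c⁻¹ * ‖fderiv ℝ F x v‖ := by gcongr; exact le_max_right _ _

/-- A dense pre-orbit of `x` cannot be `{x}`, so it contains a point reaching `x` in at least one
step. Surjectivity makes the conditions on cones, which are stated at image points and along inverse
paths, available everywhere. -/
theorem surjective_of_dense_preOrbit (hn : 0 < n) (hdense : ∀ x, Dense (preOrbit f x)) :
    Function.Surjective f := by
  intro x
  have hne : ({x}ᶜ : Set (Torus n)).Nonempty := by
    set v : Euc n := EuclideanSpace.single ⟨0, hn⟩ (1 / 4) with hv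
    have hv1 : ‖v‖ = 1 / 4 := by rw [hv, PiLp.norm_single]; norm_num
    refine ⟨x + toTorus v, fun h => ?_⟩
    have := eq_zero_of_toTorus_eq_zero (by rw [hv1]; norm_num) (add_eq_left.1 h)
    rw [this, norm_zero] at hv1
    norm_num at hv1
  obtain ⟨w, hw1, k, hk⟩ := (hdense x).inter_open_nonempty _ isOpen_compl_singleton hne
  rcases k with _ | k
  · exact absurd hk hw1
  · exact ⟨f^[k] w, by rw [← Function.iterate_succ_apply' f]; exact hk⟩

/-- The center bundle meets the unstable cones only at the origin. -/
theorem IsPartiallyHyperbolic.eq_zero_of_mem (h : IsPartiallyHyperbolic f d E C)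
    (hs : Function.Surjective f) {y : Torus n} {v : Euc n} (hE : v ∈ E y) (hC : v ∈ C y) :
    v = 0 := by
  obtain ⟨x, rfl⟩ := hs y
  rw [← h.center.invariant x] at hE
  obtain ⟨w, hw, rfl⟩ := hE
  by_contra hne
  have hw0 : w ≠ 0 := fun h0 => hne (by rw [h0]; simp)
  obtain ⟨lam, hl0, hl1, hdom⟩ := h.expansion_domination
  have h1 := (hdom x w hw0 hC).2
  have h2 := ((torusDeriv f x).comp (E x).subtypeL).le_opNorm ⟨w, hw⟩
  have h3 : ‖torusDeriv f x w‖ ≤ ‖(torusDeriv f x).comp (E x).subtypeL‖ * ‖w‖ := h2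
  have h4 : 0 ≤ ‖torusDeriv f x w‖ := norm_nonneg _
  nlinarith

/-- The subspace `b`-orthogonal to `E`. -/
def formOrthogonal (b : Euc n →L[ℝ] Euc n →L[ℝ] ℝ) (E : Submodule ℝ (Euc n)) :
    Submodule ℝ (Euc n) where
  carrier := {v | ∀ e ∈ E, b v e = 0}
  add_mem' := fun {v w} hv hw e he => by
    rw [map_add]; simp [hv e he, hw e he]
  zero_mem' := fun e _ => by simp
  smul_mem' := fun c v hv e he => by
    rw [map_smul]; simp [hv e he]

/-- Being definite on `E`, the form identifies `E` with its dual, so the functional `b w` on `E` is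
represented by some `e ∈ E`, and `w - e` is orthogonal to `E`. -/
theorem isCompl_formOrthogonal {b : Euc n →L[ℝ] Euc n →L[ℝ] ℝ} {E : Submodule ℝ (Euc n)}
    (hneg : ∀ e ∈ E, e ≠ 0 → b e e < 0) : IsCompl (formOrthogonal b E) E := by
  constructor
  · rw [Submodule.disjoint_def]
    intro v hv hvE
    by_contra hne
    have := hneg v hvE hne
    rw [hv v hvE] at this
    exact lt_irrefl _ this
  · rw [codisjoint_iff, Submodule.eq_top_iff']
    intro w
    let B : E →ₗ[ℝ] Module.Dual ℝ E :=
      { toFun := fun e => (b e).toLinearMap.comp E.subtype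
        map_add' := fun e e' => by ext; simp
        map_smul' := fun c e => by ext; simp }
    have hinj : Function.Injective B := by
      refine (injective_iff_map_eq_zero B).2 fun e he => ?_
      by_contra hne
      have h1 := hneg e e.2 (fun h0 => hne (Subtype.ext h0))
      have h2 : B e e = b e e := rfl
      rw [he] at h2
      rw [← h2] at h1
      exact lt_irrefl _ h1
    have hsurj : Function.Surjective B :=
      (LinearMap.injective_iff_surjective_of_finrank_eq_finrank
        (Subspace.dual_finrank_eq (K := ℝ) (V := E)).symm).1 hinj
    obtain ⟨e, he⟩ := hsurj ((b w).toLinearMap.comp E.subtype)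
    have hmem : w - e ∈ formOrthogonal b E := fun e' he' => by
      have : B e ⟨e', he'⟩ = b w e' := by rw [he]; rfl
      rw [map_sub]
      have h2 : B e ⟨e', he'⟩ = b e e' := rfl
      simp [← this, h2]
    rw [Submodule.mem_sup]
    exact ⟨w - e, hmem, e, e.2, by simp⟩

/-- If `b` is negative definite on `E` and nonnegative on a subspace of complementary dimension, it
is positive definite on the `b`-orthogonal of `E`. -/
theorem pos_of_mem_formOrthogonal {b : Euc n →L[ℝ] Euc n →L[ℝ] ℝ} {E S : Submodule ℝ (Euc n)}
    (hsymm : ∀ v w, b v w = b w v) (hnd : ∀ v, (∀ w, b v w = 0) → v = 0)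
    (hneg : ∀ e ∈ E, e ≠ 0 → b e e < 0) (hS : ∀ s ∈ S, 0 ≤ b s s)
    (hdim : Module.finrank ℝ S + Module.finrank ℝ E = n) {v : Euc n}
    (hv : v ∈ formOrthogonal b E) (hv0 : v ≠ 0) : 0 < b v v := by
  have hnn : ∀ v ∈ formOrthogonal b E, 0 ≤ b v v := by
    intro v hv
    by_contra hlt
    push Not at hlt
    have hvE : v ∉ E := fun hvE => by
      have := hv v hvE
      linarith
    have hlt' : E < E ⊔ Submodule.span ℝ {v} := by
      refine lt_of_le_of_ne le_sup_left fun heq => hvE ?_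
      rw [heq]
      exact Submodule.mem_sup_right (Submodule.mem_span_singleton_self v)
    have h1 := Submodule.finrank_lt_finrank_of_lt hlt'
    have h2 := Submodule.finrank_sup_add_finrank_inf_eq (E ⊔ Submodule.span ℝ {v}) S
    have h3 := Submodule.finrank_le ((E ⊔ Submodule.span ℝ {v}) ⊔ S)
    rw [finrank_euclideanSpace_fin] at h3
    -- If `b v v < 0`, then `b` is negative definite on the span of `E` and `v`, whose dimension is
    -- too large for it to meet `S` only at zero.
    have h4 : ((E ⊔ Submodule.span ℝ {v}) ⊓ S) ≠ ⊥ := by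
      intro h0
      rw [h0, finrank_bot] at h2
      omega
    obtain ⟨s, hs, hs0⟩ := Submodule.exists_mem_ne_zero_of_ne_bot h4
    obtain ⟨e, he, t, ht, hst⟩ := Submodule.mem_sup.1 hs.1
    obtain ⟨c, rfl⟩ := Submodule.mem_span_singleton.1 ht
    have h5 := hS s hs.2
    have h6 : b s s = b e e + c ^ 2 * b v v := by
      rw [← hst]
      have h7 := hv e he
      have h8 := hsymm e v
      simp only [map_add, map_smul, add_apply, smul_apply, smul_eq_mul]
      rw [h8, h7]
      ring
    rcases eq_or_ne e 0 with rfl | he0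
    · rcases eq_or_ne c 0 with rfl | hc
      · apply hs0; rw [← hst]; simp
      · have : 0 < c ^ 2 := by positivity
        simp only [map_zero] at h6
        nlinarith
    · have := hneg e he he0
      nlinarith [sq_nonneg c]
  refine lt_of_le_of_ne (hnn v hv) fun h0 => hv0 (hnd v fun w => ?_)
  have hcompl := isCompl_formOrthogonal hneg
  have hw : w ∈ formOrthogonal b E ⊔ E := by rw [hcompl.sup_eq_top]; trivial
  obtain ⟨s, hs, e, he, rfl⟩ := Submodule.mem_sup.1 hw
  rw [map_add, hv e he, add_zero]
  by_contra hne
  -- A null vector of a semidefinite form lies in its kernel: otherwise this affine function of `t`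
  -- would take negative values.
  have key : ∀ t : ℝ, 0 ≤ 2 * t * b v s + b s s := fun t => by
    have := hnn _ (Submodule.add_mem _ (Submodule.smul_mem _ t hv) hs)
    simp only [map_add, map_smul, add_apply, smul_apply, smul_eq_mul] at this
    rw [hsymm s v, ← h0] at this
    linarith
  have := key (-(b s s + 1) / (2 * b v s))
  have e : 2 * (-(b s s + 1) / (2 * b v s)) * b v s = -(b s s + 1) := by field_simp
  rw [e] at this
  linarith

end ConesAndBundles

/-! ### From partial hyperbolicity to a dominated system -/

section PartiallyHyperbolic

variable {n d : ℕ} {f : Torus n → Torus n} {F : Euc n → Euc n}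
  {E : Torus n → Submodule ℝ (Euc n)} {C : Torus n → Set (Euc n)}

/-- Vectors in the cones are controlled by their component orthogonal to the center. -/
theorem IsPartiallyHyperbolic.exists_cone_bound (h : IsPartiallyHyperbolic f d E C)
    (hs : Function.Surjective f) :
    ∃ K : ℝ, 1 ≤ K ∧ ∀ x, ∀ v ∈ C x, ‖v‖ ≤ K * ‖v - (E x).starProjection v‖ := by
  obtain ⟨b, hb, hbx⟩ := h.unstable.isConeField
  have hcl : IsClosed {z : Torus n × Euc n | 0 ≤ b z.1 z.2 z.2} :=
    isClosed_le continuous_const (((hb.comp continuous_fst).clm_apply continuous_snd).clm_apply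
      continuous_snd)
  have hφ : Continuous fun z : Torus n × Euc n => ‖z.2 - (E z.1).starProjection z.2‖ :=
    (continuous_snd.sub ((h.center.continuous.comp continuous_fst).clm_apply continuous_snd)).norm
  obtain ⟨c, hc, hle⟩ := exists_pos_le_of_isClosed hcl hφ fun z hz hz1 => by
    rw [norm_pos_iff, sub_ne_zero]
    intro heq
    have hE : z.2 ∈ E z.1 := Submodule.starProjection_eq_self_iff.1 heq.symm
    have hC : z.2 ∈ C z.1 := by rw [(hbx z.1).2.2]; exact hz
    rw [h.eq_zero_of_mem hs hE hC, norm_zero] at hz1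
    exact zero_ne_one hz1
  refine ⟨max 1 c⁻¹, le_max_left _ _, fun x v hv => ?_⟩
  have key : c * ‖v‖ ≤ ‖v - (E x).starProjection v‖ := by
    rcases eq_or_ne v 0 with rfl | hv0
    · simp
    · have hv' : 0 < ‖v‖ := norm_pos_iff.2 hv0
      have h1 := hle (x, ‖v‖⁻¹ • v) (by
        rw [(hbx x).2.2] at hv
        have hv2 : 0 ≤ b x v v := hv
        simp only [mem_ofPred_eq, map_smul, smul_apply, smul_eq_mul]
        positivity) (by
        rw [norm_smul, norm_inv, norm_norm, inv_mul_cancel₀ hv'.ne'])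
      simp only [map_smul, ← smul_sub, norm_smul, norm_inv, norm_norm] at h1
      rwa [inv_mul_eq_div, le_div_iff₀ hv'] at h1
  calc ‖v‖ = c⁻¹ * (c * ‖v‖) := by field_simp
    _ ≤ max 1 c⁻¹ * ‖v - (E x).starProjection v‖ := by gcongr; exact le_max_right _ _

/-- There are complements of the center that remain in the cones at nearby points. -/
theorem IsPartiallyHyperbolic.exists_isCompl (h : IsPartiallyHyperbolic f d E C)
    (hs : Function.Surjective f) :
    ∃ ρ > (0 : ℝ), ∀ p : Euc n, ∃ S : Submodule ℝ (Euc n), IsCompl S (E (toTorus p)) ∧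
      ∀ y, ‖y - p‖ ≤ ρ → ∀ v ∈ S, v ∈ C (toTorus y) := by
  obtain ⟨b, hb, hbx⟩ := h.unstable.isConeField
  have hneg : ∀ x, ∀ e ∈ E x, e ≠ 0 → b x e e < 0 := fun x e he he0 => by
    by_contra hcon
    push Not at hcon
    exact he0 (h.eq_zero_of_mem hs he (by rw [(hbx x).2.2]; exact hcon))
  have hpos : ∀ x, ∀ v ∈ formOrthogonal (b x) (E x), v ≠ 0 → 0 < b x v v := fun x v hv hv0 => by
    -- An inverse path through `x` supplies a subspace of dimension `n - d` inside the cone at `x`,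
    -- fixing the signature of the form.
    let path : ℕ → Torus n := fun k => Nat.rec x (fun _ y => Function.surjInv hs y) k
    obtain ⟨S, hS⟩ := h.complementary path fun k => Function.surjInv_eq hs (path k)
    obtain ⟨h1, h2, -⟩ := hS 0
    refine pos_of_mem_formOrthogonal (hbx x).1 (hbx x).2.1 (hneg x) (S := S 0) (fun s hs' => ?_)
      (by rw [h.center.finrank_eq]; exact h1) hv hv0
    have : s ∈ C x := h2 hs'
    rw [(hbx x).2.2] at this
    exact this
  -- Orthogonality is written with the continuous projection rather than with `e ∈ E x`, so that it
  -- is visibly closed in the base point and the vector together. Compactness then gives a uniform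
  -- bound `c` for positivity, and vectors stay in the cones wherever `b` has moved by at most `c`.
  have hcl : IsClosed {z : Torus n × Euc n | ∀ w, b z.1 z.2 ((E z.1).starProjection w) = 0} := by
    simp only [ofPred_forall]
    refine isClosed_iInter fun w => isClosed_eq ?_ continuous_const
    exact (((hb.comp continuous_fst).clm_apply continuous_snd).clm_apply
      ((h.center.continuous.comp continuous_fst).clm_apply continuous_const))
  have hφ : Continuous fun z : Torus n × Euc n => b z.1 z.2 z.2 :=
    ((hb.comp continuous_fst).clm_apply continuous_snd).clm_apply continuous_snd
  obtain ⟨c, hc, hle⟩ := exists_pos_le_of_isClosed hcl hφ fun z hz hz1 => by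
    refine hpos z.1 z.2 (fun e he => ?_) fun h0 => ?_
    · have := hz e
      rwa [Submodule.starProjection_eq_self_iff.2 he] at this
    · rw [h0, norm_zero] at hz1
      exact zero_ne_one hz1
  have hle' : ∀ x, ∀ v ∈ formOrthogonal (b x) (E x), c * ‖v‖ ^ 2 ≤ b x v v := fun x v hv => by
    rcases eq_or_ne v 0 with rfl | hv0
    · simp
    · have hv' : 0 < ‖v‖ := norm_pos_iff.2 hv0
      have h1 := hle (x, ‖v‖⁻¹ • v) (fun w => by
        have := hv _ (Submodule.starProjection_apply_mem (E x) w)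
        simp [this]) (by
        rw [norm_smul, norm_inv, norm_norm, inv_mul_cancel₀ hv'.ne'])
      simp only [map_smul, smul_apply, smul_eq_mul] at h1
      calc c * ‖v‖ ^ 2 ≤ ‖v‖⁻¹ * (‖v‖⁻¹ * b x v v) * ‖v‖ ^ 2 := by gcongr
        _ = b x v v := by field_simp
  obtain ⟨ρ, hρ, hu⟩ := exists_unif_of_continuous (Y := Euc n →L[ℝ] Euc n →L[ℝ] ℝ) (b := b) hb hc
  refine ⟨ρ, hρ, fun p => ⟨_, isCompl_formOrthogonal (hneg (toTorus p)), fun y hy v hv => ?_⟩⟩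
  rw [(hbx (toTorus y)).2.2]
  have h1 := hle' _ v hv
  have h2 := (b (toTorus y) - b (toTorus p)).le_of_opNorm_le (hu y p hy) v
  have h3 := ((b (toTorus y) - b (toTorus p)) v).le_of_opNorm_le h2 v
  rw [Real.norm_eq_abs] at h3
  have h4 := (abs_le.1 h3).1
  have h5 : (b (toTorus y) - b (toTorus p)) v v = b (toTorus y) v v - b (toTorus p) v v := rfl
  rw [h5] at h4
  show 0 ≤ b (toTorus y) v v
  nlinarith

theorem IsPartiallyHyperbolic.fderiv_iterate_mem_center (h : IsPartiallyHyperbolic f d E C)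
    (hF : IsC1Lift F f) (N : ℕ) (x : Euc n) {v : Euc n} (hv : v ∈ E (toTorus x)) :
    fderiv ℝ F^[N] x v ∈ E (toTorus (F^[N] x)) := by
  have hd : Differentiable ℝ F := hF.1.differentiable (by norm_num)
  induction N with
  | zero => simpa using hv
  | succ N ih =>
    rw [fderiv_iterate_succ_apply hd, Function.iterate_succ_apply', hF.2, ← hF.torusDeriv_eq,
      ← h.center.invariant]
    exact Submodule.mem_map_of_mem ih

theorem IsPartiallyHyperbolic.fderiv_iterate_mem_cone (h : IsPartiallyHyperbolic f d E C)
    (hF : IsC1Lift F f) (N : ℕ) (x : Euc n) {v : Euc n} (hv : v ∈ C (toTorus x)) :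
    fderiv ℝ F^[N] x v ∈ C (toTorus (F^[N] x)) := by
  have hd : Differentiable ℝ F := hF.1.differentiable (by norm_num)
  induction N with
  | zero => simpa using hv
  | succ N ih =>
    rw [fderiv_iterate_succ_apply hd, Function.iterate_succ_apply', hF.2, ← hF.torusDeriv_eq]
    exact h.unstable.forward_invariant _ _ ih

/-- Vectors in the cones are expanded, more than those in the center. -/
theorem IsPartiallyHyperbolic.exists_growth (h : IsPartiallyHyperbolic f d E C)
    (hF : IsC1Lift F f) : ∃ lam : ℝ, 0 < lam ∧ lam < 1 ∧ ∀ (N : ℕ) (x : Euc n),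
      ∀ v ∈ C (toTorus x), ‖v‖ ≤ lam ^ N * ‖fderiv ℝ F^[N] x v‖ ∧
        ∀ e ∈ E (toTorus x), ‖fderiv ℝ F^[N] x e‖ * ‖v‖ ≤
          lam ^ N * ‖e‖ * ‖fderiv ℝ F^[N] x v‖ := by
  have hd : Differentiable ℝ F := hF.1.differentiable (by norm_num)
  obtain ⟨lam, h0, h1, hdom⟩ := h.expansion_domination
  refine ⟨lam, h0, h1, fun N x v hv => ?_⟩
  induction N with
  | zero =>
    refine ⟨by simp, fun e he => ?_⟩
    simp
  | succ N ih =>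
    obtain ⟨ih1, ih2⟩ := ih
    simp only [fderiv_iterate_succ_apply hd]
    set w := fderiv ℝ F^[N] x v with hw
    set y := F^[N] x with hy
    have hwC : w ∈ C (toTorus y) := h.fderiv_iterate_mem_cone hF N x hv
    have hstep : ‖w‖ ≤ lam * ‖fderiv ℝ F y w‖ ∧
        ‖(torusDeriv f (toTorus y)).comp (E (toTorus y)).subtypeL‖ * ‖w‖ ≤
          lam * ‖fderiv ℝ F y w‖ := by
      rcases eq_or_ne w 0 with hw0 | hw0
      · rw [hw0]; simp
      · have := hdom (toTorus y) w hw0 (h.unstable.forward_invariant _ _ hwC)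
        rw [← hF.torusDeriv_eq]
        exact ⟨this.1.le, this.2.le⟩
    constructor
    · calc ‖v‖ ≤ lam ^ N * ‖w‖ := ih1
        _ ≤ lam ^ N * (lam * ‖fderiv ℝ F y w‖) := by gcongr; exact hstep.1
        _ = _ := by ring
    · intro e he
      have he' := h.fderiv_iterate_mem_center hF N x he
      have h3 := ((torusDeriv f (toTorus y)).comp (E (toTorus y)).subtypeL).le_opNorm ⟨_, he'⟩
      have hM0 := norm_nonneg ((torusDeriv f (toTorus y)).comp (E (toTorus y)).subtypeL)
      set M := ‖(torusDeriv f (toTorus y)).comp (E (toTorus y)).subtypeL‖ with hM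
      have h4 : ‖fderiv ℝ F y (fderiv ℝ F^[N] x e)‖ ≤ M * ‖fderiv ℝ F^[N] x e‖ := by
        rw [← hF.torusDeriv_eq]; exact h3
      calc ‖fderiv ℝ F y (fderiv ℝ F^[N] x e)‖ * ‖v‖ ≤ M * ‖fderiv ℝ F^[N] x e‖ * ‖v‖ := by gcongr
        _ = M * (‖fderiv ℝ F^[N] x e‖ * ‖v‖) := by ring
        _ ≤ M * (lam ^ N * ‖e‖ * ‖w‖) := 
            mul_le_mul_of_nonneg_left (ih2 e he) hM0
        _ = lam ^ N * ‖e‖ * (M * ‖w‖) := by ring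
        _ ≤ lam ^ N * ‖e‖ * (lam * ‖fderiv ℝ F y w‖) := 
            mul_le_mul_of_nonneg_left hstep.2 (by positivity)
        _ = _ := by ring

theorem norm_le_pow_mul_norm_fderiv_iterate {L : ℝ} (hL : 0 ≤ L) (hd : Differentiable ℝ F)
    (hlow : ∀ x v, ‖v‖ ≤ L * ‖fderiv ℝ F x v‖) (N : ℕ) (x v : Euc n) :
    ‖v‖ ≤ L ^ N * ‖fderiv ℝ F^[N] x v‖ := by
  induction N with
  | zero => simp
  | succ N ih =>
    rw [fderiv_iterate_succ_apply hd, pow_succ, mul_assoc]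
    exact ih.trans (by gcongr; exact hlow _ _)

/-- Frames for the splitting into the center and its orthogonal complement. -/
theorem IsPartiallyHyperbolic.exists_frames (h : IsPartiallyHyperbolic f d E C) :
    ∃ (J : Euc n → Euc (n - d) →L[ℝ] Euc n) (R : Euc n → Euc n →L[ℝ] Euc (n - d)),
      ∀ x, Frame (J x) (R x) (E (toTorus x)).starProjection := by
  have hex : ∀ x : Euc n, ∃ (J : Euc (n - d) →L[ℝ] Euc n) (R : Euc n →L[ℝ] Euc (n - d)),
      Frame J R (E (toTorus x)).starProjection := fun x => exists_frame _ (by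
    rw [h.center.finrank_eq]
    have := h.rank_lt
    omega)
  choose J R hJR using hex
  exact ⟨J, R, hJR⟩

/-- All large iterates form a dominated system. -/
theorem IsPartiallyHyperbolic.exists_dominatedSystem (h : IsPartiallyHyperbolic f d E C)
    (hs : Function.Surjective f) (hF : IsC1Lift F f)
    (hf : ∀ x, Function.Bijective (torusDeriv f x))
    {J : Euc n → Euc (n - d) →L[ℝ] Euc n} {R : Euc n → Euc n →L[ℝ] Euc (n - d)}
    (hJR : ∀ x, Frame (J x) (R x) (E (toTorus x)).starProjection) :
    ∃ N₁ : ℕ, ∀ N ≥ N₁, ∃ L, DominatedSystem F^[N] J R (fun x => (E (toTorus x)).starProjection) L := by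
  obtain ⟨K, hK1, hK⟩ := h.exists_cone_bound hs
  obtain ⟨lam, hl0, hl1, hgr⟩ := h.exists_growth hF
  obtain ⟨ρ, hρ, hcompl⟩ := h.exists_isCompl hs
  obtain ⟨L₁, hL₁, hlow⟩ := hF.exists_lower_bound hf
  have hd : Differentiable ℝ F := hF.1.differentiable (by norm_num)
  have hK0 : 0 < K := by linarith
  -- Measuring cone vectors by their coordinate costs `K`; the domination rate `lam ^ N` must beat
  -- it by the factor 4.
  obtain ⟨N₁, hN₁⟩ := exists_pow_lt_of_lt_one (show 0 < 1 / (4 * K) by positivity) hl1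
  refine ⟨N₁, fun N hN => ?_⟩
  have hlamN : 4 * K * lam ^ N ≤ 1 := by
    have e1 : lam ^ N ≤ lam ^ N₁ := pow_le_pow_of_le_one hl0.le hl1.le hN
    have e2 := e1.trans hN₁.le
    rw [le_div_iff₀ (by positivity)] at e2
    linarith
  have hU : UnifC1 F^[N] := hF.unifC1.iterate N
  obtain ⟨L₂, hL₂1, hL₂⟩ := hU.exists_pos_bound
  refine ⟨max L₂ (L₁ ^ N), hU, hJR, fun x => (hL₂ x).trans (le_max_left _ _), fun x v => ?_,
    fun c hc => exists_unif_of_continuous h.center.continuous hc, fun x v => ?_, fun x => ?_⟩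
  · refine (norm_le_pow_mul_norm_fderiv_iterate (by linarith) hd hlow N x v).trans ?_
    gcongr
    exact le_max_right _ _
  · exact Submodule.starProjection_eq_self_iff.2 (h.fderiv_iterate_mem_center hF N x
      (Submodule.starProjection_apply_mem _ _))
  · set D := fderiv ℝ F^[N] x with hD
    set μ := max 1 ‖D.comp (E (toTorus x)).subtypeL‖ with hμ
    refine ⟨μ, le_max_left _ _, max_le (hL₂1.trans (le_max_left _ _)) ?_, fun v => ?_, fun w => ?_⟩
    · refine le_trans ?_ ((hL₂ x).trans (le_max_left _ _))
      refine ContinuousLinearMap.opNorm_le_bound _ (norm_nonneg _) fun v => ?_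
      exact D.le_opNorm v
    · have h1 := (D.comp (E (toTorus x)).subtypeL).le_opNorm
        ⟨(E (toTorus x)).starProjection v, Submodule.starProjection_apply_mem _ _⟩
      refine le_trans h1 ?_
      show _ ≤ μ * ‖(E (toTorus x)).starProjection v‖
      gcongr
      · exact le_max_right _ _
      · rfl
    -- The orthogonal complement of the center need not lie in the cone, but `R` vanishes on the
    -- invariant center. So `w` may be replaced by its component along a complement inside the cone,
    -- where the growth estimates apply.
    · obtain ⟨S, hSE, hSC⟩ := hcompl x
      have hw : w ∈ S ⊔ E (toTorus x) := by rw [hSE.sup_eq_top]; trivial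
      obtain ⟨s, hsS, e, he, rfl⟩ := Submodule.mem_sup.1 hw
      have hRE : ∀ y, ∀ e ∈ E (toTorus y), R y e = 0 := fun y e he => by
        have := (hJR y).coord_Q e
        rwa [Submodule.starProjection_eq_self_iff.2 he] at this
      have hsC : s ∈ C (toTorus x) := hSC x (by simp [hρ.le]) s hsS
      have hDsC := h.fderiv_iterate_mem_cone hF N x hsC
      rw [map_add, map_add, map_add, hRE x e he,
        hRE _ _ (h.fderiv_iterate_mem_center hF N x he), add_zero, add_zero]
      have h1 := (hJR x).norm_coord s
      have h2 := hK _ _ hDsC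
      rw [← (hJR (F^[N] x)).norm_coord_eq, ← hD] at h2
      obtain ⟨h3, h4⟩ := hgr N x s hsC
      rw [← hD] at h3 h4
      have h5 : μ * ‖s‖ ≤ lam ^ N * ‖D s‖ := by
        rcases eq_or_ne s 0 with rfl | hs0
        · simp
        have hs0' : 0 < ‖s‖ := norm_pos_iff.2 hs0
        rw [← le_div_iff₀ hs0']
        refine max_le (by rw [le_div_iff₀ hs0']; linarith) ?_
        refine ContinuousLinearMap.opNorm_le_bound _ (by positivity) fun e => ?_
        rw [div_mul_eq_mul_div, le_div_iff₀ hs0']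
        have := h4 e e.2
        show ‖D e‖ * ‖s‖ ≤ lam ^ N * ‖D s‖ * ‖(e : Euc n)‖
        linarith
      have hμ0 : 0 < μ := lt_of_lt_of_le one_pos (le_max_left _ _)
      calc 4 * μ * ‖R x s‖ ≤ 4 * (μ * ‖s‖) := by nlinarith
        _ ≤ 4 * (lam ^ N * (K * ‖R (F^[N] x) (D s)‖)) := by
            have : lam ^ N * ‖D s‖ ≤ lam ^ N * (K * ‖R (F^[N] x) (D s)‖) := by gcongr
            linarith
        _ = 4 * K * lam ^ N * ‖R (F^[N] x) (D s)‖ := by ring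
        _ ≤ 1 * ‖R (F^[N] x) (D s)‖ := by gcongr
        _ = _ := one_mul _

/-- Affine discs tangent to the cones, transversal to the center, of uniform size. -/
theorem IsPartiallyHyperbolic.exists_affine_discs (h : IsPartiallyHyperbolic f d E C)
    (hs : Function.Surjective f)
    {J : Euc n → Euc (n - d) →L[ℝ] Euc n} {R : Euc n → Euc n →L[ℝ] Euc (n - d)}
    (hJR : ∀ x, Frame (J x) (R x) (E (toTorus x)).starProjection) :
    ∃ K : ℝ, ∃ ρ > (0 : ℝ), ∀ p, ∃ ℓ : Euc (n - d) →L[ℝ] Euc n, (∀ k, R p (ℓ k) = k) ∧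
      (∀ k, ‖(E (toTorus p)).starProjection (ℓ k)‖ ≤ K * ‖k‖) ∧
      ∀ y, ‖y - p‖ ≤ ρ → ∀ k, ℓ k ∈ C (toTorus y) := by
  obtain ⟨K, hK1, hK⟩ := h.exists_cone_bound hs
  obtain ⟨ρ, hρ, hcompl⟩ := h.exists_isCompl hs
  refine ⟨K, ρ, hρ, fun p => ?_⟩
  obtain ⟨S, hSE, hSC⟩ := hcompl p
  -- Projecting along the center moves the orthogonal section into `S` without changing the
  -- coordinate `R`.
  set ℓ : Euc (n - d) →ₗ[ℝ] Euc n := (S.projection (E (toTorus p)) hSE).comp (J p).toLinearMap with hℓ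
  have hmem : ∀ k, ℓ k ∈ S := fun k => by
    exact Submodule.projection_apply_mem hSE _
  have hR : ∀ k, R p (ℓ k) = k := fun k => by
    have h1 : J p k - ℓ k ∈ E (toTorus p) := Submodule.sub_projection_mem hSE _
    have h2 := (hJR p).coord_Q (J p k - ℓ k)
    rw [Submodule.starProjection_eq_self_iff.2 h1, map_sub, (hJR p).coord_J, sub_eq_zero] at h2
    exact h2.symm
  refine ⟨ℓ.toContinuousLinearMap, hR, fun k => ?_, fun y hy k => hSC y hy _ (hmem k)⟩
  have h1 := hK _ _ (hSC p (by simp [hρ.le]) _ (hmem k))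
  rw [← (hJR p).norm_coord_eq, hR] at h1
  exact ((hJR p).norm_Q _).trans h1

end PartiallyHyperbolic

/-! ### Internal diameter and center expanding points of tangent discs -/

section ExpandingPoints

/-- A disc whose parametrization expands by at least `κ` has internal diameter at least `2 * κ`. -/
theorem ofReal_le_internalDiam {n m : ℕ} {σ : Euc m → Euc n} {κ : ℝ} (hκ : 0 ≤ κ)
    (hd : ∀ u ∈ closedBall (0 : Euc m) 1, DifferentiableAt ℝ σ u)
    (hσ : ∀ u ∈ closedBall (0 : Euc m) 1, ∀ w, κ * ‖w‖ ≤ ‖fderiv ℝ σ u w‖) :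
    ENNReal.ofReal (2 * κ) ≤ internalDiam σ := by
  rw [internalDiam, ENNReal.ofReal_mul (by norm_num), ENNReal.ofReal_ofNat]
  gcongr
  -- The parameter 0 suffices: a curve from it to the unit sphere has length at least 1 in the
  -- parameter ball.
  refine le_trans ?_ (le_iSup₂_of_le (0 : Euc m) (by simp) le_rfl)
  refine le_iInf₂ fun c hc => ?_
  obtain ⟨hc1, hmem, hc0, hcs⟩ := hc
  have hdc : Differentiable ℝ c := hc1.differentiable (by norm_num)
  have hFTC : ∫ t in (0 : ℝ)..1, deriv c t = c 1 - c 0 :=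
    intervalIntegral.integral_deriv_eq_sub (fun t _ => hdc t)
      ((hc1.continuous_deriv le_rfl).intervalIntegrable _ _)
  have hlen : 1 ≤ ∫⁻ t in Icc (0 : ℝ) 1, ‖deriv c t‖ₑ := by
    have h1 : ‖c 1 - c 0‖ₑ = 1 := by
      rw [hc0, sub_zero, ← ofReal_norm, mem_sphere_zero_iff_norm.1 hcs, ENNReal.ofReal_one]
    rw [← h1, ← hFTC, intervalIntegral.integral_of_le zero_le_one]
    exact (MeasureTheory.enorm_integral_le_lintegral_enorm _).trans
      (MeasureTheory.lintegral_mono_set Ioc_subset_Icc_self)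
  calc ENNReal.ofReal κ ≤ ENNReal.ofReal κ * ∫⁻ t in Icc (0 : ℝ) 1, ‖deriv c t‖ₑ :=
        le_mul_of_one_le_right zero_le hlen
    _ = ∫⁻ t in Icc (0 : ℝ) 1, ENNReal.ofReal κ * ‖deriv c t‖ₑ :=
        (MeasureTheory.lintegral_const_mul' _ _ ENNReal.ofReal_ne_top).symm
    _ ≤ ∫⁻ t in Icc (0 : ℝ) 1, ‖deriv (σ ∘ c) t‖ₑ := by
        refine MeasureTheory.setLIntegral_mono' measurableSet_Icc fun t ht => ?_
        rw [fderiv_comp_deriv t (hd _ (hmem t ht)) (hdc t), ← ofReal_norm, ← ofReal_norm,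
          ← ENNReal.ofReal_mul hκ]
        exact ENNReal.ofReal_le_ofReal (hσ _ (hmem t ht) _)

theorem GraphDisc.coord_fderiv {X W : Type*} [NormedAddCommGroup X] [NormedSpace ℝ X]
    [NormedAddCommGroup W] [NormedSpace ℝ W] {R : X →L[ℝ] W} {Q : X →L[ℝ] X} {a r : ℝ} {p : X}
    {φ : W → X} (hφ : GraphDisc R Q a p r φ) {h : W} (hh : h ∈ ball (0 : W) r) (w : W) :
    R (fderiv ℝ φ h w) = w := by
  have h1 : HasFDerivAt (fun y => R (φ y - p)) (R.comp (fderiv ℝ φ h)) h :=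
    R.hasFDerivAt.comp h
      (((hφ.contDiffAt h hh).differentiableAt (by norm_num)).hasFDerivAt.sub_const p)
  have h2 : (fun y => R (φ y - p)) =ᶠ[nhds h] id := by
    filter_upwards [isOpen_ball.mem_nhds hh] with y hy using hφ.chart y hy
  have h3 := (h1.congr_of_eventuallyEq h2.symm).unique (hasFDerivAt_id h)
  exact congrArg (fun T : W →L[ℝ] W => T w) h3

variable {n d : ℕ} {f : Torus n → Torus n} {F : Euc n → Euc n}
  {E : Torus n → Submodule ℝ (Euc n)} {C : Torus n → Set (Euc n)}

/-- The forward images of a graph disc tangent to the cones are discs of large internal diameter. -/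
theorem IsPartiallyHyperbolic.exists_isTangentDisc (h : IsPartiallyHyperbolic f d E C)
    (hF : IsC1Lift F f) (hf : ∀ x, Function.Bijective (torusDeriv f x)) (δ : ℝ) {ρ : ℝ}
    (hρ : 0 < ρ) :
    ∃ M : ℕ, ∀ (J : Euc (n - d) →L[ℝ] Euc n) (R : Euc n →L[ℝ] Euc (n - d))
      (Q : Euc n →L[ℝ] Euc n) (a : ℝ) (p : Euc n) (σ : Euc (n - d) → Euc n), Frame J R Q →
      GraphDisc R Q a p ρ σ → TangentTo (fun x => C (toTorus x)) ρ σ →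
      IsTangentDisc C (fun u => F^[M] (σ ((ρ / 2) • u))) ∧
        ENNReal.ofReal δ < internalDiam (fun u => F^[M] (σ ((ρ / 2) • u))) := by
  obtain ⟨lam, hl0, hl1, hgr⟩ := h.exists_growth hF
  obtain ⟨M, hM⟩ := exists_pow_lt_of_lt_one (show 0 < ρ / (|δ| + 1) by positivity) hl1
  refine ⟨M, fun J R Q a p σ hJ hσ hT => ?_⟩
  have hFM : ContDiff ℝ 1 F^[M] := contDiff_one_iterate hF.1 M
  have hmem : ∀ u ∈ closedBall (0 : Euc (n - d)) 1, (ρ / 2) • u ∈ ball (0 : Euc (n - d)) ρ := by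
    intro u hu
    rw [mem_closedBall_zero_iff] at hu
    rw [mem_ball_zero_iff, norm_smul, Real.norm_of_nonneg (by positivity)]
    nlinarith
  have hC : ∀ u ∈ closedBall (0 : Euc (n - d)) 1,
      ContDiffAt ℝ 1 (fun u => F^[M] (σ ((ρ / 2) • u))) u := fun u hu => by
    have h1 : ContDiffAt ℝ 1 (fun u : Euc (n - d) => (ρ / 2) • u) u :=
      (contDiff_const_smul (ρ / 2)).contDiffAt
    exact hFM.contDiffAt.comp u ((hσ.contDiffAt _ (hmem u hu)).comp u h1)
  have hfd : ∀ u ∈ closedBall (0 : Euc (n - d)) 1, ∀ w,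
      fderiv ℝ (fun u => F^[M] (σ ((ρ / 2) • u))) u w =
        fderiv ℝ F^[M] (σ ((ρ / 2) • u)) (fderiv ℝ σ ((ρ / 2) • u) ((ρ / 2) • w)) := by
    intro u hu w
    have h1 : HasFDerivAt (fun u : Euc (n - d) => (ρ / 2) • u)
        ((ρ / 2) • ContinuousLinearMap.id ℝ (Euc (n - d))) u := (hasFDerivAt_id u).fun_const_smul _
    have h2 := ((hσ.contDiffAt _ (hmem u hu)).differentiableAt (by norm_num)).hasFDerivAt
    have h3 := (hFM.differentiable (by norm_num) (σ ((ρ / 2) • u))).hasFDerivAt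
    exact congrArg (fun T : Euc (n - d) →L[ℝ] Euc n => T w) (h3.comp u (h2.comp u h1)).fderiv
  have hlow : ∀ u ∈ closedBall (0 : Euc (n - d)) 1, ∀ w,
      (lam ^ M)⁻¹ * (ρ / 2) * ‖w‖ ≤ ‖fderiv ℝ (fun u => F^[M] (σ ((ρ / 2) • u))) u w‖ := by
    intro u hu w
    rw [hfd u hu]
    have h1 := (hgr M _ _ (hT _ (hmem u hu) ((ρ / 2) • w))).1
    have h2 := hJ.norm_coord (fderiv ℝ σ ((ρ / 2) • u) ((ρ / 2) • w))
    rw [hσ.coord_fderiv (hmem u hu), norm_smul, Real.norm_of_nonneg (by positivity)] at h2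
    rw [mul_assoc, inv_mul_le_iff₀ (by positivity)]
    exact h2.trans h1
  have hκ : 0 < (lam ^ M)⁻¹ * (ρ / 2) := by positivity
  refine ⟨⟨hC, fun u hu u' hu' heq => ?_, fun u hu => ?_, fun u hu w => ?_⟩, ?_⟩
  -- Discs are required to be embedded only in the universal cover, where the lift is injective
  -- although `f` need not be.
  · have h1 := (hF.injective hf).iterate M heq
    have h2 := hσ.coord_sub (hmem u hu) (hmem u' hu')
    rw [h1, sub_self, map_zero] at h2
    exact smul_right_injective _ (by positivity : ρ / 2 ≠ 0) (sub_eq_zero.1 h2.symm)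
  · refine (injective_iff_map_eq_zero _).2 fun w hw => ?_
    have h1 := hlow u hu w
    rw [hw, norm_zero] at h1
    exact norm_le_zero_iff.1 (nonpos_of_mul_nonpos_right h1 hκ)
  · rw [hfd u hu]
    exact h.fderiv_iterate_mem_cone hF M _ (hT _ (hmem u hu) _)
  · refine lt_of_lt_of_le ?_ (ofReal_le_internalDiam hκ.le
      (fun u hu => (hC u hu).differentiableAt (by norm_num)) hlow)
    rw [lt_div_iff₀ (by positivity)] at hM
    have h1 : δ < 2 * ((lam ^ M)⁻¹ * (ρ / 2)) := by
      have e : 2 * ((lam ^ M)⁻¹ * (ρ / 2)) = ρ / lam ^ M := by field_simp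
      rw [e, lt_div_iff₀ (by positivity)]
      have : 0 < lam ^ M := by positivity
      nlinarith [le_abs_self δ]
    exact (ENNReal.ofReal_lt_ofReal_iff (by positivity)).2 h1

/-- Discs tangent to the cones have points that are center expanding for an iterate of the map. -/
theorem IsPartiallyHyperbolic.exists_hasExpandingPoints (h : IsPartiallyHyperbolic f d E C)
    (hF : IsC1Lift F f) (hf : ∀ x, Function.Bijective (torusDeriv f x))
    {J : Euc n → Euc (n - d) →L[ℝ] Euc n} {R : Euc n → Euc n →L[ℝ] Euc (n - d)}
    (hJR : ∀ x, Frame (J x) (R x) (E (toTorus x)).starProjection) {δ₀ lam₀ : ℝ} {k₀ : ℕ}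
    (hexp : CenterExpandingPoints f d E C δ₀ lam₀ k₀) {N : ℕ} (hN : 0 < N) (hN4 : 4 ≤ lam₀ ^ N)
    (a : ℝ) {ρ : ℝ} (hρ : 0 < ρ) :
    ∃ m₀, HasExpandingPoints F^[N] R (fun x => (E (toTorus x)).starProjection)
      (fun x => C (toTorus x)) a ρ m₀ := by
  obtain ⟨M, hM⟩ := h.exists_isTangentDisc hF hf δ₀ hρ
  -- The hypothesis applies to the `M`-th image of the disc and to more than `k₀` iterates after it;
  -- counting in steps of `F^[N]` only improves this, as `k ≤ N * k`.
  refine ⟨M + k₀ + 1, fun p σ hσ hT => ?_⟩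
  obtain ⟨hdisc, hdiam⟩ := hM _ _ _ a p σ (hJR p) hσ hT
  obtain ⟨u, hu, hx⟩ := hexp _ hdisc hdiam
  refine ⟨(ρ / 2) • u, ?_, fun k hk v => ?_⟩
  · rw [mem_closedBall_zero_iff] at hu
    rw [norm_smul, Real.norm_of_nonneg (by positivity)]
    exact mul_le_of_le_one_right (by positivity) hu
  set q := σ ((ρ / 2) • u) with hq
  have hk' : k ≤ N * k := Nat.le_mul_of_pos_left k hN
  obtain ⟨j, hj⟩ : ∃ j, N * k = j + M := ⟨N * k - M, by omega⟩
  have hpt : f^[j] (toTorus (F^[M] q)) = toTorus ((F^[N])^[k] q) := by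
    rw [← Function.iterate_mul, hj, Function.iterate_add_apply, (hF.iterate j).2]
  have h1 := hx N hN j (by omega)
  simp only [hpt] at h1
  rw [(hF.iterate N).torusDeriv_eq] at h1
  set w := (E (toTorus ((F^[N])^[k] q))).starProjection v with hw
  rcases eq_or_ne w 0 with h0 | h0
  · rw [h0]; simp
  · have h2 := h1 w (Submodule.starProjection_apply_mem _ _) h0
    calc 4 * ‖w‖ ≤ lam₀ ^ N * ‖w‖ := by gcongr
      _ ≤ _ := h2.le

end ExpandingPoints

/-! ### Robust meeting of pre-orbits with balls of fixed radius -/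

section RobustDensity

variable {n d : ℕ} {f : Torus n → Torus n} {F : Euc n → Euc n}

/-- If the pre-orbits of `f` are dense, those of the maps near `f` meet all balls of radius `r`. -/
theorem IsC1Lift.exists_robust_mem_preOrbit (hF : IsC1Lift F f)
    (hf : ∀ x, Function.Bijective (torusDeriv f x)) (hdense : ∀ x, Dense (preOrbit f x)) {r : ℝ}
    (hr : 0 < r) :
    ∃ ε > (0 : ℝ), ∀ G g, IsC1Lift G g → C1Close F G ε → ∀ (w : Euc n) (x : Torus n),
      ∃ w' ∈ closedBall w r, toTorus w' ∈ preOrbit g x := by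
  obtain ⟨L, hL, hlow⟩ := hF.exists_lower_bound hf
  obtain ⟨ε₀, hε₀, hball⟩ := hF.unifC1.exists_ball_iterate (by linarith) hlow
  have hK : IsCompact (closedBall (0 : Euc n) √n ×ˢ closedBall (0 : Euc n) √n) :=
    (isCompact_closedBall _ _).prod (isCompact_closedBall _ _)
  have key : ∃ ε > (0 : ℝ), ∀ G g, IsC1Lift G g → C1Close F G ε →
      ∀ z ∈ closedBall (0 : Euc n) √n ×ˢ closedBall (0 : Euc n) √n,
        ∃ w' ∈ closedBall z.1 r, toTorus w' ∈ preOrbit g (toTorus z.2) := by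
    refine hK.induction_on (p := fun s => ∃ ε > (0 : ℝ), ∀ G g, IsC1Lift G g → C1Close F G ε →
      ∀ z ∈ s, ∃ w' ∈ closedBall z.1 r, toTorus w' ∈ preOrbit g (toTorus z.2)) ?_ ?_ ?_ ?_
    · exact ⟨1, one_pos, fun _ _ _ _ _ hz => hz.elim⟩
    · rintro s t hst ⟨ε, hε, h⟩
      exact ⟨ε, hε, fun G g hG hc z hz => h G g hG hc z (hst hz)⟩
    · rintro s t ⟨ε, hε, h⟩ ⟨ε', hε', h'⟩
      refine ⟨min ε ε', lt_min hε hε', fun G g hG hc z hz => hz.elim (fun hz => ?_) fun hz => ?_⟩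
      · exact h G g hG (hc.mono (min_le_left _ _)) z hz
      · exact h' G g hG (hc.mono (min_le_right _ _)) z hz
    · rintro ⟨w₀, x₀⟩ -
      -- A point `w₁` near `w₀` is sent to `x₀` in `k` steps. For nearby `G`, the image under
      -- `G^[k]` of the ball of radius `r / 2` around `w₁` covers lifts of all points near `x₀`.
      obtain ⟨y, ⟨w₁, hw₁, rfl⟩, k, hk⟩ := (hdense (toTorus x₀)).inter_open_nonempty
        (toTorus '' ball w₀ (r / 4)) (isOpenQuotientMap_toTorus.isOpenMap _ isOpen_ball)
        ((nonempty_ball.2 (by positivity)).image _)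
      obtain ⟨s, hs, hcov⟩ := hball k (r / 2) (by positivity)
      obtain ⟨ε₁, hε₁, hclose⟩ := hF.unifC1.exists_c1Close_iterate k
        (show 0 < s / 2 by positivity)
      refine ⟨ball w₀ (r / 4) ×ˢ ball x₀ (s / 2), mem_nhdsWithin_of_mem_nhds
        (prod_mem_nhds (ball_mem_nhds _ (by positivity)) (ball_mem_nhds _ (by positivity))),
        min ε₀ ε₁, lt_min hε₀ hε₁, ?_⟩
      rintro G g hG hc ⟨w, x⟩ ⟨hw, hx⟩
      have h1 := (hclose G hG.1 (hc.mono (min_le_right _ _)) w₁).1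
      have hy : F^[k] w₁ + (x - x₀) ∈ closedBall (G^[k] w₁) s := by
        rw [mem_ball, dist_eq_norm] at hx
        rw [mem_closedBall, dist_eq_norm, add_sub_right_comm]
        exact (norm_add_le _ _).trans (by dsimp only at hx; linarith)
      obtain ⟨w', hw', hGw⟩ := hcov G hG.1 (hc.mono (min_le_left _ _)) w₁ hy
      refine ⟨w', ?_, k, ?_⟩
      · rw [mem_closedBall] at hw' ⊢
        rw [mem_ball] at hw hw₁
        rw [dist_comm] at hw
        have h2 := dist_triangle4 w' w₁ w₀ w
        dsimp only at hw ⊢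
        linarith
      · rw [← (hG.iterate k).2, hGw, toTorus_add, toTorus_sub, (hF.iterate k).2, hk]
        abel
  obtain ⟨ε, hε, h⟩ := key
  refine ⟨ε, hε, fun G g hG hc w x => ?_⟩
  -- Only classes modulo the lattice matter, so both points are moved into the compact ball, and the
  -- solution is translated back.
  obtain ⟨w₂, hw₂, hn₂⟩ := exists_lift_norm_le_sqrt (toTorus w)
  obtain ⟨x₂, rfl, hx₂⟩ := exists_lift_norm_le_sqrt x
  obtain ⟨w', hw', hmem⟩ := h G g hG hc (w₂, x₂)
    ⟨mem_closedBall_zero_iff.2 hn₂, mem_closedBall_zero_iff.2 hx₂⟩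
  refine ⟨w' + (w - w₂), ?_, ?_⟩
  · rw [mem_closedBall, dist_eq_norm] at hw' ⊢
    convert hw' using 2
    abel
  · rwa [toTorus_add, toTorus_sub, hw₂, sub_self, add_zero]

end RobustDensity

/-! ### Robust density of pre-orbits -/

theorem theorem2 {n d : ℕ} (f : Torus n → Torus n)
    (E : Torus n → Submodule ℝ (Euc n)) (C : Torus n → Set (Euc n))
    (hf : IsLocalDiffeo f) (hph : IsPartiallyHyperbolic f d E C)
    (hdense : ∀ x, Dense (preOrbit f x))
    (hexp : ∃ δ₀ > (0 : ℝ), ∃ lam₀ > (1 : ℝ), ∃ k₀ : ℕ, CenterExpandingPoints f d E C δ₀ lam₀ k₀) :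
    ∃ ε > (0 : ℝ), ∀ g : Torus n → Torus n, IsC1 g →
      (∀ x, dist (f x) (g x) < ε ∧ ‖torusDeriv f x - torusDeriv g x‖ < ε) →
      ∀ x, Dense (preOrbit g x) := by
  obtain ⟨⟨F, hF⟩, hbij⟩ := hf
  obtain ⟨δ₀, -, lam₀, hlam₀, k₀, hexp⟩ := hexp
  have hs : Function.Surjective f :=
    surjective_of_dense_preOrbit (hph.rank_pos.trans hph.rank_lt) hdense
  obtain ⟨J, R, hJR⟩ := hph.exists_frames
  obtain ⟨N₁, hN₁⟩ := hph.exists_dominatedSystem hs hF hbij hJR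
  obtain ⟨N₂, hN₂⟩ := pow_unbounded_of_one_lt 4 hlam₀
  set N := max N₁ (max 1 N₂) with hN
  have hN0 : 0 < N := lt_of_lt_of_le one_pos ((le_max_left 1 N₂).trans (le_max_right _ _))
  have hN4 : 4 ≤ lam₀ ^ N :=
    hN₂.le.trans (pow_le_pow_right₀ hlam₀.le ((le_max_right 1 N₂).trans (le_max_right _ _)))
  obtain ⟨L, hS⟩ := hN₁ N (le_max_left _ _)
  obtain ⟨K, ρ, hρ, haff⟩ := hph.exists_affine_discs hs hJR
  obtain ⟨ε₁, hε₁, r, hr, hblow⟩ := hS.exists_ball_subset_iterate (C := fun x => C (toTorus x))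
    (fun x v hv => hph.fderiv_iterate_mem_cone hF N x hv) hρ haff
    fun a ρ hρ => hph.exists_hasExpandingPoints hF hbij hJR hexp hN0 hN4 a hρ
  obtain ⟨ε₂, hε₂, hclose⟩ := hF.unifC1.exists_c1Close_iterate N hε₁
  -- The radius `r` is already fixed by the power `F^[N]`, so the closeness needed to meet all balls
  -- of that radius is uniform in `g`.
  obtain ⟨ε₃, hε₃, hrob⟩ := hF.exists_robust_mem_preOrbit hbij hdense hr
  obtain ⟨ε, hε, hlift⟩ := hF.exists_lift_c1Close (lt_min hε₂ hε₃)
  refine ⟨ε, hε, fun g hg hgf x => dense_iff_inter_open.2 fun V hV hVne => ?_⟩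
  obtain ⟨G, hG, hFG⟩ := hlift g hg hgf
  obtain ⟨k, w, hw⟩ := hblow G^[N] (contDiff_one_iterate hG.1 N)
    (hclose G hG.1 (hFG.mono (min_le_left _ _))) (toTorus ⁻¹' V) (hV.preimage continuous_toTorus)
    (hVne.preimage isOpenQuotientMap_toTorus.surjective)
  obtain ⟨w', hw', j, hj⟩ := hrob G g hG (hFG.mono (min_le_right _ _)) w x
  obtain ⟨u, hu, rfl⟩ := hw hw'
  -- `N * k` steps bring `u` to a point of the ball lying in the pre-orbit of `x`, and `j` more
  -- steps reach `x`.
  refine ⟨toTorus u, hu, j + N * k, ?_⟩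
  rw [Function.iterate_add_apply, ← (hG.iterate (N * k)).2, Function.iterate_mul, hj]
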